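/- **Setting.** Let $A$ be a Hopf algebra over $\mathbb{C}$ with coproduct $\Delta$ and counit $\epsilon$, and let $(E,d)$ be a bicovariant first order differential calculus on $A$: $E$ is an $A$-bimodule, $d:A\to E$ is $\mathbb{C}$-linear with $d(ab)=(da)b+a\,db$, every element of $E$ is a finite sum $\sum a_k\,db_k$, and $\sum_k a_k\,db_k=0$ implies $\sum_k\Delta(a_k)(\mathrm{id}\otimes d)\Delta(b_k)=0$ and $\sum_k\Delta(a_k)(d\otimes\mathrm{id})\Delta(b_k)=0$. Thus $E$ is a bicovariant bimodule with coactions $\Delta_E(a\,db)=\Delta(a)(\mathrm{id}\otimes d)\Delta(b)$ and ${}_E\Delta(a\,db)=\Delta(a)(d\otimes \mathrm{id})\Delta(b)$, written $\Delta_E(m)=m_{(-1)}\otimes m_{(0)}$, ${}_E\Delta(m)=m_{(0)}\otimes m_{(1)}$. Let ${}_0E=\{m:\Delta_E(m)=1\otimes m\}$ and $E_0=\{m:{}_E\Delta(m)=m\otimes 1\}$, and assume that both are finite-dimensional. The bimodule $E\otimes_A E$ carries the codiagonal coactions. * The *braiding* is the unique $A$-bimodule map $\sigma:E\otimes_AE\to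 E\otimes_AE$ with $\sigma(\omega\otimes\eta)=\eta\otimes\omega$ for $\omega\in{}_0E$, $\eta\in E_0$; ${}_0\sigma$ is its restriction to ${}_0E\otimes_{\mathbb C}{}_0E={}_0(E\otimes_AE)$. If ${}_0\sigma$ is diagonalisable, ${}_0P_{\rm sym}$ denotes the idempotent of ${}_0E\otimes_{\mathbb C}{}_0E$ with range $\mathrm{Ker}({}_0\sigma-1)$ and kernel the sum of the eigenspaces of ${}_0\sigma$ for eigenvalues $\neq1$. * A *bi-invariant pseudo-Riemannian metric* is a right $A$-linear map $g:E\otimes_AE\to A$ with $g\circ\sigma=g$, such that $g(\rho\otimes\nu)=0$ for all $\nu$ implies $\rho=0$, and $(\mathrm{id}\otimes\epsilon g)\Delta_{E\otimes_AE}=g=(\epsilon g\otimes\mathrm{id})\,{}_{E\otimes_AE}\Delta$. * Two-forms are $\Omega^2=(E\otimes_AE)/\mathrm{Ker}(\sigma-1)$, with quotient map $\wedge$, and $d:E\to\Omega^2$ is given by $d(a\,db)=da\wedge db$. * A *connection* is a $\mathbb C$-linear map $\nabla:E\to E\otimes_AE$ with $\nabla(\rho a)=\nabla(\rho)a+\rho\otimes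 da$. It is left- (right-) covariant if it intertwines the left (right) coactions, and bicovariant if both hold. It is *torsionless* if $\wedge\circ\nabla+d=0$ on $E$. A left-covariant $\nabla$ is *compatible with $g$* if for all $\omega_1,\omega_2\in{}_0E$ and $a\in A$ $$\Pi^0(\omega_1\otimes\omega_2)\,a+g(\omega_1\otimes\omega_2)\,da=d\big(g(\omega_1\otimes\omega_2a)\big),\qquad \Pi^0=2(\mathrm{id}\otimes g)({}_0\sigma\otimes\mathrm{id})(\nabla\otimes\mathrm{id})\,{}_0P_{\rm sym}.$$ A *Levi-Civita connection* for $(E,d,g)$ is a left-covariant, torsionless connection compatible with $g$. **Deformation.** Let $\Omega$ be a normalised dual 2-cocycle on $A$: a convolution-invertible linear functional $\gamma$ on $A\otimes A$, with convolution inverse $\bar\gamma$, such that $\gamma(1\otimes a)=\epsilon(a)=\gamma(a\otimes1)$ and $\gamma(a_{(1)}\otimes b_{(1)})\gamma(a_{(2)}b_{(2)}\otimes c)=\gamma(b_{(1)}\otimes c_{(1)})\gamma(a\otimes b_{(2)}c_{(2)})$. Let $A_\Omega$ be the coalgebra $A$ with product $a*b=\gamma(a_{(1)}\otimes b_{(1)})\,a_{(2)}b_{(2)}\,\bar\gamma(a_{(3)}\otimes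 b_{(3)})$. Let $E_\Omega$ be the bicomodule $E$ with actions $a*m=\gamma(a_{(1)}\otimes m_{(-1)})\,a_{(2)}m_{(0)}\,\bar\gamma(a_{(3)}\otimes m_{(1)})$ and $m*a=\gamma(m_{(-1)}\otimes a_{(1)})\,m_{(0)}a_{(2)}\,\bar\gamma(m_{(1)}\otimes a_{(3)})$. Let $d_\Omega=d$, and let $\xi:E_\Omega\otimes_{A_\Omega}E_\Omega\to E\otimes_AE$ be the linear isomorphism $$\xi(m\otimes n)=\gamma(m_{(-1)}\otimes n_{(-1)})\,m_{(0)}\otimes n_{(0)}\,\bar\gamma(m_{(1)}\otimes n_{(1)}).$$ For $\sigma$, $g$, $\nabla$ as above put $\sigma_\Omega=\xi^{-1}\sigma\,\xi$, $g_\Omega=g\circ\xi$, $\nabla_\Omega=\xi^{-1}\circ\nabla$. **Theorem.** 1. $A_\Omega$ is a Hopf algebra and $(E_\Omega,d_\Omega)$ is a bicovariant first order differential calculus on $A_\Omega$ whose coactions are those of $E$. 2. The braiding $\sigma$ of $E$ exists and is unique, and $\sigma_\Omega$ is the unique braiding of $E_\Omega$. If ${}_0\sigma$ is diagonalisable, so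 is ${}_0(\sigma_\Omega)$. 3. If $g$ is a bi-invariant pseudo-Riemannian metric on $E$, then $g_\Omega$ is a bi-invariant pseudo-Riemannian metric on $E_\Omega$, and every bi-invariant pseudo-Riemannian metric on $E_\Omega$ is of this form. 4. Suppose that ${}_0\sigma$ is diagonalisable and $g$ is a bi-invariant pseudo-Riemannian metric on $E$. If $\nabla$ is a bicovariant Levi-Civita connection for $(E,d,g)$, then $\nabla_\Omega$ is a bicovariant Levi-Civita connection for $(E_\Omega,d_\Omega,g_\Omega)$. If moreover $\nabla$ is the only bicovariant Levi-Civita connection for $(E,d,g)$ (in particular, if it is the only Levi-Civita connection), then $\nabla_\Omega$ is the only bicovariant Levi-Civita connection for $(E_\Omega,d_\Omega,g_\Omega)$. -/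

import Mathlib

section

open scoped TensorProduct
open Coalgebra (comul counit)

noncomputable section

namespace BicovariantCalculus

section tensor_lemmas

variable {M N K M₁ M₂ M' N' K' M₁' M₂' : Type*}
    [AddCommGroup M] [Module ℂ M] [AddCommGroup N] [Module ℂ N] [AddCommGroup K] [Module ℂ K]
    [AddCommGroup M₁] [Module ℂ M₁] [AddCommGroup M₂] [Module ℂ M₂]
    [AddCommGroup M'] [Module ℂ M'] [AddCommGroup N'] [Module ℂ N'] [AddCommGroup K'] [Module ℂ K']
    [AddCommGroup M₁'] [Module ℂ M₁'] [AddCommGroup M₂'] [Module ℂ M₂']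

lemma interchange_map (f : M →ₗ[ℂ] M₁) (g : N →ₗ[ℂ] M₂) (h : M' →ₗ[ℂ] M₁') (j : N' →ₗ[ℂ] M₂')
    (u : M ⊗[ℂ] N) (v : M' ⊗[ℂ] N') :
    TensorProduct.tensorTensorTensorComm ℂ M₁ M₂ M₁' M₂'
      (TensorProduct.map f g u ⊗ₜ TensorProduct.map h j v) =
    TensorProduct.map (TensorProduct.map f h) (TensorProduct.map g j)
      (TensorProduct.tensorTensorTensorComm ℂ M N M' N' (u ⊗ₜ v)) :=
  LinearMap.congr_fun (TensorProduct.tensorTensorTensorComm_comp_map (R := ℂ) (f := f) (g := g)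
    (h := h) (j := j)) (u ⊗ₜ v)

lemma interchange_coassoc (α : M →ₗ[ℂ] M₁ ⊗[ℂ] M₂) (β : K →ₗ[ℂ] M₂ ⊗[ℂ] N)
    (α' : M' →ₗ[ℂ] M₁' ⊗[ℂ] M₂') (β' : K' →ₗ[ℂ] M₂' ⊗[ℂ] N')
    {u : M ⊗[ℂ] N} {w : M₁ ⊗[ℂ] K} {u' : M' ⊗[ℂ] N'} {w' : M₁' ⊗[ℂ] K'}
    (h : TensorProduct.assoc ℂ M₁ M₂ N (α.rTensor N u) = β.lTensor M₁ w)
    (h' : TensorProduct.assoc ℂ M₁' M₂' N' (α'.rTensor N' u') = β'.lTensor M₁' w') :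
    TensorProduct.assoc ℂ _ _ _
      (((TensorProduct.tensorTensorTensorComm ℂ M₁ M₂ M₁' M₂').toLinearMap ∘ₗ
        TensorProduct.map α α').rTensor (N ⊗[ℂ] N')
        (TensorProduct.tensorTensorTensorComm ℂ M N M' N' (u ⊗ₜ u'))) =
    ((TensorProduct.tensorTensorTensorComm ℂ M₂ N M₂' N').toLinearMap ∘ₗ
        TensorProduct.map β β').lTensor (M₁ ⊗[ℂ] M₁')
        (TensorProduct.tensorTensorTensorComm ℂ M₁ K M₁' K' (w ⊗ₜ w')) := by
  have hex : (TensorProduct.assoc ℂ _ _ _).toLinearMap ∘ₗ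
      (TensorProduct.tensorTensorTensorComm ℂ M₁ M₂ M₁' M₂').toLinearMap.rTensor (N ⊗[ℂ] N') ∘ₗ
      (TensorProduct.tensorTensorTensorComm ℂ (M₁ ⊗[ℂ] M₂) N (M₁' ⊗[ℂ] M₂') N').toLinearMap =
      (TensorProduct.tensorTensorTensorComm ℂ M₂ N M₂' N').toLinearMap.lTensor (M₁ ⊗[ℂ] M₁') ∘ₗ
      (TensorProduct.tensorTensorTensorComm ℂ M₁ (M₂ ⊗[ℂ] N) M₁' (M₂' ⊗[ℂ] N')).toLinearMap ∘ₗ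
      TensorProduct.map (TensorProduct.assoc ℂ M₁ M₂ N).toLinearMap
        (TensorProduct.assoc ℂ M₁' M₂' N').toLinearMap := by
    ext; simp
  have e := LinearMap.congr_fun hex (α.rTensor N u ⊗ₜ α'.rTensor N' u')
  simp only [LinearMap.comp_apply, TensorProduct.map_tmul, LinearEquiv.coe_coe, h, h'] at e
  rw [LinearMap.rTensor_comp_apply, LinearMap.lTensor_comp_apply]
  simp only [LinearMap.rTensor, LinearMap.lTensor] at e ⊢
  rw [interchange_map, interchange_map, TensorProduct.map_id, TensorProduct.map_id] at e
  exact e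

lemma contract_left {α : M →ₗ[ℂ] M₁ ⊗[ℂ] M₂} {β : K →ₗ[ℂ] M₂ ⊗[ℂ] N}
    {u : M ⊗[ℂ] N} {w : M₁ ⊗[ℂ] K}
    (h : TensorProduct.assoc ℂ M₁ M₂ N (α.rTensor N u) = β.lTensor M₁ w) (f : M₁ →ₗ[ℂ] ℂ) :
    β (TensorProduct.lid ℂ K (f.rTensor K w)) =
      TensorProduct.map ((TensorProduct.lid ℂ M₂).toLinearMap ∘ₗ f.rTensor M₂ ∘ₗ α) .id u := by
  have e₁ : β ∘ₗ (TensorProduct.lid ℂ K).toLinearMap ∘ₗ f.rTensor K =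
      (TensorProduct.lid ℂ _).toLinearMap ∘ₗ f.rTensor _ ∘ₗ β.lTensor M₁ := by ext; simp
  have e₂ : (TensorProduct.lid ℂ _).toLinearMap ∘ₗ f.rTensor _ ∘ₗ
      (TensorProduct.assoc ℂ M₁ M₂ N).toLinearMap =
      ((TensorProduct.lid ℂ M₂).toLinearMap ∘ₗ f.rTensor M₂).rTensor N := by
    ext; simp [TensorProduct.smul_tmul']
  have := LinearMap.congr_fun e₁ w
  have h₂ := LinearMap.congr_fun e₂ (α.rTensor N u)
  simp only [LinearMap.comp_apply, LinearEquiv.coe_coe] at this h₂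
  rw [this, ← h, h₂, ← LinearMap.rTensor_comp_apply]
  rfl

lemma contract_mid {α : M →ₗ[ℂ] M₁ ⊗[ℂ] M₂} {β : K →ₗ[ℂ] M₂ ⊗[ℂ] N}
    {u : M ⊗[ℂ] N} {w : M₁ ⊗[ℂ] K}
    (h : TensorProduct.assoc ℂ M₁ M₂ N (α.rTensor N u) = β.lTensor M₁ w) (f : M₂ →ₗ[ℂ] ℂ) :
    TensorProduct.map ((TensorProduct.rid ℂ M₁).toLinearMap ∘ₗ f.lTensor M₁ ∘ₗ α) .id u =
      TensorProduct.map .id ((TensorProduct.lid ℂ N).toLinearMap ∘ₗ f.rTensor N ∘ₗ β) w := by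
  have e : ((TensorProduct.lid ℂ N).toLinearMap ∘ₗ f.rTensor N).lTensor M₁ ∘ₗ
      (TensorProduct.assoc ℂ M₁ M₂ N).toLinearMap =
      ((TensorProduct.rid ℂ M₁).toLinearMap ∘ₗ f.lTensor M₁).rTensor N := by
    ext; simp [TensorProduct.smul_tmul']
  have h₂ := LinearMap.congr_fun e (α.rTensor N u)
  simp only [LinearMap.comp_apply (f := LinearMap.lTensor _ _), LinearEquiv.coe_coe] at h₂
  rw [h, ← LinearMap.rTensor_comp_apply, ← LinearMap.lTensor_comp_apply] at h₂
  exact h₂.symm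

lemma contract_right {α : M →ₗ[ℂ] M₁ ⊗[ℂ] M₂} {β : K →ₗ[ℂ] M₂ ⊗[ℂ] N}
    {u : M ⊗[ℂ] N} {w : M₁ ⊗[ℂ] K}
    (h : TensorProduct.assoc ℂ M₁ M₂ N (α.rTensor N u) = β.lTensor M₁ w) (f : N →ₗ[ℂ] ℂ) :
    α (TensorProduct.rid ℂ M (f.lTensor M u)) =
      TensorProduct.map .id ((TensorProduct.rid ℂ M₂).toLinearMap ∘ₗ f.lTensor M₂ ∘ₗ β) w := by
  have e₁ : α ∘ₗ (TensorProduct.rid ℂ M).toLinearMap ∘ₗ f.lTensor M =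
      (TensorProduct.rid ℂ _).toLinearMap ∘ₗ f.lTensor _ ∘ₗ α.rTensor N := by ext; simp
  have e₂ : (TensorProduct.rid ℂ _).toLinearMap ∘ₗ f.lTensor _ =
      ((TensorProduct.rid ℂ M₂).toLinearMap ∘ₗ f.lTensor M₂).lTensor M₁ ∘ₗ
        (TensorProduct.assoc ℂ M₁ M₂ N).toLinearMap := by
    ext; simp
  have h₁ := LinearMap.congr_fun e₁ u
  have h₂ := LinearMap.congr_fun e₂ (α.rTensor N u)
  simp only [LinearMap.comp_apply (f := LinearMap.lTensor _ _), LinearMap.comp_apply,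
    LinearEquiv.coe_coe] at h₁ h₂
  rw [h₁, h₂, h, ← LinearMap.lTensor_comp_apply]
  rfl

end tensor_lemmas

/-- A bicomodule over a complex coalgebra `C`. -/
@[ext]
structure Bicomodule (C X : Type*) [AddCommGroup C] [Module ℂ C] [Coalgebra ℂ C]
    [AddCommGroup X] [Module ℂ X] where
  lco : X →ₗ[ℂ] C ⊗[ℂ] X
  rco : X →ₗ[ℂ] X ⊗[ℂ] C
  lco_counit : ∀ x, TensorProduct.lid ℂ X ((counit (R := ℂ) (A := C)).rTensor X (lco x)) = x
  lco_coassoc : ∀ x, TensorProduct.assoc ℂ C C X ((comul (R := ℂ) (A := C)).rTensor X (lco x)) =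
    lco.lTensor C (lco x)
  rco_counit : ∀ x, TensorProduct.rid ℂ X ((counit (R := ℂ) (A := C)).lTensor X (rco x)) = x
  rco_coassoc : ∀ x, TensorProduct.assoc ℂ X C C (rco.rTensor C (rco x)) =
    (comul (R := ℂ) (A := C)).lTensor X (rco x)
  lco_rco : ∀ x, TensorProduct.assoc ℂ C X C (lco.rTensor C (rco x)) = rco.lTensor C (lco x)

namespace Bicomodule

variable {C X D Y : Type*}
    [AddCommGroup C] [Module ℂ C] [Coalgebra ℂ C] [AddCommGroup X] [Module ℂ X]
    [AddCommGroup D] [Module ℂ D] [Coalgebra ℂ D] [AddCommGroup Y] [Module ℂ Y]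

/-- `x ↦ f(x₍₋₁₎) x₍₀₎`. -/
def lop (B : Bicomodule C X) (f : C →ₗ[ℂ] ℂ) : X →ₗ[ℂ] X :=
  (TensorProduct.lid ℂ X).toLinearMap ∘ₗ f.rTensor X ∘ₗ B.lco

/-- `x ↦ x₍₀₎ f(x₍₁₎)`. -/
def rop (B : Bicomodule C X) (f : C →ₗ[ℂ] ℂ) : X →ₗ[ℂ] X :=
  (TensorProduct.rid ℂ X).toLinearMap ∘ₗ f.lTensor X ∘ₗ B.rco

/-- A coalgebra as a bicomodule over itself. -/
def self (C : Type*) [AddCommGroup C] [Module ℂ C] [Coalgebra ℂ C] : Bicomodule C C where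
  lco := comul
  rco := comul
  lco_counit x := by simp
  lco_coassoc x := by simp
  rco_counit x := by simp
  rco_coassoc x := by simp
  lco_rco x := by simp

lemma comul_tensor : comul (R := ℂ) (A := C ⊗[ℂ] D) =
    (TensorProduct.tensorTensorTensorComm ℂ C C D D).toLinearMap ∘ₗ
      TensorProduct.map comul comul := by
  simp only [TensorProduct.comul_def,
      TensorProduct.AlgebraTensorModule.tensorTensorTensorComm_eq,
      TensorProduct.AlgebraTensorModule.map_eq]

/-- The external tensor product of bicomodules, a bicomodule over `C ⊗ D`. -/
def tensor (B : Bicomodule C X) (B' : Bicomodule D Y) : Bicomodule (C ⊗[ℂ] D) (X ⊗[ℂ] Y) where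
  lco := (TensorProduct.tensorTensorTensorComm ℂ C X D Y).toLinearMap ∘ₗ
    TensorProduct.map B.lco B'.lco
  rco := (TensorProduct.tensorTensorTensorComm ℂ X C Y D).toLinearMap ∘ₗ
    TensorProduct.map B.rco B'.rco
  lco_counit t := by
    have e : (TensorProduct.lid ℂ (X ⊗[ℂ] Y)).toLinearMap ∘ₗ
        (counit (R := ℂ) (A := C ⊗[ℂ] D)).rTensor (X ⊗[ℂ] Y) ∘ₗ
        (TensorProduct.tensorTensorTensorComm ℂ C X D Y).toLinearMap =
        TensorProduct.map ((TensorProduct.lid ℂ X).toLinearMap ∘ₗ counit.rTensor X)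
          ((TensorProduct.lid ℂ Y).toLinearMap ∘ₗ counit.rTensor Y) := by
      ext; simp [TensorProduct.smul_tmul', smul_smul, mul_comm]
    induction t using TensorProduct.induction_on with
    | zero => simp
    | add u v hu hv => simp only [map_add, hu, hv]
    | tmul x y =>
      exact (LinearMap.congr_fun e (B.lco x ⊗ₜ B'.lco y)).trans
        (congrArg₂ (· ⊗ₜ[ℂ] ·) (B.lco_counit x) (B'.lco_counit y))
  rco_counit t := by
    have e : (TensorProduct.rid ℂ (X ⊗[ℂ] Y)).toLinearMap ∘ₗ
        (counit (R := ℂ) (A := C ⊗[ℂ] D)).lTensor (X ⊗[ℂ] Y) ∘ₗ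
        (TensorProduct.tensorTensorTensorComm ℂ X C Y D).toLinearMap =
        TensorProduct.map ((TensorProduct.rid ℂ X).toLinearMap ∘ₗ counit.lTensor X)
          ((TensorProduct.rid ℂ Y).toLinearMap ∘ₗ counit.lTensor Y) := by
      ext; simp [TensorProduct.smul_tmul', smul_smul, mul_comm]
    induction t using TensorProduct.induction_on with
    | zero => simp
    | add u v hu hv => simp only [map_add, hu, hv]
    | tmul x y =>
      exact (LinearMap.congr_fun e (B.rco x ⊗ₜ B'.rco y)).trans
        (congrArg₂ (· ⊗ₜ[ℂ] ·) (B.rco_counit x) (B'.rco_counit y))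
  lco_coassoc t := by
    rw [comul_tensor]
    induction t using TensorProduct.induction_on with
    | zero => simp
    | add u v hu hv => simp only [map_add, hu, hv]
    | tmul x y => exact interchange_coassoc _ _ _ _ (B.lco_coassoc x) (B'.lco_coassoc y)
  rco_coassoc t := by
    rw [comul_tensor]
    induction t using TensorProduct.induction_on with
    | zero => simp
    | add u v hu hv => simp only [map_add, hu, hv]
    | tmul x y => exact interchange_coassoc _ _ _ _ (B.rco_coassoc x) (B'.rco_coassoc y)
  lco_rco t := by
    induction t using TensorProduct.induction_on with
    | zero => simp
    | add u v hu hv => simp only [map_add, hu, hv]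
    | tmul x y => exact interchange_coassoc _ _ _ _ (B.lco_rco x) (B'.lco_rco y)

lemma self_tensor : (self C).tensor (self D) = self (C ⊗[ℂ] D) := by
  ext : 1
  · exact comul_tensor.symm
  · exact comul_tensor.symm

variable (B : Bicomodule C X)

lemma lco_lop (f : C →ₗ[ℂ] ℂ) (x : X) :
    B.lco (B.lop f x) = TensorProduct.map ((self C).lop f) .id (B.lco x) :=
  contract_left (B.lco_coassoc x) f

lemma rco_lop (f : C →ₗ[ℂ] ℂ) (x : X) :
    B.rco (B.lop f x) = TensorProduct.map (B.lop f) .id (B.rco x) :=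
  contract_left (B.lco_rco x) f

lemma lco_swap (f : C →ₗ[ℂ] ℂ) (x : X) :
    TensorProduct.map ((self C).rop f) .id (B.lco x) =
      TensorProduct.map .id (B.lop f) (B.lco x) :=
  contract_mid (B.lco_coassoc x) f

lemma rco_swap (f : C →ₗ[ℂ] ℂ) (x : X) :
    TensorProduct.map (B.rop f) .id (B.rco x) =
      TensorProduct.map .id ((self C).lop f) (B.rco x) :=
  contract_mid (B.rco_coassoc x) f

lemma rco_rop (f : C →ₗ[ℂ] ℂ) (x : X) :
    B.rco (B.rop f x) = TensorProduct.map .id ((self C).rop f) (B.rco x) :=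
  contract_right (B.rco_coassoc x) f

lemma lco_rop (f : C →ₗ[ℂ] ℂ) (x : X) :
    B.lco (B.rop f x) = TensorProduct.map .id (B.rop f) (B.lco x) :=
  contract_right (B.lco_rco x) f

lemma lop_one (x : X) : B.lop (1 : WithConv (C →ₗ[ℂ] ℂ)).ofConv x = x := B.lco_counit x

lemma rop_one (x : X) : B.rop (1 : WithConv (C →ₗ[ℂ] ℂ)).ofConv x = x := B.rco_counit x

lemma lop_lop (f h : WithConv (C →ₗ[ℂ] ℂ)) (x : X) :
    B.lop f.ofConv (B.lop h.ofConv x) = B.lop (h * f).ofConv x := by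
  have e : f.ofConv ∘ₗ (self C).lop h.ofConv = (h * f).ofConv := by
    have : f.ofConv ∘ₗ (TensorProduct.lid ℂ C).toLinearMap ∘ₗ h.ofConv.rTensor C =
        LinearMap.mul' ℂ ℂ ∘ₗ TensorProduct.map h.ofConv f.ofConv := by ext; simp
    exact LinearMap.ext fun c ↦ LinearMap.congr_fun this (comul c)
  rw [← e]
  change TensorProduct.lid ℂ X (f.ofConv.rTensor X (B.lco (B.lop h.ofConv x))) =
    TensorProduct.lid ℂ X ((f.ofConv ∘ₗ (self C).lop h.ofConv).rTensor X (B.lco x))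
  rw [lco_lop, LinearMap.rTensor_comp_apply]
  rfl

lemma rop_rop (f h : WithConv (C →ₗ[ℂ] ℂ)) (x : X) :
    B.rop f.ofConv (B.rop h.ofConv x) = B.rop (f * h).ofConv x := by
  have e : f.ofConv ∘ₗ (self C).rop h.ofConv = (f * h).ofConv := by
    have : f.ofConv ∘ₗ (TensorProduct.rid ℂ C).toLinearMap ∘ₗ h.ofConv.lTensor C =
        LinearMap.mul' ℂ ℂ ∘ₗ TensorProduct.map f.ofConv h.ofConv := by
      ext; simp [mul_comm]
    exact LinearMap.ext fun c ↦ LinearMap.congr_fun this (comul c)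
  rw [← e]
  change TensorProduct.rid ℂ X (f.ofConv.lTensor X (B.rco (B.rop h.ofConv x))) =
    TensorProduct.rid ℂ X ((f.ofConv ∘ₗ (self C).rop h.ofConv).lTensor X (B.rco x))
  rw [rco_rop, LinearMap.lTensor_comp_apply]
  rfl

lemma lop_rop (f h : C →ₗ[ℂ] ℂ) (x : X) :
    B.lop f (B.rop h x) = B.rop h (B.lop f x) := by
  have e : (TensorProduct.lid ℂ X).toLinearMap ∘ₗ f.rTensor X ∘ₗ
      TensorProduct.map .id (B.rop h) =
      B.rop h ∘ₗ (TensorProduct.lid ℂ X).toLinearMap ∘ₗ f.rTensor X := by ext; simp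
  conv_lhs => rw [lop]
  simp only [LinearMap.comp_apply, lco_rop]
  exact LinearMap.congr_fun e (B.lco x)

end Bicomodule

namespace Bicomodule

section hom

variable {C X D Y C' U D' V : Type*}
    [AddCommGroup C] [Module ℂ C] [Coalgebra ℂ C] [AddCommGroup X] [Module ℂ X]
    [AddCommGroup D] [Module ℂ D] [Coalgebra ℂ D] [AddCommGroup Y] [Module ℂ Y]
    [AddCommGroup C'] [Module ℂ C'] [Coalgebra ℂ C'] [AddCommGroup U] [Module ℂ U]
    [AddCommGroup D'] [Module ℂ D'] [Coalgebra ℂ D'] [AddCommGroup V] [Module ℂ V]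

/-- `F` intertwines the coactions along the linear map `φ` of coalgebras. -/
def IsHom (B : Bicomodule C X) (B' : Bicomodule D Y) (φ : C →ₗ[ℂ] D) (F : X →ₗ[ℂ] Y) : Prop :=
  (∀ x, B'.lco (F x) = TensorProduct.map φ F (B.lco x)) ∧
    ∀ x, B'.rco (F x) = TensorProduct.map F φ (B.rco x)

variable {B : Bicomodule C X} {B' : Bicomodule D Y} {φ : C →ₗ[ℂ] D} {F : X →ₗ[ℂ] Y}

lemma IsHom.lop (h : IsHom B B' φ F) (f : D →ₗ[ℂ] ℂ) (x : X) :
    B'.lop f (F x) = F (B.lop (f ∘ₗ φ) x) := by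
  have e : (TensorProduct.lid ℂ Y).toLinearMap ∘ₗ f.rTensor Y ∘ₗ TensorProduct.map φ F =
      F ∘ₗ (TensorProduct.lid ℂ X).toLinearMap ∘ₗ (f ∘ₗ φ).rTensor X := by ext; simp
  change TensorProduct.lid ℂ Y (f.rTensor Y (B'.lco (F x))) = _
  rw [h.1]
  exact LinearMap.congr_fun e (B.lco x)

lemma IsHom.rop (h : IsHom B B' φ F) (f : D →ₗ[ℂ] ℂ) (x : X) :
    B'.rop f (F x) = F (B.rop (f ∘ₗ φ) x) := by
  have e : (TensorProduct.rid ℂ Y).toLinearMap ∘ₗ f.lTensor Y ∘ₗ TensorProduct.map F φ =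
      F ∘ₗ (TensorProduct.rid ℂ X).toLinearMap ∘ₗ (f ∘ₗ φ).lTensor X := by ext; simp
  change TensorProduct.rid ℂ Y (f.lTensor Y (B'.rco (F x))) = _
  rw [h.2]
  exact LinearMap.congr_fun e (B.rco x)

lemma IsHom.id (B : Bicomodule C X) : IsHom B B .id .id := by
  constructor <;> simp

lemma IsHom.tensor {E : Bicomodule C' U} {E' : Bicomodule D' V} {ψ : C' →ₗ[ℂ] D'} {G : U →ₗ[ℂ] V}
    (h : IsHom B B' φ F) (h' : IsHom E E' ψ G) :
    IsHom (B.tensor E) (B'.tensor E') (TensorProduct.map φ ψ) (TensorProduct.map F G) := by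
  constructor <;> intro t <;> induction t using TensorProduct.induction_on with
  | zero => simp
  | add u v hu hv => simp only [map_add, hu, hv]
  | tmul x y =>
    simp only [Bicomodule.tensor, TensorProduct.map_tmul, LinearMap.comp_apply, h.1, h'.1,
      h.2, h'.2, LinearEquiv.coe_coe, interchange_map]

lemma isHom_assoc (B : Bicomodule C X) (B' : Bicomodule D Y) (E : Bicomodule C' U) :
    IsHom ((B.tensor B').tensor E) (B.tensor (B'.tensor E))
      (TensorProduct.assoc ℂ C D C').toLinearMap (TensorProduct.assoc ℂ X Y U).toLinearMap := by
  have e₁ : (TensorProduct.tensorTensorTensorComm ℂ C X _ _).toLinearMap ∘ₗ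
      (TensorProduct.tensorTensorTensorComm ℂ D Y C' U).toLinearMap.lTensor (C ⊗[ℂ] X) ∘ₗ
      (TensorProduct.assoc ℂ _ _ _).toLinearMap =
      TensorProduct.map (TensorProduct.assoc ℂ C D C').toLinearMap
        (TensorProduct.assoc ℂ X Y U).toLinearMap ∘ₗ
      (TensorProduct.tensorTensorTensorComm ℂ _ _ C' U).toLinearMap ∘ₗ
      (TensorProduct.tensorTensorTensorComm ℂ C X D Y).toLinearMap.rTensor (C' ⊗[ℂ] U) := by
    ext; simp
  have e₂ : (TensorProduct.tensorTensorTensorComm ℂ X C _ _).toLinearMap ∘ₗ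
      (TensorProduct.tensorTensorTensorComm ℂ Y D U C').toLinearMap.lTensor (X ⊗[ℂ] C) ∘ₗ
      (TensorProduct.assoc ℂ _ _ _).toLinearMap =
      TensorProduct.map (TensorProduct.assoc ℂ X Y U).toLinearMap
        (TensorProduct.assoc ℂ C D C').toLinearMap ∘ₗ
      (TensorProduct.tensorTensorTensorComm ℂ _ _ U C').toLinearMap ∘ₗ
      (TensorProduct.tensorTensorTensorComm ℂ X C Y D).toLinearMap.rTensor (U ⊗[ℂ] C') := by
    ext; simp
  have k₁ : (B.tensor (B'.tensor E)).lco ∘ₗ (TensorProduct.assoc ℂ X Y U).toLinearMap =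
      TensorProduct.map (TensorProduct.assoc ℂ C D C').toLinearMap
        (TensorProduct.assoc ℂ X Y U).toLinearMap ∘ₗ ((B.tensor B').tensor E).lco :=
    TensorProduct.ext_threefold fun x y z ↦
      LinearMap.congr_fun e₁ ((B.lco x ⊗ₜ B'.lco y) ⊗ₜ E.lco z)
  have k₂ : (B.tensor (B'.tensor E)).rco ∘ₗ (TensorProduct.assoc ℂ X Y U).toLinearMap =
      TensorProduct.map (TensorProduct.assoc ℂ X Y U).toLinearMap
        (TensorProduct.assoc ℂ C D C').toLinearMap ∘ₗ ((B.tensor B').tensor E).rco :=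
    TensorProduct.ext_threefold fun x y z ↦
      LinearMap.congr_fun e₂ ((B.rco x ⊗ₜ B'.rco y) ⊗ₜ E.rco z)
  exact ⟨LinearMap.congr_fun k₁, LinearMap.congr_fun k₂⟩

end hom

end Bicomodule

/-- A normalised dual 2-cocycle on a bialgebra `A`, as an invertible element of the dual algebra
of the coalgebra `A ⊗ A` (whose product is convolution). The comultiplication and the counit
of the dual are `f ↦ (a ⊗ b ↦ f (a b))` and `f ↦ f 1`. -/
structure DualTwoCocycle (A : Type*) [Ring A] [Bialgebra ℂ A] where
  Ω : (WithConv (A ⊗[ℂ] A →ₗ[ℂ] ℂ))ˣ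
  counit_left : ∀ a, Ω.val.ofConv (1 ⊗ₜ a) = counit (R := ℂ) a
  counit_right : ∀ a, Ω.val.ofConv (a ⊗ₜ 1) = counit (R := ℂ) a
  cocycle :
    WithConv.toConv (LinearMap.mul' ℂ ℂ ∘ₗ
        TensorProduct.map Ω.val.ofConv (counit (R := ℂ) (A := A))) *
      WithConv.toConv (Ω.val.ofConv ∘ₗ TensorProduct.map (LinearMap.mul' ℂ A) .id) =
    WithConv.toConv (LinearMap.mul' ℂ ℂ ∘ₗ
        TensorProduct.map (counit (R := ℂ) (A := A)) Ω.val.ofConv ∘ₗ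
          (TensorProduct.assoc ℂ A A A).toLinearMap) *
      WithConv.toConv (Ω.val.ofConv ∘ₗ TensorProduct.map .id (LinearMap.mul' ℂ A) ∘ₗ
          (TensorProduct.assoc ℂ A A A).toLinearMap)

namespace DualTwoCocycle

variable {A : Type*} [Ring A] [Bialgebra ℂ A] (𝓒 : DualTwoCocycle A)

/-- The functional `γ` on `A ⊗ A`. -/
def γ : A ⊗[ℂ] A →ₗ[ℂ] ℂ := 𝓒.Ω.val.ofConv

/-- The convolution inverse of `γ`. -/
def γinv : A ⊗[ℂ] A →ₗ[ℂ] ℂ := (𝓒.Ω⁻¹).val.ofConv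

section pull

variable {C D : Type*} [AddCommGroup C] [Module ℂ C] [Coalgebra ℂ C]
  [AddCommGroup D] [Module ℂ D] [Coalgebra ℂ D]

/-- The dual algebra homomorphism of a coalgebra homomorphism. -/
def pull (φ : C →ₗc[ℂ] D) : WithConv (D →ₗ[ℂ] ℂ) →* WithConv (C →ₗ[ℂ] ℂ) where
  toFun f := WithConv.toConv (f.ofConv ∘ₗ φ.toLinearMap)
  map_one' := by
    ext c
    simp
  map_mul' f g := by
    have := LinearMap.convMul_comp_coalgHom_distrib f g φ
    exact WithConv.ofConv_injective this

end pull

/-- `(a ⊗ b) ⊗ c ↦ ε(c) a ⊗ b`. -/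
def face₃ (A : Type*) [Ring A] [Bialgebra ℂ A] : (A ⊗[ℂ] A) ⊗[ℂ] A →ₗc[ℂ] A ⊗[ℂ] A :=
  (Coalgebra.TensorProduct.rid ℂ ℂ (A ⊗[ℂ] A)).toCoalgHom.comp
    (Coalgebra.TensorProduct.map (CoalgHom.id ℂ _) (Coalgebra.counitCoalgHom ℂ A))

/-- `(a ⊗ b) ⊗ c ↦ ε(a) b ⊗ c`. -/
def face₀ (A : Type*) [Ring A] [Bialgebra ℂ A] : (A ⊗[ℂ] A) ⊗[ℂ] A →ₗc[ℂ] A ⊗[ℂ] A :=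
  (Coalgebra.TensorProduct.lid ℂ (A ⊗[ℂ] A)).toCoalgHom.comp
    ((Coalgebra.TensorProduct.map (Coalgebra.counitCoalgHom ℂ A) (CoalgHom.id ℂ _)).comp
      (Coalgebra.TensorProduct.assoc ℂ ℂ A A A).toCoalgHom)

/-- `(a ⊗ b) ⊗ c ↦ a b ⊗ c`. -/
def face₂ (A : Type*) [Ring A] [Bialgebra ℂ A] : (A ⊗[ℂ] A) ⊗[ℂ] A →ₗc[ℂ] A ⊗[ℂ] A :=
  Coalgebra.TensorProduct.map (Bialgebra.mulCoalgHom ℂ A) (CoalgHom.id ℂ A)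

/-- `(a ⊗ b) ⊗ c ↦ a ⊗ b c`. -/
def face₁ (A : Type*) [Ring A] [Bialgebra ℂ A] : (A ⊗[ℂ] A) ⊗[ℂ] A →ₗc[ℂ] A ⊗[ℂ] A :=
  (Coalgebra.TensorProduct.map (CoalgHom.id ℂ A) (Bialgebra.mulCoalgHom ℂ A)).comp
      (Coalgebra.TensorProduct.assoc ℂ ℂ A A A).toCoalgHom

lemma cocycle' : Units.map (pull (face₃ A)) 𝓒.Ω * Units.map (pull (face₂ A)) 𝓒.Ω =
    Units.map (pull (face₀ A)) 𝓒.Ω * Units.map (pull (face₁ A)) 𝓒.Ω := by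
  ext1
  have h₃ : pull (face₃ A) 𝓒.Ω.val = WithConv.toConv (LinearMap.mul' ℂ ℂ ∘ₗ
        TensorProduct.map 𝓒.Ω.val.ofConv (counit (R := ℂ) (A := A))) := by
    apply WithConv.ofConv_injective
    ext a b c
    simp [pull, face₃, mul_comm]
  have h₀ : pull (face₀ A) 𝓒.Ω.val = WithConv.toConv (LinearMap.mul' ℂ ℂ ∘ₗ
        TensorProduct.map (counit (R := ℂ) (A := A)) 𝓒.Ω.val.ofConv ∘ₗ
          (TensorProduct.assoc ℂ A A A).toLinearMap) := by
    apply WithConv.ofConv_injective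
    ext a b c
    simp [pull, face₀]
  rw [Units.val_mul, Units.val_mul, Units.coe_map, Units.coe_map, Units.coe_map, Units.coe_map]
  change pull (face₃ A) 𝓒.Ω.val * pull (face₂ A) 𝓒.Ω.val =
    pull (face₀ A) 𝓒.Ω.val * pull (face₁ A) 𝓒.Ω.val
  rw [h₃, h₀]
  exact 𝓒.cocycle

end DualTwoCocycle

namespace Bicomodule

variable {C X D Y : Type*}
    [AddCommGroup C] [Module ℂ C] [Coalgebra ℂ C] [AddCommGroup X] [Module ℂ X]
    [AddCommGroup D] [Module ℂ D] [Coalgebra ℂ D] [AddCommGroup Y] [Module ℂ Y]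

/-- `x ↦ u(x₍₋₁₎) x₍₀₎ u⁻¹(x₍₁₎)` for an invertible element `u` of the dual algebra. -/
def ad (B : Bicomodule C X) (u : (WithConv (C →ₗ[ℂ] ℂ))ˣ) : X →ₗ[ℂ] X :=
  B.lop u.val.ofConv ∘ₗ B.rop u⁻¹.val.ofConv

lemma ad_ad (B : Bicomodule C X) (u v : (WithConv (C →ₗ[ℂ] ℂ))ˣ) (x : X) :
    B.ad u (B.ad v x) = B.ad (v * u) x := by
  simp only [ad, LinearMap.comp_apply]
  rw [← lop_rop, lop_lop, rop_rop, Units.val_mul, mul_inv_rev, Units.val_mul]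

lemma ad_one (B : Bicomodule C X) (x : X) : B.ad 1 x = x := by
  simp only [ad, LinearMap.comp_apply, inv_one, Units.val_one, lop_one, rop_one]

lemma IsHom.ad {B : Bicomodule C X} {B' : Bicomodule D Y} {φ : C →ₗc[ℂ] D} {F : X →ₗ[ℂ] Y}
    (h : IsHom B B' φ.toLinearMap F) (u : (WithConv (D →ₗ[ℂ] ℂ))ˣ) (x : X) :
    B'.ad u (F x) = F (B.ad (Units.map (DualTwoCocycle.pull φ) u) x) := by
  simp only [Bicomodule.ad, LinearMap.comp_apply]
  rw [h.rop, h.lop]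
  rfl

lemma lop_tensor (B : Bicomodule C X) (B' : Bicomodule D Y) (f : C →ₗ[ℂ] ℂ) (f' : D →ₗ[ℂ] ℂ) :
    (B.tensor B').lop (LinearMap.mul' ℂ ℂ ∘ₗ TensorProduct.map f f') =
      TensorProduct.map (B.lop f) (B'.lop f') := by
  have e : (TensorProduct.lid ℂ (X ⊗[ℂ] Y)).toLinearMap ∘ₗ
      (LinearMap.mul' ℂ ℂ ∘ₗ TensorProduct.map f f').rTensor (X ⊗[ℂ] Y) ∘ₗ
      (TensorProduct.tensorTensorTensorComm ℂ C X D Y).toLinearMap =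
      TensorProduct.map ((TensorProduct.lid ℂ X).toLinearMap ∘ₗ f.rTensor X)
        ((TensorProduct.lid ℂ Y).toLinearMap ∘ₗ f'.rTensor Y) := by
    ext; simp [TensorProduct.smul_tmul', smul_smul, mul_comm]
  exact TensorProduct.ext' fun x y ↦ LinearMap.congr_fun e (B.lco x ⊗ₜ B'.lco y)

lemma rop_tensor (B : Bicomodule C X) (B' : Bicomodule D Y) (f : C →ₗ[ℂ] ℂ) (f' : D →ₗ[ℂ] ℂ) :
    (B.tensor B').rop (LinearMap.mul' ℂ ℂ ∘ₗ TensorProduct.map f f') =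
      TensorProduct.map (B.rop f) (B'.rop f') := by
  have e : (TensorProduct.rid ℂ (X ⊗[ℂ] Y)).toLinearMap ∘ₗ
      (LinearMap.mul' ℂ ℂ ∘ₗ TensorProduct.map f f').lTensor (X ⊗[ℂ] Y) ∘ₗ
      (TensorProduct.tensorTensorTensorComm ℂ X C Y D).toLinearMap =
      TensorProduct.map ((TensorProduct.rid ℂ X).toLinearMap ∘ₗ f.lTensor X)
        ((TensorProduct.rid ℂ Y).toLinearMap ∘ₗ f'.lTensor Y) := by
    ext; simp [TensorProduct.smul_tmul', smul_smul, mul_comm]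
  exact TensorProduct.ext' fun x y ↦ LinearMap.congr_fun e (B.rco x ⊗ₜ B'.rco y)

end Bicomodule

namespace DualTwoCocycle

open Bicomodule

variable {A : Type*} [Ring A] [Bialgebra ℂ A] (𝓒 : DualTwoCocycle A)

section twist

variable {X Y Z U V W : Type*} [AddCommGroup X] [Module ℂ X] [AddCommGroup Y] [Module ℂ Y]
  [AddCommGroup Z] [Module ℂ Z] [AddCommGroup U] [Module ℂ U] [AddCommGroup V] [Module ℂ V]
  [AddCommGroup W] [Module ℂ W]
  (BX : Bicomodule A X) (BY : Bicomodule A Y) (BZ : Bicomodule A Z)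
  (BU : Bicomodule A U) (BV : Bicomodule A V)

/-- The deformation of a bilinear map: `γ(x₍₋₁₎ ⊗ y₍₋₁₎) μ(x₍₀₎ ⊗ y₍₀₎) γ⁻¹(x₍₁₎ ⊗ y₍₁₎)`. -/
def deform (μ : X ⊗[ℂ] Y →ₗ[ℂ] Z) : X ⊗[ℂ] Y →ₗ[ℂ] Z := μ ∘ₗ (BX.tensor BY).ad 𝓒.Ω

/-- The deformed product of `A`: `a ⊗ b ↦ γ(a₍₁₎ ⊗ b₍₁₎) a₍₂₎ b₍₂₎ γ⁻¹(a₍₃₎ ⊗ b₍₃₎)`. -/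
def mulΩ : A ⊗[ℂ] A →ₗ[ℂ] A := 𝓒.deform (self A) (self A) (LinearMap.mul' ℂ A)

variable {BX BY BZ BU BV}

lemma deform_isHom {μ : X ⊗[ℂ] Y →ₗ[ℂ] Z}
    (h : IsHom (BX.tensor BY) BZ (LinearMap.mul' ℂ A) μ) :
    IsHom (BX.tensor BY) BZ 𝓒.mulΩ (𝓒.deform BX BY μ) := by
  set S := self (A ⊗[ℂ] A)
  set T := BX.tensor BY
  have hr : S.rop 𝓒.γinv ∘ₗ S.rop 𝓒.γ = .id :=
    LinearMap.ext fun t ↦ (S.rop_rop 𝓒.Ω⁻¹.val 𝓒.Ω.val t).trans (by simp [rop_one])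
  have hl : S.lop 𝓒.γ ∘ₗ S.lop 𝓒.γinv = .id :=
    LinearMap.ext fun t ↦ (S.lop_lop 𝓒.Ω.val 𝓒.Ω⁻¹.val t).trans (by simp [lop_one])
  have hm : 𝓒.mulΩ = LinearMap.mul' ℂ A ∘ₗ S.lop 𝓒.γ ∘ₗ S.rop 𝓒.γinv := by
    rw [mulΩ, deform, self_tensor]
    rfl
  have hc : T.lop 𝓒.γ ∘ₗ T.rop 𝓒.γinv = T.rop 𝓒.γinv ∘ₗ T.lop 𝓒.γ :=
    LinearMap.ext fun t ↦ T.lop_rop _ _ t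
  have hc' : S.lop 𝓒.γ ∘ₗ S.rop 𝓒.γinv = S.rop 𝓒.γinv ∘ₗ S.lop 𝓒.γ :=
    LinearMap.ext fun t ↦ S.lop_rop _ _ t
  constructor <;> intro t
  · change BZ.lco (μ (T.lop 𝓒.γ (T.rop 𝓒.γinv t))) = _
    rw [h.1, lco_lop, lco_rop, hm]
    change _ = TensorProduct.map _ (μ ∘ₗ T.lop 𝓒.γ ∘ₗ T.rop 𝓒.γinv) _
    rw [hc]
    have e := congrArg (TensorProduct.map (LinearMap.mul' ℂ A ∘ₗ S.lop 𝓒.γ ∘ₗ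
      S.rop 𝓒.γinv) (μ ∘ₗ T.rop 𝓒.γinv)) (T.lco_swap 𝓒.γ t)
    simp only [TensorProduct.map_map, LinearMap.comp_assoc,
      LinearMap.comp_id, LinearMap.id_comp] at e ⊢
    change TensorProduct.map (_ ∘ₗ _ ∘ₗ S.rop 𝓒.γinv ∘ₗ S.rop 𝓒.γ) _ _ = _ at e
    rw [hr] at e
    exact e
  · change BZ.rco (μ (T.lop 𝓒.γ (T.rop 𝓒.γinv t))) = _
    rw [h.2, rco_lop, rco_rop, hm]
    change _ = TensorProduct.map (μ ∘ₗ T.lop 𝓒.γ ∘ₗ T.rop 𝓒.γinv) _ _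
    rw [hc']
    have e := congrArg (TensorProduct.map (μ ∘ₗ T.lop 𝓒.γ) (LinearMap.mul' ℂ A ∘ₗ
      S.rop 𝓒.γinv ∘ₗ S.lop 𝓒.γ)) (T.rco_swap 𝓒.γinv t)
    simp only [TensorProduct.map_map, LinearMap.comp_assoc,
      LinearMap.comp_id, LinearMap.id_comp] at e ⊢
    change _ = TensorProduct.map _ (_ ∘ₗ _ ∘ₗ S.lop 𝓒.γ ∘ₗ S.lop 𝓒.γinv) _ at e
    rw [hl] at e
    exact e.symm

lemma ad_face₃ (u : (WithConv (A ⊗[ℂ] A →ₗ[ℂ] ℂ))ˣ) (t : (X ⊗[ℂ] Y) ⊗[ℂ] Z) :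
    ((BX.tensor BY).tensor BZ).ad (Units.map (pull (face₃ A)) u) t =
      ((BX.tensor BY).ad u).rTensor Z t := by
  have e (f : WithConv (A ⊗[ℂ] A →ₗ[ℂ] ℂ)) : (pull (face₃ A) f).ofConv =
      LinearMap.mul' ℂ ℂ ∘ₗ TensorProduct.map f.ofConv (counit (R := ℂ) (A := A)) := by
    ext a b c
    simp [pull, face₃, mul_comm]
  have e₁ : BZ.lop (counit (R := ℂ) (A := A)) = .id := LinearMap.ext BZ.lco_counit
  have e₂ : BZ.rop (counit (R := ℂ) (A := A)) = .id := LinearMap.ext BZ.rco_counit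
  rw [Bicomodule.ad, ← map_inv, Units.coe_map, Units.coe_map, e, e, lop_tensor,
    rop_tensor, e₁, e₂, ← TensorProduct.map_comp]
  rfl

lemma ad_face₀ (u : (WithConv (A ⊗[ℂ] A →ₗ[ℂ] ℂ))ˣ) (t : (X ⊗[ℂ] Y) ⊗[ℂ] Z) :
    TensorProduct.assoc ℂ X Y Z
        (((BX.tensor BY).tensor BZ).ad (Units.map (pull (face₀ A)) u) t) =
      ((BY.tensor BZ).ad u).lTensor X (TensorProduct.assoc ℂ X Y Z t) := by
  have e (f : WithConv (A ⊗[ℂ] A →ₗ[ℂ] ℂ)) : (pull (face₀ A) f).ofConv =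
      (LinearMap.mul' ℂ ℂ ∘ₗ TensorProduct.map (counit (R := ℂ) (A := A)) f.ofConv) ∘ₗ
        (TensorProduct.assoc ℂ A A A).toLinearMap := by
    ext a b c
    simp [pull, face₀]
  have e₁ : BX.lop (counit (R := ℂ) (A := A)) = .id := LinearMap.ext BX.lco_counit
  have e₂ : BX.rop (counit (R := ℂ) (A := A)) = .id := LinearMap.ext BX.rco_counit
  have k := isHom_assoc BX BY BZ
  rw [Bicomodule.ad, ← map_inv, Units.coe_map, Units.coe_map, e, e,
    LinearMap.comp_apply, ← LinearEquiv.coe_coe, ← k.lop, ← k.rop, lop_tensor,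
    rop_tensor, e₁, e₂, ← LinearMap.comp_apply, ← TensorProduct.map_comp]
  rfl

lemma ad_face₂ {μ : X ⊗[ℂ] Y →ₗ[ℂ] U} (h : IsHom (BX.tensor BY) BU (LinearMap.mul' ℂ A) μ)
    (u : (WithConv (A ⊗[ℂ] A →ₗ[ℂ] ℂ))ˣ) (t : (X ⊗[ℂ] Y) ⊗[ℂ] Z) :
    (BU.tensor BZ).ad u (μ.rTensor Z t) =
      μ.rTensor Z (((BX.tensor BY).tensor BZ).ad (Units.map (pull (face₂ A)) u) t) :=
  IsHom.ad (φ := face₂ A) (h.tensor (IsHom.id BZ)) u t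

lemma ad_face₁ {μ : Y ⊗[ℂ] Z →ₗ[ℂ] V} (h : IsHom (BY.tensor BZ) BV (LinearMap.mul' ℂ A) μ)
    (u : (WithConv (A ⊗[ℂ] A →ₗ[ℂ] ℂ))ˣ) (t : (X ⊗[ℂ] Y) ⊗[ℂ] Z) :
    (BX.tensor BV).ad u (μ.lTensor X (TensorProduct.assoc ℂ X Y Z t)) =
      μ.lTensor X (TensorProduct.assoc ℂ X Y Z
        (((BX.tensor BY).tensor BZ).ad (Units.map (pull (face₁ A)) u) t)) := by
  have k := isHom_assoc BX BY BZ
  have k' := (IsHom.id BX).tensor h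
  refine IsHom.ad (φ := face₁ A) (F := μ.lTensor X ∘ₗ (TensorProduct.assoc ℂ X Y Z).toLinearMap)
    ⟨fun x ↦ ?_, fun x ↦ ?_⟩ u t
  · refine (k'.1 _).trans ?_
    rw [k.1, TensorProduct.map_map]
    rfl
  · refine (k'.2 _).trans ?_
    rw [k.2, TensorProduct.map_map]
    rfl

lemma ad_deform_left {μ : X ⊗[ℂ] Y →ₗ[ℂ] U} (h : IsHom (BX.tensor BY) BU (LinearMap.mul' ℂ A) μ)
    (t : (X ⊗[ℂ] Y) ⊗[ℂ] Z) :
    (BU.tensor BZ).ad 𝓒.Ω ((𝓒.deform BX BY μ).rTensor Z t) =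
      μ.rTensor Z (((BX.tensor BY).tensor BZ).ad
        (Units.map (pull (face₃ A)) 𝓒.Ω * Units.map (pull (face₂ A)) 𝓒.Ω) t) := by
  rw [deform, LinearMap.rTensor_comp_apply, ad_face₂ h, ← ad_face₃, ad_ad]

lemma ad_deform_right {μ : Y ⊗[ℂ] Z →ₗ[ℂ] V} (h : IsHom (BY.tensor BZ) BV (LinearMap.mul' ℂ A) μ)
    (t : (X ⊗[ℂ] Y) ⊗[ℂ] Z) :
    (BX.tensor BV).ad 𝓒.Ω ((𝓒.deform BY BZ μ).lTensor X (TensorProduct.assoc ℂ X Y Z t)) =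
      μ.lTensor X (TensorProduct.assoc ℂ X Y Z (((BX.tensor BY).tensor BZ).ad
        (Units.map (pull (face₃ A)) 𝓒.Ω * Units.map (pull (face₂ A)) 𝓒.Ω) t)) := by
  rw [deform, LinearMap.lTensor_comp_apply, cocycle', ← ad_face₀, ad_face₁ h, ad_ad]

lemma ad_inv_left {μ : X ⊗[ℂ] Y →ₗ[ℂ] U} (h : IsHom (BX.tensor BY) BU (LinearMap.mul' ℂ A) μ)
    (t : (X ⊗[ℂ] Y) ⊗[ℂ] Z) :
    (BU.tensor BZ).ad 𝓒.Ω⁻¹ (μ.rTensor Z t) =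
      (𝓒.deform BX BY μ).rTensor Z (((BX.tensor BY).tensor BZ).ad
        (Units.map (pull (face₃ A)) 𝓒.Ω * Units.map (pull (face₂ A)) 𝓒.Ω)⁻¹ t) := by
  rw [deform, LinearMap.rTensor_comp_apply, ad_face₂ h, ← ad_face₃, ad_ad, map_inv,
    mul_inv_rev, inv_mul_cancel_right]

lemma ad_inv_right {μ : Y ⊗[ℂ] Z →ₗ[ℂ] V} (h : IsHom (BY.tensor BZ) BV (LinearMap.mul' ℂ A) μ)
    (t : (X ⊗[ℂ] Y) ⊗[ℂ] Z) :
    (BX.tensor BV).ad 𝓒.Ω⁻¹ (μ.lTensor X (TensorProduct.assoc ℂ X Y Z t)) =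
      (𝓒.deform BY BZ μ).lTensor X (TensorProduct.assoc ℂ X Y Z (((BX.tensor BY).tensor BZ).ad
        (Units.map (pull (face₃ A)) 𝓒.Ω * Units.map (pull (face₂ A)) 𝓒.Ω)⁻¹ t)) := by
  rw [deform, LinearMap.lTensor_comp_apply, cocycle', ← ad_face₀, ad_face₁ h, ad_ad, map_inv,
    mul_inv_rev, inv_mul_cancel_right]

/-- The deformation of an associative pair of products is associative. -/
lemma deform_assoc {μ : X ⊗[ℂ] Y →ₗ[ℂ] U} {ν : U ⊗[ℂ] Z →ₗ[ℂ] W}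
    {μ' : Y ⊗[ℂ] Z →ₗ[ℂ] V} {ν' : X ⊗[ℂ] V →ₗ[ℂ] W}
    (h : IsHom (BX.tensor BY) BU (LinearMap.mul' ℂ A) μ)
    (h' : IsHom (BY.tensor BZ) BV (LinearMap.mul' ℂ A) μ')
    (e : ∀ x y z, ν (μ (x ⊗ₜ y) ⊗ₜ z) = ν' (x ⊗ₜ μ' (y ⊗ₜ z))) (x : X) (y : Y) (z : Z) :
    𝓒.deform BU BZ ν (𝓒.deform BX BY μ (x ⊗ₜ y) ⊗ₜ z) =
      𝓒.deform BX BV ν' (x ⊗ₜ 𝓒.deform BY BZ μ' (y ⊗ₜ z)) := by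
  have e' : ν ∘ₗ μ.rTensor Z =
      ν' ∘ₗ μ'.lTensor X ∘ₗ (TensorProduct.assoc ℂ X Y Z).toLinearMap :=
    TensorProduct.ext_threefold e
  have h₁ := 𝓒.ad_deform_left (BZ := BZ) h ((x ⊗ₜ y) ⊗ₜ z)
  have h₂ := 𝓒.ad_deform_right (BX := BX) h' ((x ⊗ₜ y) ⊗ₜ z)
  exact (congrArg ν h₁).trans ((LinearMap.congr_fun e' _).trans (congrArg ν' h₂).symm)

end twist

end DualTwoCocycle

namespace DualTwoCocycle

open Bicomodule

variable {A : Type*} [Ring A] [Bialgebra ℂ A] (𝓒 : DualTwoCocycle A)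

section unit

variable {X Y : Type*} [AddCommGroup X] [Module ℂ X] [AddCommGroup Y] [Module ℂ Y]
  {BX : Bicomodule A X} {BY : Bicomodule A Y}

/-- `a ↦ 1 ⊗ a`. -/
def degen₀ (A : Type*) [Ring A] [Bialgebra ℂ A] : A →ₗc[ℂ] A ⊗[ℂ] A where
  toLinearMap := TensorProduct.mk ℂ A A 1
  counit_comp := by ext; simp
  map_comp_comul := by
    have e : TensorProduct.map (TensorProduct.mk ℂ A A 1) (TensorProduct.mk ℂ A A 1) =
      (TensorProduct.tensorTensorTensorComm ℂ A A A A).toLinearMap ∘ₗ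
        TensorProduct.mk ℂ _ _ (1 ⊗ₜ 1) := by ext; simp
    ext a
    rw [e, comul_tensor]
    simp [Algebra.TensorProduct.one_def]

/-- `a ↦ a ⊗ 1`. -/
def degen₁ (A : Type*) [Ring A] [Bialgebra ℂ A] : A →ₗc[ℂ] A ⊗[ℂ] A where
  toLinearMap := (TensorProduct.mk ℂ A A).flip 1
  counit_comp := by ext; simp
  map_comp_comul := by
    have e : TensorProduct.map ((TensorProduct.mk ℂ A A).flip 1)
        ((TensorProduct.mk ℂ A A).flip 1) =
      (TensorProduct.tensorTensorTensorComm ℂ A A A A).toLinearMap ∘ₗ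
        (TensorProduct.mk ℂ _ _).flip (1 ⊗ₜ 1) := by ext; simp
    ext a
    rw [e, comul_tensor]
    simp [Algebra.TensorProduct.one_def]

lemma deform_unit_left {x : X} (hl : BX.lco x = 1 ⊗ₜ x) (hr : BX.rco x = x ⊗ₜ 1)
    {Z : Type*} [AddCommGroup Z] [Module ℂ Z] (μ : X ⊗[ℂ] Y →ₗ[ℂ] Z) (y : Y) :
    𝓒.deform BX BY μ (x ⊗ₜ y) = μ (x ⊗ₜ y) := by
  have h₁ : Units.map (pull (degen₀ A)) 𝓒.Ω = 1 :=
    Units.ext (WithConv.ofConv_injective (LinearMap.ext 𝓒.counit_left))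
  have e₁ : (TensorProduct.tensorTensorTensorComm ℂ A X A Y).toLinearMap ∘ₗ
      TensorProduct.mk ℂ _ _ (1 ⊗ₜ x) =
      TensorProduct.map (TensorProduct.mk ℂ A A 1) (TensorProduct.mk ℂ X Y x) := by ext; simp
  have e₂ : (TensorProduct.tensorTensorTensorComm ℂ X A Y A).toLinearMap ∘ₗ
      TensorProduct.mk ℂ _ _ (x ⊗ₜ 1) =
      TensorProduct.map (TensorProduct.mk ℂ X Y x) (TensorProduct.mk ℂ A A 1) := by ext; simp
  have h : IsHom BY (BX.tensor BY) (degen₀ A).toLinearMap (TensorProduct.mk ℂ X Y x) := by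
    constructor <;> intro y
    · simp only [Bicomodule.tensor, TensorProduct.mk_apply, LinearMap.comp_apply,
        TensorProduct.map_tmul, hl]
      exact LinearMap.congr_fun e₁ _
    · simp only [Bicomodule.tensor, TensorProduct.mk_apply, LinearMap.comp_apply,
        TensorProduct.map_tmul, hr]
      exact LinearMap.congr_fun e₂ _
  have := h.ad 𝓒.Ω y
  rw [h₁, ad_one] at this
  exact congrArg μ this

lemma deform_unit_right {y : Y} (hl : BY.lco y = 1 ⊗ₜ y) (hr : BY.rco y = y ⊗ₜ 1)
    {Z : Type*} [AddCommGroup Z] [Module ℂ Z] (μ : X ⊗[ℂ] Y →ₗ[ℂ] Z) (x : X) :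
    𝓒.deform BX BY μ (x ⊗ₜ y) = μ (x ⊗ₜ y) := by
  have h₁ : Units.map (pull (degen₁ A)) 𝓒.Ω = 1 :=
    Units.ext (WithConv.ofConv_injective (LinearMap.ext 𝓒.counit_right))
  have e₁ : (TensorProduct.tensorTensorTensorComm ℂ A X A Y).toLinearMap ∘ₗ
      (TensorProduct.mk ℂ _ _).flip (1 ⊗ₜ y) =
      TensorProduct.map ((TensorProduct.mk ℂ A A).flip 1) ((TensorProduct.mk ℂ X Y).flip y) := by
    ext; simp
  have e₂ : (TensorProduct.tensorTensorTensorComm ℂ X A Y A).toLinearMap ∘ₗ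
      (TensorProduct.mk ℂ _ _).flip (y ⊗ₜ 1) =
      TensorProduct.map ((TensorProduct.mk ℂ X Y).flip y) ((TensorProduct.mk ℂ A A).flip 1) := by
    ext; simp
  have h : IsHom BX (BX.tensor BY) (degen₁ A).toLinearMap ((TensorProduct.mk ℂ X Y).flip y) := by
    constructor <;> intro x
    · simp only [Bicomodule.tensor, LinearMap.flip_apply, TensorProduct.mk_apply,
        LinearMap.comp_apply, TensorProduct.map_tmul, hl]
      exact LinearMap.congr_fun e₁ _
    · simp only [Bicomodule.tensor, LinearMap.flip_apply, TensorProduct.mk_apply,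
        LinearMap.comp_apply, TensorProduct.map_tmul, hr]
      exact LinearMap.congr_fun e₂ _
  have := h.ad 𝓒.Ω x
  rw [h₁, ad_one] at this
  exact congrArg μ this

end unit

lemma self_mul_isHom : IsHom ((self A).tensor (self A)) (self A) (LinearMap.mul' ℂ A)
    (LinearMap.mul' ℂ A) := by
  have h := (Bialgebra.mulCoalgHom ℂ A).map_comp_comul
  rw [self_tensor]
  exact ⟨fun x ↦ (LinearMap.congr_fun h x).symm, fun x ↦ (LinearMap.congr_fun h x).symm⟩

lemma counit_mulΩ (t : A ⊗[ℂ] A) :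
    counit (R := ℂ) (𝓒.mulΩ t) = counit (R := ℂ) (A := A ⊗[ℂ] A) t := by
  set S := self (A ⊗[ℂ] A)
  have e₁ (f : WithConv (A ⊗[ℂ] A →ₗ[ℂ] ℂ)) :
      (1 : WithConv (A ⊗[ℂ] A →ₗ[ℂ] ℂ)).ofConv ∘ₗ S.lop f.ofConv = f.ofConv := by
    have : (1 : WithConv (A ⊗[ℂ] A →ₗ[ℂ] ℂ)).ofConv ∘ₗ
        (TensorProduct.lid ℂ _).toLinearMap ∘ₗ f.ofConv.rTensor _ =
        LinearMap.mul' ℂ ℂ ∘ₗ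
          TensorProduct.map f.ofConv (1 : WithConv (A ⊗[ℂ] A →ₗ[ℂ] ℂ)).ofConv :=
      TensorProduct.ext' fun x y ↦ by simp
    have h : (1 : WithConv (A ⊗[ℂ] A →ₗ[ℂ] ℂ)).ofConv ∘ₗ S.lop f.ofConv = (f * 1).ofConv :=
      LinearMap.ext fun c ↦ LinearMap.congr_fun this (comul c)
    rwa [mul_one] at h
  have e₂ (f h : WithConv (A ⊗[ℂ] A →ₗ[ℂ] ℂ)) : f.ofConv ∘ₗ S.rop h.ofConv = (f * h).ofConv := by
    have : f.ofConv ∘ₗ (TensorProduct.rid ℂ _).toLinearMap ∘ₗ h.ofConv.lTensor _ =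
        LinearMap.mul' ℂ ℂ ∘ₗ TensorProduct.map f.ofConv h.ofConv :=
      TensorProduct.ext' fun x y ↦ by simp [mul_comm]
    exact LinearMap.ext fun c ↦ LinearMap.congr_fun this (comul c)
  have h₁ (s : A ⊗[ℂ] A) : counit (R := ℂ) (LinearMap.mul' ℂ A s) =
      (1 : WithConv (A ⊗[ℂ] A →ₗ[ℂ] ℂ)).ofConv s :=
    LinearMap.congr_fun (Bialgebra.mulCoalgHom ℂ A).counit_comp s
  rw [mulΩ, deform, self_tensor, LinearMap.comp_apply, h₁, Bicomodule.ad, LinearMap.comp_apply,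
    ← LinearMap.comp_apply, e₁, ← LinearMap.comp_apply, e₂, Units.mul_inv]
  rfl

/-- The deformed product of two elements. -/
def mulFun (a b : A) : A := 𝓒.mulΩ (a ⊗ₜ b)

lemma mulFun_add (a b c : A) : 𝓒.mulFun a (b + c) = 𝓒.mulFun a b + 𝓒.mulFun a c := by
  simp [mulFun, TensorProduct.tmul_add]

lemma add_mulFun (a b c : A) : 𝓒.mulFun (a + b) c = 𝓒.mulFun a c + 𝓒.mulFun b c := by
  simp [mulFun, TensorProduct.add_tmul]

lemma zero_mulFun (a : A) : 𝓒.mulFun 0 a = 0 := by simp [mulFun]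

lemma mulFun_zero (a : A) : 𝓒.mulFun a 0 = 0 := by simp [mulFun]

lemma smul_mulFun (r : ℂ) (a b : A) : 𝓒.mulFun (r • a) b = r • 𝓒.mulFun a b := by
  rw [mulFun, ← TensorProduct.smul_tmul', map_smul, mulFun]

lemma mulFun_smul (r : ℂ) (a b : A) : 𝓒.mulFun a (r • b) = r • 𝓒.mulFun a b := by
  rw [mulFun, TensorProduct.tmul_smul, map_smul, mulFun]

lemma mulFun_assoc (a b c : A) :
    𝓒.mulFun (𝓒.mulFun a b) c = 𝓒.mulFun a (𝓒.mulFun b c) :=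
  𝓒.deform_assoc self_mul_isHom self_mul_isHom (fun x y z ↦ by simp [mul_assoc]) a b c

lemma self_one : (self A).lco 1 = 1 ⊗ₜ 1 ∧ (self A).rco 1 = 1 ⊗ₜ 1 :=
  ⟨Bialgebra.comul_one, Bialgebra.comul_one⟩

lemma one_mulFun (a : A) : 𝓒.mulFun 1 a = a :=
  (𝓒.deform_unit_left (BX := self A) self_one.1 self_one.2 _ _).trans (one_mul a)

lemma mulFun_one (a : A) : 𝓒.mulFun a 1 = a :=
  (𝓒.deform_unit_right (BY := self A) self_one.1 self_one.2 _ _).trans (mul_one a)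

lemma counit_mulFun (a b : A) :
    counit (R := ℂ) (𝓒.mulFun a b) = counit (R := ℂ) a * counit (R := ℂ) b :=
  (𝓒.counit_mulΩ (a ⊗ₜ b)).trans (by simp [mul_comm])

end DualTwoCocycle

/-- The algebra `A_Ω`: the vector space `A` with the deformed product. -/
def Twist {A : Type*} [Ring A] [Bialgebra ℂ A] (_ : DualTwoCocycle A) : Type _ := A

namespace Twist

open Bicomodule

variable {A : Type*} [Ring A] [Bialgebra ℂ A] (𝓒 : DualTwoCocycle A)

instance : AddCommGroup (Twist 𝓒) := inferInstanceAs (AddCommGroup A)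
instance : Module ℂ (Twist 𝓒) := inferInstanceAs (Module ℂ A)

/-- The identity map of the underlying vector spaces. -/
def equiv : Twist 𝓒 ≃ₗ[ℂ] A := LinearEquiv.refl ℂ A

instance : Ring (Twist 𝓒) where
  __ := (inferInstance : AddCommGroup (Twist 𝓒))
  mul := 𝓒.mulFun
  one := (1 : A)
  left_distrib := 𝓒.mulFun_add
  right_distrib := 𝓒.add_mulFun
  zero_mul := 𝓒.zero_mulFun
  mul_zero := 𝓒.mulFun_zero
  mul_assoc := 𝓒.mulFun_assoc
  one_mul := 𝓒.one_mulFun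
  mul_one := 𝓒.mulFun_one

instance : Algebra ℂ (Twist 𝓒) := Algebra.ofModule 𝓒.smul_mulFun 𝓒.mulFun_smul

instance : Coalgebra ℂ (Twist 𝓒) := inferInstanceAs (Coalgebra ℂ A)

lemma mul'_eq : LinearMap.mul' ℂ (Twist 𝓒) = 𝓒.mulΩ :=
  TensorProduct.ext' fun _ _ ↦ rfl

lemma mul_eq_map {R : Type*} [Ring R] [Algebra ℂ R] (u v : R ⊗[ℂ] R) :
    TensorProduct.map (LinearMap.mul' ℂ R) (LinearMap.mul' ℂ R)
      (TensorProduct.tensorTensorTensorComm ℂ R R R R (u ⊗ₜ v)) = u * v := by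
  have : TensorProduct.map (LinearMap.mul' ℂ R) (LinearMap.mul' ℂ R) ∘ₗ
      (TensorProduct.tensorTensorTensorComm ℂ R R R R).toLinearMap =
      LinearMap.mul' ℂ (R ⊗[ℂ] R) := by
    ext; simp
  exact LinearMap.congr_fun this (u ⊗ₜ v)

instance : Bialgebra ℂ (Twist 𝓒) := Bialgebra.mk' ℂ (Twist 𝓒)
  (Bialgebra.counit_one (R := ℂ) (A := A))
  (fun {a b} ↦ 𝓒.counit_mulFun a b)
  (Bialgebra.comul_one (R := ℂ) (A := A))
  (fun {a b} ↦ by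
    have h := mul_eq_map (R := Twist 𝓒) (comul (R := ℂ) a) (comul (R := ℂ) b)
    rw [mul'_eq] at h
    exact ((𝓒.deform_isHom DualTwoCocycle.self_mul_isHom).1 _).trans h)

end Twist

open Bicomodule

/-- An `A`-bimodule structure on a complex vector space, `a m = lact (a ⊗ m)` and
`m a = ract (m ⊗ a)`. -/
@[ext]
structure Bimodule (A M : Type*) [Ring A] [Algebra ℂ A] [AddCommGroup M] [Module ℂ M] where
  lact : A ⊗[ℂ] M →ₗ[ℂ] M
  ract : M ⊗[ℂ] A →ₗ[ℂ] M
  one_lact : ∀ m, lact (1 ⊗ₜ m) = m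
  mul_lact : ∀ a b m, lact ((a * b) ⊗ₜ m) = lact (a ⊗ₜ lact (b ⊗ₜ m))
  ract_one : ∀ m, ract (m ⊗ₜ 1) = m
  ract_mul : ∀ m a b, ract (m ⊗ₜ (a * b)) = ract (ract (m ⊗ₜ a) ⊗ₜ b)
  lact_ract : ∀ a m b, ract (lact (a ⊗ₜ m) ⊗ₜ b) = lact (a ⊗ₜ ract (m ⊗ₜ b))

/-- A bicovariant `A`-bimodule: a bimodule and bicomodule whose coactions satisfy
`Δ_M(a m) = Δ(a) Δ_M(m)`, `Δ_M(m a) = Δ_M(m) Δ(a)`, and likewise for the right coaction. -/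
@[ext]
structure BicovariantBimodule (A M : Type*) [Ring A] [Bialgebra ℂ A] [AddCommGroup M]
    [Module ℂ M] extends Bimodule A M, Bicomodule A M where
  lact_isHom : IsHom ((self A).tensor toBicomodule) toBicomodule (LinearMap.mul' ℂ A) lact
  ract_isHom : IsHom (toBicomodule.tensor (self A)) toBicomodule (LinearMap.mul' ℂ A) ract

namespace BicovariantBimodule

variable {A M : Type*} [Ring A] [Bialgebra ℂ A] [AddCommGroup M] [Module ℂ M]

/-- The bimodule deformed by a cocycle: `a *_Ω m = γ(a₍₁₎ ⊗ m₍₋₁₎) a₍₂₎ m₍₀₎ γ⁻¹(a₍₃₎ ⊗ m₍₁₎)`,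
`m *_Ω a = γ(m₍₋₁₎ ⊗ a₍₁₎) m₍₀₎ a₍₂₎ γ⁻¹(m₍₁₎ ⊗ a₍₃₎)`, with unchanged coactions. -/
def twist (𝓒 : DualTwoCocycle A) (B : BicovariantBimodule A M) :
    BicovariantBimodule (Twist 𝓒) M where
  lact := 𝓒.deform (self A) B.toBicomodule B.lact
  ract := 𝓒.deform B.toBicomodule (self A) B.ract
  one_lact m := (𝓒.deform_unit_left (BX := self A) DualTwoCocycle.self_one.1
    DualTwoCocycle.self_one.2 _ _).trans (B.one_lact m)
  mul_lact a b m := 𝓒.deform_assoc DualTwoCocycle.self_mul_isHom B.lact_isHom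
    (fun a b m ↦ B.mul_lact a b m) a b m
  ract_one m := (𝓒.deform_unit_right (BY := self A) DualTwoCocycle.self_one.1
    DualTwoCocycle.self_one.2 _ _).trans (B.ract_one m)
  ract_mul m a b := (𝓒.deform_assoc B.ract_isHom DualTwoCocycle.self_mul_isHom
    (fun m a b ↦ (B.ract_mul m a b).symm) m a b).symm
  lact_ract a m b := 𝓒.deform_assoc B.lact_isHom B.ract_isHom B.lact_ract a m b
  lco := B.lco
  rco := B.rco
  lco_counit := B.lco_counit
  lco_coassoc := B.lco_coassoc
  rco_counit := B.rco_counit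
  rco_coassoc := B.rco_coassoc
  lco_rco := B.lco_rco
  lact_isHom := by
    have h := 𝓒.deform_isHom B.lact_isHom
    rw [← Twist.mul'_eq] at h
    exact h
  ract_isHom := by
    have h := 𝓒.deform_isHom B.ract_isHom
    rw [← Twist.mul'_eq] at h
    exact h

end BicovariantBimodule

section descend

variable {X Y Z : Type*} [AddCommGroup X] [Module ℂ X] [AddCommGroup Y] [Module ℂ Y]
  [AddCommGroup Z] [Module ℂ Z]

/-- The factorisation of `G` through a surjective linear map `F`. -/
def descend (F : X →ₗ[ℂ] Y) (hF : Function.Surjective F) (G : X →ₗ[ℂ] Z)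
    (h : ∀ x, F x = 0 → G x = 0) : Y →ₗ[ℂ] Z :=
  (LinearMap.ker F).liftQ G h ∘ₗ (F.quotKerEquivOfSurjective hF).symm.toLinearMap

lemma descend_apply (F : X →ₗ[ℂ] Y) (hF : Function.Surjective F) (G : X →ₗ[ℂ] Z)
    (h : ∀ x, F x = 0 → G x = 0) (x : X) : descend F hF G h (F x) = G x := by
  have : (F.quotKerEquivOfSurjective hF).symm (F x) = (LinearMap.ker F).mkQ x := by
    rw [LinearEquiv.symm_apply_eq]
    rfl
  rw [descend, LinearMap.comp_apply, LinearEquiv.coe_coe, this]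
  exact Submodule.liftQ_apply ..

variable {C D : Type*} [AddCommGroup C] [Module ℂ C] [Coalgebra ℂ C]
  [AddCommGroup D] [Module ℂ D] [Coalgebra ℂ D]

/-- The bicomodule induced on a quotient. -/
def Bicomodule.quot (B : Bicomodule C X) (F : X →ₗ[ℂ] Y) (hF : Function.Surjective F)
    (hl : ∀ x, F x = 0 → F.lTensor C (B.lco x) = 0)
    (hr : ∀ x, F x = 0 → F.rTensor C (B.rco x) = 0) : Bicomodule C Y :=
  let l := descend F hF (F.lTensor C ∘ₗ B.lco) hl
  let r := descend F hF (F.rTensor C ∘ₗ B.rco) hr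
  have el (x : X) : l (F x) = F.lTensor C (B.lco x) := descend_apply ..
  have er (x : X) : r (F x) = F.rTensor C (B.rco x) := descend_apply ..
  have ell : l ∘ₗ F = F.lTensor C ∘ₗ B.lco := LinearMap.ext el
  have err : r ∘ₗ F = F.rTensor C ∘ₗ B.rco := LinearMap.ext er
  { lco := l
    rco := r
    lco_counit := hF.forall.2 fun x ↦ by
      have e : (TensorProduct.lid ℂ Y).toLinearMap ∘ₗ counit.rTensor Y ∘ₗ F.lTensor C =
        F ∘ₗ (TensorProduct.lid ℂ X).toLinearMap ∘ₗ counit.rTensor X := by ext; simp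
      rw [el]
      exact (LinearMap.congr_fun e _).trans (congrArg F (B.lco_counit x))
    rco_counit := hF.forall.2 fun x ↦ by
      have e : (TensorProduct.rid ℂ Y).toLinearMap ∘ₗ counit.lTensor Y ∘ₗ F.rTensor C =
        F ∘ₗ (TensorProduct.rid ℂ X).toLinearMap ∘ₗ counit.lTensor X := by ext; simp
      rw [er]
      exact (LinearMap.congr_fun e _).trans (congrArg F (B.rco_counit x))
    lco_coassoc := hF.forall.2 fun x ↦ by
      have e : (TensorProduct.assoc ℂ C C Y).toLinearMap ∘ₗ comul.rTensor Y ∘ₗ F.lTensor C =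
        (F.lTensor C).lTensor C ∘ₗ (TensorProduct.assoc ℂ C C X).toLinearMap ∘ₗ
          comul.rTensor X := by
        ext c x
        simpa using LinearMap.congr_fun (f := (TensorProduct.assoc ℂ C C Y).toLinearMap ∘ₗ
          F.lTensor (C ⊗[ℂ] C)) (g := (F.lTensor C).lTensor C ∘ₗ
            (TensorProduct.assoc ℂ C C X).toLinearMap) (by ext; simp) (comul c ⊗ₜ x)
      rw [el, ← LinearMap.lTensor_comp_apply, ell, LinearMap.lTensor_comp_apply, ← B.lco_coassoc]
      exact LinearMap.congr_fun e _
    rco_coassoc := hF.forall.2 fun x ↦ by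
      have e : (TensorProduct.assoc ℂ Y C C).toLinearMap ∘ₗ (F.rTensor C).rTensor C =
        F.rTensor (C ⊗[ℂ] C) ∘ₗ (TensorProduct.assoc ℂ X C C).toLinearMap := by ext; simp
      rw [er, ← LinearMap.rTensor_comp_apply, err, LinearMap.rTensor_comp_apply]
      refine (LinearMap.congr_fun e _).trans ?_
      rw [LinearMap.comp_apply, LinearEquiv.coe_coe, B.rco_coassoc]
      simp only [LinearMap.lTensor, LinearMap.rTensor, TensorProduct.map_map, LinearMap.comp_id,
        LinearMap.id_comp]
    lco_rco := hF.forall.2 fun x ↦ by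
      have e : (TensorProduct.assoc ℂ C Y C).toLinearMap ∘ₗ (F.lTensor C).rTensor C =
        (F.rTensor C).lTensor C ∘ₗ (TensorProduct.assoc ℂ C X C).toLinearMap := by ext; simp
      rw [el, er, ← LinearMap.rTensor_comp_apply, ← LinearMap.lTensor_comp_apply, ell, err,
        LinearMap.rTensor_comp_apply, LinearMap.lTensor_comp_apply, ← B.lco_rco]
      exact LinearMap.congr_fun e _ }

lemma Bicomodule.quot_lco (B : Bicomodule C X) (F : X →ₗ[ℂ] Y) (hF : Function.Surjective F)
    (hl hr) (x : X) : (B.quot F hF hl hr).lco (F x) = F.lTensor C (B.lco x) := descend_apply ..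

lemma Bicomodule.quot_rco (B : Bicomodule C X) (F : X →ₗ[ℂ] Y) (hF : Function.Surjective F)
    (hl hr) (x : X) : (B.quot F hF hl hr).rco (F x) = F.rTensor C (B.rco x) := descend_apply ..

/-- Corestriction of a bicomodule along a homomorphism of coalgebras. -/
def Bicomodule.push (B : Bicomodule C X) (φ : C →ₗc[ℂ] D) : Bicomodule D X :=
  have h₁ : counit (R := ℂ) ∘ₗ φ.toLinearMap = counit := φ.counit_comp
  have h₂ : TensorProduct.map φ.toLinearMap φ.toLinearMap ∘ₗ comul = comul ∘ₗ φ.toLinearMap :=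
    φ.map_comp_comul
  { lco := φ.toLinearMap.rTensor X ∘ₗ B.lco
    rco := φ.toLinearMap.lTensor X ∘ₗ B.rco
    lco_counit x := by
      rw [LinearMap.comp_apply, ← LinearMap.rTensor_comp_apply, h₁, B.lco_counit]
    rco_counit x := by
      rw [LinearMap.comp_apply, ← LinearMap.lTensor_comp_apply, h₁, B.rco_counit]
    lco_coassoc x := by
      have e : (TensorProduct.assoc ℂ D D X).toLinearMap ∘ₗ
          (TensorProduct.map φ.toLinearMap φ.toLinearMap).rTensor X =
        TensorProduct.map φ.toLinearMap (φ.toLinearMap.rTensor X) ∘ₗ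
          (TensorProduct.assoc ℂ C C X).toLinearMap := by ext; simp
      rw [LinearMap.comp_apply, ← LinearMap.rTensor_comp_apply, ← h₂,
        LinearMap.rTensor_comp_apply]
      refine (LinearMap.congr_fun e _).trans ?_
      rw [LinearMap.comp_apply, LinearEquiv.coe_coe, B.lco_coassoc]
      simp only [LinearMap.lTensor, LinearMap.rTensor, TensorProduct.map_map, LinearMap.comp_id,
        LinearMap.id_comp]
    rco_coassoc x := by
      have e : (TensorProduct.assoc ℂ X D D).toLinearMap ∘ₗ
          TensorProduct.map (φ.toLinearMap.lTensor X) φ.toLinearMap =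
        (TensorProduct.map φ.toLinearMap φ.toLinearMap).lTensor X ∘ₗ
          (TensorProduct.assoc ℂ X C C).toLinearMap := by ext; simp
      rw [LinearMap.comp_apply, ← LinearMap.lTensor_comp_apply, ← h₂,
        LinearMap.lTensor_comp_apply, ← B.rco_coassoc]
      refine Eq.trans ?_ (LinearMap.congr_fun e _)
      rw [LinearMap.comp_apply, LinearEquiv.coe_coe]
      simp only [LinearMap.lTensor, LinearMap.rTensor, TensorProduct.map_map, LinearMap.comp_id,
        LinearMap.id_comp]
    lco_rco x := by
      have e : (TensorProduct.assoc ℂ D X D).toLinearMap ∘ₗ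
          TensorProduct.map (φ.toLinearMap.rTensor X) φ.toLinearMap =
        TensorProduct.map φ.toLinearMap (φ.toLinearMap.lTensor X) ∘ₗ
          (TensorProduct.assoc ℂ C X C).toLinearMap := by ext; simp
      have h := congrArg (TensorProduct.map φ.toLinearMap (φ.toLinearMap.lTensor X)) (B.lco_rco x)
      have e' := LinearMap.congr_fun e (B.lco.rTensor C (B.rco x))
      rw [LinearMap.comp_apply, LinearMap.comp_apply, LinearEquiv.coe_coe, LinearEquiv.coe_coe,
        h] at e'
      simp only [LinearMap.lTensor, LinearMap.rTensor, TensorProduct.map_map, LinearMap.comp_id,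
        LinearMap.id_comp, LinearMap.comp_apply] at e' ⊢
      exact e' }

end descend

section balanced

variable {A M N : Type*} [Ring A] [AddCommGroup M] [Module ℂ M] [AddCommGroup N] [Module ℂ N]

section algebra

variable [Algebra ℂ A]

/-- `(m ⊗ a) ⊗ n ↦ m a ⊗ n - m ⊗ a n`. -/
def balancer (S : Bimodule A M) (T : Bimodule A N) : (M ⊗[ℂ] A) ⊗[ℂ] N →ₗ[ℂ] M ⊗[ℂ] N :=
  S.ract.rTensor N - T.lact.lTensor M ∘ₗ (TensorProduct.assoc ℂ M A N).toLinearMap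

/-- The tensor product `M ⊗_A N`. -/
abbrev Bal (S : Bimodule A M) (T : Bimodule A N) : Type _ :=
  (M ⊗[ℂ] N) ⧸ LinearMap.range (balancer S T)

/-- The projection `M ⊗ N → M ⊗_A N`. -/
abbrev Bal.mk (S : Bimodule A M) (T : Bimodule A N) : M ⊗[ℂ] N →ₗ[ℂ] Bal S T :=
  (LinearMap.range (balancer S T)).mkQ

variable (S : Bimodule A M) (T : Bimodule A N)

namespace Bal

lemma mk_surjective : Function.Surjective (mk S T) := Submodule.mkQ_surjective _

lemma exact : Function.Exact (balancer S T) (mk S T) :=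
  LinearMap.exact_map_mkQ_range _

lemma mk_balance (t : (M ⊗[ℂ] A) ⊗[ℂ] N) :
    mk S T (S.ract.rTensor N t) = mk S T (T.lact.lTensor M (TensorProduct.assoc ℂ M A N t)) := by
  have h := (exact S T (balancer S T t)).2 ⟨t, rfl⟩
  change mk S T (S.ract.rTensor N t - T.lact.lTensor M (TensorProduct.assoc ℂ M A N t)) = 0 at h
  rwa [map_sub, sub_eq_zero] at h

variable {S T} in
lemma ind {P : Bal S T → Prop} (h : ∀ t, P (mk S T t)) (q : Bal S T) : P q :=
  (mk_surjective S T).forall.2 h q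

lemma eq_zero {Z : Type*} [AddCommGroup Z] [Module ℂ Z] {G : M ⊗[ℂ] N →ₗ[ℂ] Z}
    (h : ∀ t, G (S.ract.rTensor N t) = G (T.lact.lTensor M (TensorProduct.assoc ℂ M A N t)))
    (t : M ⊗[ℂ] N) (ht : mk S T t = 0) : G t = 0 := by
  obtain ⟨s, rfl⟩ := (exact S T t).1 ht
  rw [balancer, LinearMap.sub_apply, map_sub, sub_eq_zero]
  exact h s

/-- The left action on `M ⊗ N`. -/
def lact₀ : A ⊗[ℂ] (M ⊗[ℂ] N) →ₗ[ℂ] M ⊗[ℂ] N :=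
  S.lact.rTensor N ∘ₗ (TensorProduct.assoc ℂ A M N).symm.toLinearMap

/-- The right action on `M ⊗ N`. -/
def ract₀ : (M ⊗[ℂ] N) ⊗[ℂ] A →ₗ[ℂ] M ⊗[ℂ] N :=
  T.ract.lTensor M ∘ₗ (TensorProduct.assoc ℂ M N A).toLinearMap

/-- The left action `a (m ⊗ n) = a m ⊗ n`. -/
def lact : A ⊗[ℂ] Bal S T →ₗ[ℂ] Bal S T :=
  descend ((mk S T).lTensor A) (LinearMap.lTensor_surjective A (mk_surjective S T))
    (mk S T ∘ₗ lact₀ S) (fun x hx ↦ by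
      obtain ⟨s, rfl⟩ := (lTensor_exact A (exact S T) (mk_surjective S T) x).1 hx
      have e : mk S T ∘ₗ lact₀ S ∘ₗ (balancer S T).lTensor A = 0 := by
        ext a m b n
        have h := mk_balance S T ((S.lact (a ⊗ₜ m) ⊗ₜ b) ⊗ₜ n)
        simp only [LinearMap.rTensor_tmul, LinearMap.lTensor_tmul, TensorProduct.assoc_tmul,
          S.lact_ract] at h
        change mk S T (lact₀ S (a ⊗ₜ (S.ract (m ⊗ₜ b) ⊗ₜ n - m ⊗ₜ T.lact (b ⊗ₜ n)))) = 0
        rw [TensorProduct.tmul_sub, map_sub, map_sub, sub_eq_zero]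
        exact h
      exact LinearMap.congr_fun e s)

/-- The right action `(m ⊗ n) a = m ⊗ n a`. -/
def ract : Bal S T ⊗[ℂ] A →ₗ[ℂ] Bal S T :=
  descend ((mk S T).rTensor A) (LinearMap.rTensor_surjective A (mk_surjective S T))
    (mk S T ∘ₗ ract₀ T) (fun x hx ↦ by
      obtain ⟨s, rfl⟩ := (rTensor_exact A (exact S T) (mk_surjective S T) x).1 hx
      have e : mk S T ∘ₗ ract₀ T ∘ₗ (balancer S T).rTensor A = 0 := by
        ext m b n a
        have h := mk_balance S T ((m ⊗ₜ b) ⊗ₜ T.ract (n ⊗ₜ a))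
        simp only [LinearMap.rTensor_tmul, LinearMap.lTensor_tmul, TensorProduct.assoc_tmul,
          ← T.lact_ract] at h
        change mk S T (ract₀ T ((S.ract (m ⊗ₜ b) ⊗ₜ n - m ⊗ₜ T.lact (b ⊗ₜ n)) ⊗ₜ a)) = 0
        rw [TensorProduct.sub_tmul, map_sub, map_sub, sub_eq_zero]
        exact h
      exact LinearMap.congr_fun e s)

lemma lact_mk (s : A ⊗[ℂ] (M ⊗[ℂ] N)) :
    lact S T ((mk S T).lTensor A s) = mk S T (lact₀ S s) := descend_apply ..

lemma ract_mk (s : (M ⊗[ℂ] N) ⊗[ℂ] A) :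
    ract S T ((mk S T).rTensor A s) = mk S T (ract₀ T s) := descend_apply ..

lemma lact_tmul (a : A) (t : M ⊗[ℂ] N) :
    lact S T (a ⊗ₜ mk S T t) = mk S T (lact₀ S (a ⊗ₜ t)) := lact_mk S T (a ⊗ₜ t)

lemma ract_tmul (a : A) (t : M ⊗[ℂ] N) :
    ract S T (mk S T t ⊗ₜ a) = mk S T (ract₀ T (t ⊗ₜ a)) := ract_mk S T (t ⊗ₜ a)

/-- The bimodule `M ⊗_A N`. -/
def bimodule : Bimodule A (Bal S T) where
  lact := lact S T
  ract := ract S T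
  one_lact := ind fun t ↦ by
    have e : lact₀ (N := N) S ∘ₗ TensorProduct.mk ℂ A _ 1 = .id := by
      ext; simp [lact₀, S.one_lact]
    rw [lact_tmul]
    exact congrArg (mk S T) (LinearMap.congr_fun e t)
  mul_lact a b := ind fun t ↦ by
    have e : lact₀ (N := N) S ∘ₗ TensorProduct.mk ℂ A _ (a * b) =
        lact₀ S ∘ₗ TensorProduct.mk ℂ A _ a ∘ₗ lact₀ S ∘ₗ TensorProduct.mk ℂ A _ b := by
      ext; simp [lact₀, S.mul_lact]
    rw [lact_tmul, lact_tmul, lact_tmul]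
    exact congrArg (mk S T) (LinearMap.congr_fun e t)
  ract_one := ind fun t ↦ by
    have e : ract₀ (M := M) T ∘ₗ (TensorProduct.mk ℂ _ A).flip 1 = .id := by
      ext; simp [ract₀, T.ract_one]
    rw [ract_tmul]
    exact congrArg (mk S T) (LinearMap.congr_fun e t)
  ract_mul := ind fun t a b ↦ by
    have e : ract₀ (M := M) T ∘ₗ (TensorProduct.mk ℂ _ A).flip (a * b) =
        ract₀ T ∘ₗ (TensorProduct.mk ℂ _ A).flip b ∘ₗ ract₀ T ∘ₗ
          (TensorProduct.mk ℂ _ A).flip a := by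
      ext; simp [ract₀, T.ract_mul]
    rw [ract_tmul, ract_tmul, ract_tmul]
    exact congrArg (mk S T) (LinearMap.congr_fun e t)
  lact_ract a := ind fun t b ↦ by
    have e : ract₀ T ∘ₗ (TensorProduct.mk ℂ _ A).flip b ∘ₗ lact₀ S ∘ₗ TensorProduct.mk ℂ A _ a =
        lact₀ S ∘ₗ TensorProduct.mk ℂ A _ a ∘ₗ ract₀ T ∘ₗ (TensorProduct.mk ℂ _ A).flip b := by
      ext; simp [ract₀, lact₀]
    rw [lact_tmul, ract_tmul, ract_tmul, lact_tmul]
    exact congrArg (mk S T) (LinearMap.congr_fun e t)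

end Bal

end algebra

namespace Bal

variable [Bialgebra ℂ A] (S : BicovariantBimodule A M) (T : BicovariantBimodule A N)

/-- The codiagonal coactions on `M ⊗ N`. -/
def codiag (B : Bicomodule A M) (B' : Bicomodule A N) : Bicomodule A (M ⊗[ℂ] N) :=
  (B.tensor B').push (Bialgebra.mulCoalgHom ℂ A)

lemma codiag_lco (B : Bicomodule A M) (B' : Bicomodule A N) (t : M ⊗[ℂ] N) :
    (codiag B B').lco t = (LinearMap.mul' ℂ A).rTensor _ ((B.tensor B').lco t) := rfl

lemma codiag_rco (B : Bicomodule A M) (B' : Bicomodule A N) (t : M ⊗[ℂ] N) :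
    (codiag B B').rco t = (LinearMap.mul' ℂ A).lTensor _ ((B.tensor B').rco t) := rfl

lemma mul'_assoc : LinearMap.mul' ℂ A ∘ₗ (LinearMap.mul' ℂ A).rTensor A =
    LinearMap.mul' ℂ A ∘ₗ (LinearMap.mul' ℂ A).lTensor A ∘ₗ
      (TensorProduct.assoc ℂ A A A).toLinearMap := by
  ext; simp [mul_assoc]

lemma mk_balance_comp : mk S.toBimodule T.toBimodule ∘ₗ S.ract.rTensor N =
    mk S.toBimodule T.toBimodule ∘ₗ T.lact.lTensor M ∘ₗ
      (TensorProduct.assoc ℂ M A N).toLinearMap :=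
  LinearMap.ext (mk_balance S.toBimodule T.toBimodule)

/-- The bicomodule `M ⊗_A N` with the codiagonal coactions. -/
def bicomodule : Bicomodule A (Bal S.toBimodule T.toBimodule) :=
  (codiag S.toBicomodule T.toBicomodule).quot (mk S.toBimodule T.toBimodule) (mk_surjective _ _)
    (eq_zero _ _ (G := (mk S.toBimodule T.toBimodule).lTensor A ∘ₗ (codiag _ _).lco) fun t ↦ by
      have h₁ := (S.ract_isHom.tensor (IsHom.id T.toBicomodule)).1 t
      have h₂ := ((IsHom.id S.toBicomodule).tensor T.lact_isHom).1 (TensorProduct.assoc ℂ M A N t)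
      have h₃ := (isHom_assoc S.toBicomodule (self A) T.toBicomodule).1 t
      rw [LinearEquiv.coe_coe] at h₃
      rw [h₃] at h₂
      rw [LinearMap.comp_apply, LinearMap.comp_apply, codiag_lco, codiag_lco]
      simp only [LinearMap.rTensor, LinearMap.lTensor]
      rw [h₁, h₂]
      have e := mk_balance_comp S T
      have e' := mul'_assoc (A := A)
      simp only [LinearMap.rTensor, LinearMap.lTensor] at e e' ⊢
      simp only [TensorProduct.map_map, LinearMap.id_comp, e, e'])
    (eq_zero _ _ (G := (mk S.toBimodule T.toBimodule).rTensor A ∘ₗ (codiag _ _).rco) fun t ↦ by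
      have h₁ := (S.ract_isHom.tensor (IsHom.id T.toBicomodule)).2 t
      have h₂ := ((IsHom.id S.toBicomodule).tensor T.lact_isHom).2 (TensorProduct.assoc ℂ M A N t)
      have h₃ := (isHom_assoc S.toBicomodule (self A) T.toBicomodule).2 t
      rw [LinearEquiv.coe_coe] at h₃
      rw [h₃] at h₂
      rw [LinearMap.comp_apply, LinearMap.comp_apply, codiag_rco, codiag_rco]
      simp only [LinearMap.rTensor, LinearMap.lTensor]
      rw [h₁, h₂]
      have e := mk_balance_comp S T
      have e' := mul'_assoc (A := A)
      simp only [LinearMap.rTensor, LinearMap.lTensor] at e e' ⊢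
      simp only [TensorProduct.map_map, LinearMap.id_comp, e, e'])

variable (𝓒 : DualTwoCocycle A)

/-- `m ⊗ n ↦ γ(m₍₋₁₎ ⊗ n₍₋₁₎) m₍₀₎ ⊗ n₍₀₎ γ⁻¹(m₍₁₎ ⊗ n₍₁₎)`, from `M_Ω ⊗_{A_Ω} N_Ω` to
`M ⊗_A N`. -/
def ξfun : Bal (S.twist 𝓒).toBimodule (T.twist 𝓒).toBimodule →ₗ[ℂ]
    Bal S.toBimodule T.toBimodule :=
  descend (mk (S.twist 𝓒).toBimodule (T.twist 𝓒).toBimodule) (mk_surjective _ _)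
    (mk S.toBimodule T.toBimodule ∘ₗ (S.toBicomodule.tensor T.toBicomodule).ad 𝓒.Ω)
    (eq_zero _ _ fun t ↦ by
      refine (congrArg _ (𝓒.ad_deform_left S.ract_isHom t)).trans (Eq.trans ?_
        (congrArg _ (𝓒.ad_deform_right T.lact_isHom t)).symm)
      exact mk_balance _ _ _)

/-- `m ⊗ n ↦ γ⁻¹(m₍₋₁₎ ⊗ n₍₋₁₎) m₍₀₎ ⊗ n₍₀₎ γ(m₍₁₎ ⊗ n₍₁₎)`, from `M ⊗_A N` to
`M_Ω ⊗_{A_Ω} N_Ω`. -/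
def ξinv : Bal S.toBimodule T.toBimodule →ₗ[ℂ]
    Bal (S.twist 𝓒).toBimodule (T.twist 𝓒).toBimodule :=
  descend (mk S.toBimodule T.toBimodule) (mk_surjective _ _)
    (mk (S.twist 𝓒).toBimodule (T.twist 𝓒).toBimodule ∘ₗ
      (S.toBicomodule.tensor T.toBicomodule).ad 𝓒.Ω⁻¹)
    (eq_zero _ _ fun t ↦ by
      refine (congrArg _ (𝓒.ad_inv_left S.ract_isHom t)).trans (Eq.trans ?_
        (congrArg _ (𝓒.ad_inv_right T.lact_isHom t)).symm)
      exact mk_balance (S.twist 𝓒).toBimodule (T.twist 𝓒).toBimodule _)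

/-- The isomorphism `ξ : M_Ω ⊗_{A_Ω} N_Ω ≃ M ⊗_A N`. -/
def ξ : Bal (S.twist 𝓒).toBimodule (T.twist 𝓒).toBimodule ≃ₗ[ℂ]
    Bal S.toBimodule T.toBimodule :=
  LinearEquiv.ofLinearMap (ξfun S T 𝓒) (ξinv S T 𝓒)
    (LinearMap.ext (ind fun t ↦ by
      rw [LinearMap.comp_apply, ξinv, descend_apply, LinearMap.comp_apply, ξfun, descend_apply,
        LinearMap.comp_apply, ad_ad, inv_mul_cancel, ad_one, LinearMap.id_apply]))
    (LinearMap.ext (ind fun t ↦ by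
      rw [LinearMap.comp_apply, ξfun, descend_apply, LinearMap.comp_apply, ξinv, descend_apply,
        LinearMap.comp_apply, ad_ad, mul_inv_cancel, ad_one, LinearMap.id_apply]))

end Bal

end balanced

section calculus

variable {A E : Type*} [Ring A] [Bialgebra ℂ A] [AddCommGroup E] [Module ℂ E]

/-- `a ⊗ b ↦ a db`. -/
def formMap (S : Bimodule A E) (d : A →ₗ[ℂ] E) : A ⊗[ℂ] A →ₗ[ℂ] E := S.lact ∘ₗ d.lTensor A

/-- A first order differential calculus `(E, d)` over `A`. -/
structure IsCalculus (S : Bimodule A E) (d : A →ₗ[ℂ] E) : Prop where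
  leibniz : ∀ a b, d (a * b) = S.ract (d a ⊗ₜ b) + S.lact (a ⊗ₜ d b)
  span : ∀ ρ : E, ∃ (n : ℕ) (a b : Fin n → A), ρ = ∑ k, S.lact (a k ⊗ₜ d (b k))

/-- A bicovariant first order differential calculus: if `∑ aₖ dbₖ = 0`, then
`∑ Δ(aₖ) (id ⊗ d)Δ(bₖ) = 0` and `∑ Δ(aₖ) (d ⊗ id)Δ(bₖ) = 0`. -/
structure IsBicovariantCalculus (S : Bimodule A E) (d : A →ₗ[ℂ] E) : Prop
    extends IsCalculus S d where
  left_cov : ∀ (n : ℕ) (a b : Fin n → A), ∑ k, S.lact (a k ⊗ₜ d (b k)) = 0 →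
    ∑ k, TensorProduct.map (LinearMap.mul' ℂ A) S.lact
      (TensorProduct.tensorTensorTensorComm ℂ A A A E
        (comul (a k) ⊗ₜ d.lTensor A (comul (b k)))) = 0
  right_cov : ∀ (n : ℕ) (a b : Fin n → A), ∑ k, S.lact (a k ⊗ₜ d (b k)) = 0 →
    ∑ k, TensorProduct.map S.lact (LinearMap.mul' ℂ A)
      (TensorProduct.tensorTensorTensorComm ℂ A A E A
        (comul (a k) ⊗ₜ d.rTensor A (comul (b k)))) = 0

lemma exists_fin_sum (x : A ⊗[ℂ] A) : ∃ (n : ℕ) (a b : Fin n → A), x = ∑ k, a k ⊗ₜ b k := by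
  obtain ⟨s, rfl⟩ := TensorProduct.exists_finset x
  refine ⟨s.card, fun k ↦ (s.equivFin.symm k).1.1, fun k ↦ (s.equivFin.symm k).1.2, ?_⟩
  rw [← Finset.sum_coe_sort]
  exact (Equiv.sum_comp s.equivFin.symm fun i : s ↦ i.1.1 ⊗ₜ[ℂ] i.1.2).symm

namespace IsBicovariantCalculus

variable {S : Bimodule A E} {d : A →ₗ[ℂ] E}

lemma formMap_surjective (h : IsBicovariantCalculus S d) :
    Function.Surjective (formMap S d) := fun ρ ↦ by
  obtain ⟨n, a, b, rfl⟩ := h.span ρ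
  exact ⟨∑ k, a k ⊗ₜ b k, by simp [formMap]⟩

lemma lTensor_codiag (a b : A) :
    (formMap S d).lTensor A ((Bal.codiag (self A) (self A)).lco (a ⊗ₜ b)) =
      TensorProduct.map (LinearMap.mul' ℂ A) S.lact
        (TensorProduct.tensorTensorTensorComm ℂ A A A E
          (comul a ⊗ₜ d.lTensor A (comul b))) := by
  have e := interchange_map (M := A) (N := A) .id .id .id d (comul a) (comul b)
  rw [TensorProduct.map_id, LinearMap.id_apply] at e
  rw [Bal.codiag_lco, LinearMap.lTensor, LinearMap.lTensor, e]
  simp only [LinearMap.rTensor, TensorProduct.map_map]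
  rfl

lemma rTensor_codiag (a b : A) :
    (formMap S d).rTensor A ((Bal.codiag (self A) (self A)).rco (a ⊗ₜ b)) =
      TensorProduct.map S.lact (LinearMap.mul' ℂ A)
        (TensorProduct.tensorTensorTensorComm ℂ A A E A
          (comul a ⊗ₜ d.rTensor A (comul b))) := by
  have e := interchange_map (M := A) (N := A) .id .id d .id (comul a) (comul b)
  rw [TensorProduct.map_id, LinearMap.id_apply] at e
  rw [Bal.codiag_rco, LinearMap.rTensor, LinearMap.rTensor, e]
  simp only [LinearMap.lTensor, TensorProduct.map_map]
  rfl

/-- The coactions `Δ_E(a db) = Δ(a) (id ⊗ d)Δ(b)` and `_EΔ(a db) = Δ(a) (d ⊗ id)Δ(b)`. -/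
def bicomodule (h : IsBicovariantCalculus S d) : Bicomodule A E :=
  (Bal.codiag (self A) (self A)).quot (formMap S d) h.formMap_surjective
    (fun x hx ↦ by
      obtain ⟨n, a, b, rfl⟩ := exists_fin_sum x
      simp only [map_sum, lTensor_codiag]
      exact h.left_cov n a b (by simpa [formMap] using hx))
    (fun x hx ↦ by
      obtain ⟨n, a, b, rfl⟩ := exists_fin_sum x
      simp only [map_sum, rTensor_codiag]
      exact h.right_cov n a b (by simpa [formMap] using hx))

lemma bicomodule_lco (h : IsBicovariantCalculus S d) (a b : A) :
    h.bicomodule.lco (formMap S d (a ⊗ₜ b)) = TensorProduct.map (LinearMap.mul' ℂ A) (formMap S d)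
      (TensorProduct.tensorTensorTensorComm ℂ A A A A (comul a ⊗ₜ comul b)) := by
  rw [bicomodule, Bicomodule.quot_lco, Bal.codiag_lco, ← LinearMap.comp_apply,
    LinearMap.lTensor_comp_rTensor]
  rfl

lemma bicomodule_rco (h : IsBicovariantCalculus S d) (a b : A) :
    h.bicomodule.rco (formMap S d (a ⊗ₜ b)) = TensorProduct.map (formMap S d) (LinearMap.mul' ℂ A)
      (TensorProduct.tensorTensorTensorComm ℂ A A A A (comul a ⊗ₜ comul b)) := by
  rw [bicomodule, Bicomodule.quot_rco, Bal.codiag_rco, ← LinearMap.comp_apply,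
    LinearMap.rTensor_comp_lTensor]
  rfl

lemma lact_formMap (c a b : A) :
    S.lact (c ⊗ₜ formMap S d (a ⊗ₜ b)) = formMap S d ((c * a) ⊗ₜ b) := by
  simp [formMap, S.mul_lact]

lemma ract_formMap (h : IsBicovariantCalculus S d) (a b c : A) :
    S.ract (formMap S d (a ⊗ₜ b) ⊗ₜ c) =
      formMap S d (a ⊗ₜ (b * c)) - formMap S d ((a * b) ⊗ₜ c) := by
  simp [formMap, S.mul_lact, S.lact_ract, h.leibniz, TensorProduct.tmul_add]

lemma bicomodule_lact (h : IsBicovariantCalculus S d) :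
    IsHom ((self A).tensor h.bicomodule) h.bicomodule (LinearMap.mul' ℂ A) S.lact := by
  set B := h.bicomodule with hB
  set m := LinearMap.mul' ℂ A with hm
  set p := formMap S d with hp
  have e₁ : TensorProduct.map m p ∘ₗ
      (TensorProduct.tensorTensorTensorComm ℂ A A A A).toLinearMap ∘ₗ
        (LinearMap.mul' ℂ (A ⊗[ℂ] A)).rTensor (A ⊗[ℂ] A) =
      TensorProduct.map m S.lact ∘ₗ (TensorProduct.tensorTensorTensorComm ℂ A A A E).toLinearMap ∘ₗ
        (TensorProduct.map m p ∘ₗ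
          (TensorProduct.tensorTensorTensorComm ℂ A A A A).toLinearMap).lTensor (A ⊗[ℂ] A) ∘ₗ
        (TensorProduct.assoc ℂ _ _ _).toLinearMap := by
    ext; simp [hm, hp, lact_formMap, mul_assoc]
  have e₂ : TensorProduct.map p m ∘ₗ
      (TensorProduct.tensorTensorTensorComm ℂ A A A A).toLinearMap ∘ₗ
        (LinearMap.mul' ℂ (A ⊗[ℂ] A)).rTensor (A ⊗[ℂ] A) =
      TensorProduct.map S.lact m ∘ₗ (TensorProduct.tensorTensorTensorComm ℂ A A E A).toLinearMap ∘ₗ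
        (TensorProduct.map p m ∘ₗ
          (TensorProduct.tensorTensorTensorComm ℂ A A A A).toLinearMap).lTensor (A ⊗[ℂ] A) ∘ₗ
        (TensorProduct.assoc ℂ _ _ _).toLinearMap := by
    ext; simp [hm, hp, lact_formMap, mul_assoc]
  have k₁ : B.lco ∘ₗ S.lact ∘ₗ p.lTensor A ∘ₗ (TensorProduct.assoc ℂ A A A).toLinearMap =
      TensorProduct.map m S.lact ∘ₗ ((self A).tensor B).lco ∘ₗ p.lTensor A ∘ₗ
        (TensorProduct.assoc ℂ A A A).toLinearMap := by
    refine TensorProduct.ext_threefold fun c a b ↦ ?_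
    have := LinearMap.congr_fun e₁ ((comul c ⊗ₜ comul a) ⊗ₜ comul b)
    change B.lco (S.lact (c ⊗ₜ p (a ⊗ₜ b))) = TensorProduct.map m S.lact
      (TensorProduct.tensorTensorTensorComm ℂ A A A E (comul c ⊗ₜ B.lco (p (a ⊗ₜ b))))
    rw [lact_formMap, bicomodule_lco, bicomodule_lco, Bialgebra.comul_mul]
    exact this
  have k₂ : B.rco ∘ₗ S.lact ∘ₗ p.lTensor A ∘ₗ (TensorProduct.assoc ℂ A A A).toLinearMap =
      TensorProduct.map S.lact m ∘ₗ ((self A).tensor B).rco ∘ₗ p.lTensor A ∘ₗ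
        (TensorProduct.assoc ℂ A A A).toLinearMap := by
    refine TensorProduct.ext_threefold fun c a b ↦ ?_
    have := LinearMap.congr_fun e₂ ((comul c ⊗ₜ comul a) ⊗ₜ comul b)
    change B.rco (S.lact (c ⊗ₜ p (a ⊗ₜ b))) = TensorProduct.map S.lact m
      (TensorProduct.tensorTensorTensorComm ℂ A A E A (comul c ⊗ₜ B.rco (p (a ⊗ₜ b))))
    rw [lact_formMap, bicomodule_rco, bicomodule_rco, Bialgebra.comul_mul]
    exact this
  have hs : Function.Surjective (p.lTensor A ∘ₗ (TensorProduct.assoc ℂ A A A).toLinearMap) :=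
    (LinearMap.lTensor_surjective A h.formMap_surjective).comp
      (TensorProduct.assoc ℂ A A A).surjective
  exact ⟨hs.forall.2 (LinearMap.congr_fun k₁), hs.forall.2 (LinearMap.congr_fun k₂)⟩

lemma bicomodule_ract (h : IsBicovariantCalculus S d) :
    IsHom (h.bicomodule.tensor (self A)) h.bicomodule (LinearMap.mul' ℂ A) S.ract := by
  set B := h.bicomodule with hB
  set m := LinearMap.mul' ℂ A with hm
  set p := formMap S d with hp
  have hr (a b c : A) : S.ract (p (a ⊗ₜ b) ⊗ₜ c) = p (a ⊗ₜ (b * c)) - p ((a * b) ⊗ₜ c) :=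
    h.ract_formMap a b c
  have e₁ : TensorProduct.map m p ∘ₗ
      (TensorProduct.tensorTensorTensorComm ℂ A A A A).toLinearMap ∘ₗ
        ((LinearMap.mul' ℂ (A ⊗[ℂ] A)).lTensor (A ⊗[ℂ] A) ∘ₗ
          (TensorProduct.assoc ℂ _ _ _).toLinearMap -
          (LinearMap.mul' ℂ (A ⊗[ℂ] A)).rTensor (A ⊗[ℂ] A)) =
      TensorProduct.map m S.ract ∘ₗ (TensorProduct.tensorTensorTensorComm ℂ A E A A).toLinearMap ∘ₗ
        (TensorProduct.map m p ∘ₗ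
          (TensorProduct.tensorTensorTensorComm ℂ A A A A).toLinearMap).rTensor (A ⊗[ℂ] A) := by
    ext; simp [hm, hr, mul_assoc, TensorProduct.tmul_sub]
  have e₂ : TensorProduct.map p m ∘ₗ
      (TensorProduct.tensorTensorTensorComm ℂ A A A A).toLinearMap ∘ₗ
        ((LinearMap.mul' ℂ (A ⊗[ℂ] A)).lTensor (A ⊗[ℂ] A) ∘ₗ
          (TensorProduct.assoc ℂ _ _ _).toLinearMap -
          (LinearMap.mul' ℂ (A ⊗[ℂ] A)).rTensor (A ⊗[ℂ] A)) =
      TensorProduct.map S.ract m ∘ₗ (TensorProduct.tensorTensorTensorComm ℂ E A A A).toLinearMap ∘ₗ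
        (TensorProduct.map p m ∘ₗ
          (TensorProduct.tensorTensorTensorComm ℂ A A A A).toLinearMap).rTensor (A ⊗[ℂ] A) := by
    ext; simp [hm, hr, mul_assoc, TensorProduct.sub_tmul]
  have k₁ : B.lco ∘ₗ S.ract ∘ₗ p.rTensor A =
      TensorProduct.map m S.ract ∘ₗ (B.tensor (self A)).lco ∘ₗ p.rTensor A := by
    refine TensorProduct.ext_threefold fun a b c ↦ ?_
    have := LinearMap.congr_fun e₁ ((comul a ⊗ₜ comul b) ⊗ₜ comul c)
    change B.lco (S.ract (p (a ⊗ₜ b) ⊗ₜ c)) = TensorProduct.map m S.ract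
      (TensorProduct.tensorTensorTensorComm ℂ A E A A (B.lco (p (a ⊗ₜ b)) ⊗ₜ comul c))
    rw [hr, map_sub, bicomodule_lco, bicomodule_lco, bicomodule_lco, Bialgebra.comul_mul,
      Bialgebra.comul_mul]
    exact (by simp only [LinearMap.comp_apply, LinearMap.sub_apply, map_sub]; rfl : _ = _).trans this
  have k₂ : B.rco ∘ₗ S.ract ∘ₗ p.rTensor A =
      TensorProduct.map S.ract m ∘ₗ (B.tensor (self A)).rco ∘ₗ p.rTensor A := by
    refine TensorProduct.ext_threefold fun a b c ↦ ?_
    have := LinearMap.congr_fun e₂ ((comul a ⊗ₜ comul b) ⊗ₜ comul c)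
    change B.rco (S.ract (p (a ⊗ₜ b) ⊗ₜ c)) = TensorProduct.map S.ract m
      (TensorProduct.tensorTensorTensorComm ℂ E A A A (B.rco (p (a ⊗ₜ b)) ⊗ₜ comul c))
    rw [hr, map_sub, bicomodule_rco, bicomodule_rco, bicomodule_rco, Bialgebra.comul_mul,
      Bialgebra.comul_mul]
    exact (by simp only [LinearMap.comp_apply, LinearMap.sub_apply, map_sub]; rfl : _ = _).trans this
  have hs := LinearMap.rTensor_surjective A h.formMap_surjective
  exact ⟨hs.forall.2 (LinearMap.congr_fun k₁), hs.forall.2 (LinearMap.congr_fun k₂)⟩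

/-- The bicovariant bimodule underlying a bicovariant calculus. -/
def bicov (h : IsBicovariantCalculus S d) : BicovariantBimodule A E where
  toBimodule := S
  __ := h.bicomodule
  lact_isHom := h.bicomodule_lact
  ract_isHom := h.bicomodule_ract

end IsBicovariantCalculus

end calculus

section invariants

variable {A M : Type*} [Ring A] [Bialgebra ℂ A] [AddCommGroup M] [Module ℂ M]

/-- The left-invariant elements `₀M = {m | Δ_M(m) = 1 ⊗ m}`. -/
def leftInv (B : Bicomodule A M) : Submodule ℂ M :=
  LinearMap.eqLocus B.lco (TensorProduct.mk ℂ A M 1)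

/-- The right-invariant elements `M₀ = {m | _MΔ(m) = m ⊗ 1}`. -/
def rightInv (B : Bicomodule A M) : Submodule ℂ M :=
  LinearMap.eqLocus B.rco ((TensorProduct.mk ℂ M A).flip 1)

end invariants

section geometry

variable {A E : Type*} [Ring A] [Bialgebra ℂ A] [AddCommGroup E] [Module ℂ E]
  (B : BicovariantBimodule A E)

/-- `E ⊗_A E`. -/
abbrev Two : Type _ := Bal B.toBimodule B.toBimodule

/-- `ρ ⊗_A ν`. -/
def tmulA (ρ ν : E) : Two B := Bal.mk B.toBimodule B.toBimodule (ρ ⊗ₜ ν)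

/-- The left `A`-module structure of `E ⊗_A E`. -/
abbrev lmul (a : A) (q : Two B) : Two B := (Bal.bimodule B.toBimodule B.toBimodule).lact (a ⊗ₜ q)

/-- The right `A`-module structure of `E ⊗_A E`. -/
abbrev rmul (q : Two B) (a : A) : Two B := (Bal.bimodule B.toBimodule B.toBimodule).ract (q ⊗ₜ a)

/-- The braiding: the bimodule map with `σ(ω ⊗ η) = η ⊗ ω` for left-invariant `ω` and
right-invariant `η`. -/
structure IsBraiding (σ : Two B →ₗ[ℂ] Two B) : Prop where
  lmul : ∀ a q, σ (lmul B a q) = lmul B a (σ q)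
  rmul : ∀ q a, σ (rmul B q a) = rmul B (σ q) a
  swap : ∀ ω ∈ leftInv B.toBicomodule, ∀ η ∈ rightInv B.toBicomodule,
    σ (tmulA B ω η) = tmulA B η ω

/-- The space `₀E`. -/
abbrev Inv : Type _ := leftInv B.toBicomodule

/-- The identification of `₀E ⊗ ₀E` with `₀(E ⊗_A E)`, as a map into `E ⊗_A E`. -/
def invIncl : Inv B ⊗[ℂ] Inv B →ₗ[ℂ] Two B :=
  Bal.mk B.toBimodule B.toBimodule ∘ₗ
    TensorProduct.map (leftInv B.toBicomodule).subtype (leftInv B.toBicomodule).subtype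

/-- `s` is the restriction `₀σ` of `σ` to `₀E ⊗ ₀E`. -/
def IsRestriction (σ : Two B →ₗ[ℂ] Two B) (s : Module.End ℂ (Inv B ⊗[ℂ] Inv B)) : Prop :=
  invIncl B ∘ₗ s = σ ∘ₗ invIncl B

/-- `σ` restricts to a diagonalisable endomorphism `₀σ` of `₀E ⊗ ₀E`. -/
def IsDiagonalisable (σ : Two B →ₗ[ℂ] Two B) : Prop :=
  ∃ s, IsRestriction B σ s ∧ ⨆ c : ℂ, Module.End.eigenspace s c = ⊤

/-- `P` is the idempotent `₀P_sym` with range the eigenspace of `₀σ` for the eigenvalue `1` and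
kernel the sum of the other eigenspaces. -/
def IsSymProj (s P : Module.End ℂ (Inv B ⊗[ℂ] Inv B)) : Prop :=
  P * P = P ∧ LinearMap.range P = Module.End.eigenspace s 1 ∧
    LinearMap.ker P = ⨆ (c : ℂ) (_ : c ≠ 1), Module.End.eigenspace s c

/-- A pseudo-Riemannian metric for `(E, σ)`. -/
structure IsMetric (σ : Two B →ₗ[ℂ] Two B) (g : Two B →ₗ[ℂ] A) : Prop where
  rmul : ∀ q a, g (rmul B q a) = g q * a
  symm : g ∘ₗ σ = g
  nondeg : ∀ ρ, (∀ ν, g (tmulA B ρ ν) = 0) → ρ = 0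

/-- A bi-invariant pseudo-Riemannian metric:
`(id ⊗ ε g) Δ_{E ⊗_A E} = g = (ε g ⊗ id) _{E ⊗_A E}Δ`. -/
structure IsBiinvariantMetric (σ : Two B →ₗ[ℂ] Two B) (g : Two B →ₗ[ℂ] A) : Prop
    extends IsMetric B σ g where
  left_inv : ∀ ρ ν, TensorProduct.rid ℂ A ((counit ∘ₗ g).lTensor A
    ((Bal.bicomodule B B).lco (tmulA B ρ ν))) = g (tmulA B ρ ν)
  right_inv : ∀ ρ ν, TensorProduct.lid ℂ A ((counit ∘ₗ g).rTensor A
    ((Bal.bicomodule B B).rco (tmulA B ρ ν))) = g (tmulA B ρ ν)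

variable (d : A →ₗ[ℂ] E) (σ : Two B →ₗ[ℂ] Two B) (g : Two B →ₗ[ℂ] A) (nab : E →ₗ[ℂ] Two B)

/-- A right connection: `∇(ρ a) = ∇(ρ) a + ρ ⊗ da`. -/
def IsConnection : Prop :=
  ∀ ρ a, nab (B.ract (ρ ⊗ₜ a)) = rmul B (nab ρ) a + tmulA B ρ (d a)

/-- `Δ_{E ⊗_A E} ∘ ∇ = (id ⊗ ∇) ∘ Δ_E`. -/
def IsLeftCovariant : Prop :=
  ∀ ρ, (Bal.bicomodule B B).lco (nab ρ) = nab.lTensor A (B.lco ρ)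

/-- `_{E ⊗_A E}Δ ∘ ∇ = (∇ ⊗ id) ∘ _EΔ`. -/
def IsRightCovariant : Prop :=
  ∀ ρ, (Bal.bicomodule B B).rco (nab ρ) = nab.rTensor A (B.rco ρ)

/-- The space of two-forms `(E ⊗_A E) / Ker(σ - 1)`. -/
abbrev TwoForms : Type _ := Two B ⧸ LinearMap.ker (σ - LinearMap.id)

/-- The quotient map `∧ : E ⊗_A E → Ω²`. -/
abbrev wedge : Two B →ₗ[ℂ] TwoForms B σ := (LinearMap.ker (σ - LinearMap.id)).mkQ

/-- `D` is the exterior derivative on one-forms, `D(a db) = da ∧ db`. -/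
def IsExteriorDerivative (D : E →ₗ[ℂ] TwoForms B σ) : Prop :=
  ∀ a b, D (B.lact (a ⊗ₜ d b)) = wedge B σ (tmulA B (d a) (d b))

/-- The torsion `∧ ∘ ∇ + d` vanishes. -/
def IsTorsionless : Prop :=
  ∃ D, IsExteriorDerivative B d σ D ∧ wedge B σ ∘ₗ nab + D = 0

/-- `(id ⊗ g) : ₀E ⊗ ₀E ⊗ ₀E → E`, `(x ⊗ y) ⊗ z ↦ x g(y ⊗ z)`. -/
def contract : (Inv B ⊗[ℂ] Inv B) ⊗[ℂ] Inv B →ₗ[ℂ] E :=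
  B.ract ∘ₗ TensorProduct.map (leftInv B.toBicomodule).subtype (g ∘ₗ invIncl B) ∘ₗ
    (TensorProduct.assoc ℂ (Inv B) (Inv B) (Inv B)).toLinearMap

/-- `2 (id ⊗ g)(₀σ ⊗ id)(∇ ⊗ id) ₀P_sym` on `₀E ⊗ ₀E`, where `N` is the restriction
`₀E → ₀E ⊗ ₀E` of `∇`. -/
def preMetricity (s P : Module.End ℂ (Inv B ⊗[ℂ] Inv B)) (N : Inv B →ₗ[ℂ] Inv B ⊗[ℂ] Inv B) :
    Inv B ⊗[ℂ] Inv B →ₗ[ℂ] E :=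
  (2 : ℂ) • (contract B g ∘ₗ s.rTensor (Inv B) ∘ₗ N.rTensor (Inv B) ∘ₗ P)

/-- `∇` is compatible with `g`: `Π_g(∇) = dg`, where
`Π_g(∇)((ω₁ ⊗ ω₂) a) = Π⁰_g(∇)(ω₁ ⊗ ω₂) a + g(ω₁ ⊗ ω₂) da` for `ω₁, ω₂ ∈ ₀E`. -/
def IsMetricCompatible : Prop :=
  ∃ s P N, IsRestriction B σ s ∧ IsSymProj B s P ∧
    (∀ ω : Inv B, invIncl B (N ω) = nab ω) ∧
    ∀ (ω₁ ω₂ : Inv B) (a : A),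
      B.ract (preMetricity B g s P N (ω₁ ⊗ₜ ω₂) ⊗ₜ a) + B.lact (g (tmulA B ω₁ ω₂) ⊗ₜ d a) =
        d (g (rmul B (tmulA B ω₁ ω₂) a))

/-- A Levi-Civita connection: a left-covariant connection which is torsionless and compatible
with `g`. -/
structure IsLeviCivita : Prop where
  connection : IsConnection B d nab
  left_covariant : IsLeftCovariant B nab
  torsionless : IsTorsionless B d σ nab
  compatible : IsMetricCompatible B d σ g nab

/-- A bicovariant Levi-Civita connection. -/
structure IsBicovariantLeviCivita : Prop extends IsLeviCivita B d σ g nab where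
  right_covariant : IsRightCovariant B nab

variable (𝓒 : DualTwoCocycle A)

/-- `d_Ω = d`. -/
def dΩ : Twist 𝓒 →ₗ[ℂ] E := d ∘ₗ (Twist.equiv 𝓒).toLinearMap

/-- `σ_Ω = ξ⁻¹ ∘ σ ∘ ξ`. -/
def σΩ : Two (B.twist 𝓒) →ₗ[ℂ] Two (B.twist 𝓒) :=
  (Bal.ξ B B 𝓒).symm.toLinearMap ∘ₗ σ ∘ₗ (Bal.ξ B B 𝓒).toLinearMap

/-- `g_Ω = g ∘ ξ`. -/
def gΩ : Two (B.twist 𝓒) →ₗ[ℂ] Twist 𝓒 :=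
  (Twist.equiv 𝓒).symm.toLinearMap ∘ₗ g ∘ₗ (Bal.ξ B B 𝓒).toLinearMap

/-- `∇_Ω = ξ⁻¹ ∘ ∇`. -/
def nablaΩ : E →ₗ[ℂ] Two (B.twist 𝓒) := (Bal.ξ B B 𝓒).symm.toLinearMap ∘ₗ nab

/-- `S` is an antipode of the bialgebra `H`. -/
def IsAntipode {H : Type*} [Ring H] [Bialgebra ℂ H] (S : H →ₗ[ℂ] H) : Prop :=
  (∀ x, LinearMap.mul' ℂ H (S.rTensor H (comul x)) = algebraMap ℂ H (counit x)) ∧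
    ∀ x, LinearMap.mul' ℂ H (S.lTensor H (comul x)) = algebraMap ℂ H (counit x)

end geometry

end BicovariantCalculus

end

end

open BicovariantCalculus

/-! Everything rests on one operation. For an invertible functional u on a coalgebra,
`Bicomodule.ad` sends x to u(x₍₋₁₎) x₍₀₎ u⁻¹(x₍₁₎). It is invertible, and being built from the
coactions alone it commutes with bicomodule homomorphisms (`IsHom.ad`, `ad_map`). The product of A,
the actions on E and the projection onto E ⊗_A E are all deformed by precomposing with `ad` of Ω on
a tensor product of two factors, and ξ is induced by the same operation. Hence an identity between
composites of bicomodule maps holds for the deformed data exactly when it holds for the original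
data. The cocycle identity is needed where three factors are rebracketed (`deform_assoc`,
`contraction_ad`) and for the antipode. Most comparison lemmas are therefore equivalences. Since g ↦
g_Ω and ∇ ↦ ∇_Ω are bijective on linear maps, the surjectivity statement for metrics and the
uniqueness statement for connections follow from the equivalences.

It must then be known that each structure map is a bicomodule map. For d this is the coaction
formula (`IsBicovariantCalculus.isHom_d`); for ∇ it is bicovariance; for g it is bi-invariance,
because a map into A is colinear once it is recovered from its composite with the counit
(`isHom_self_iff`). For σ it is a theorem (`isHom_braiding`). The antipode gives projections P and Q
onto the left- and right-invariant elements, so E ⊗_A E is spanned by the a ω ⊗ η b. This makes σ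
unique (`two_ext`) and suggests the formula `braid₀` for it. On ω ⊗ η and η ⊗ ω the map ξ is the
identity, so σ_Ω is again a braiding.

The antipode of A_Ω is the convolution product U * S * V, where U(a) = γ(a₍₁₎ ⊗ S(a₍₂₎)) and V(a) =
γ⁻¹(S(a₍₁₎) ⊗ a₍₂₎). The relation U * V = 1 is the cocycle identity evaluated on a₍₁₎ ⊗ S(a₍₂₎) ⊗
a₍₃₎ (`DualTwoCocycle.U_mul_V`).

Nondegeneracy is not an identity between colinear maps and needs its own argument. It can be tested
on right-invariant elements (`nondeg_iff_rightInv`), and there g_Ω(w ⊗ w') = g(U·w ⊗ w')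
(`gΩ_rightInv`). The action of U is injective because V undoes it, and bijective by finite
dimension.

For compatibility with g, all values of g on left-invariant elements are scalars, so the condition
reduces to the vanishing of a contraction (id ⊗ g)(₀σ∇ ⊗ id) ₀P_sym. The maps ₀σ and ₀P_sym are
conjugated by the restriction of ξ, and `contraction_ad` shows that the contraction does not change.
-/

section

open scoped TensorProduct
open Coalgebra (comul counit)

noncomputable section

namespace BicovariantCalculus

open Bicomodule

/-! ### Convolution against a coaction and the antipode -/

section hopf_modules

section maps

variable {M N K M' N' : Type*} [AddCommGroup M] [Module ℂ M] [AddCommGroup N] [Module ℂ N]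
  [AddCommGroup K] [Module ℂ K] [AddCommGroup M'] [Module ℂ M'] [AddCommGroup N'] [Module ℂ N']

lemma map_rTensor_apply (f : M →ₗ[ℂ] M') (g : N →ₗ[ℂ] N') (h : K →ₗ[ℂ] M) (t : K ⊗[ℂ] N) :
    TensorProduct.map f g (h.rTensor N t) = TensorProduct.map (f ∘ₗ h) g t :=
  LinearMap.congr_fun (LinearMap.map_comp_rTensor ..) t

lemma map_lTensor_apply (f : M →ₗ[ℂ] M') (g : N →ₗ[ℂ] N') (h : K →ₗ[ℂ] N) (t : M ⊗[ℂ] K) :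
    TensorProduct.map f g (h.lTensor M t) = TensorProduct.map f (g ∘ₗ h) t :=
  LinearMap.congr_fun (LinearMap.map_comp_lTensor ..) t

end maps

variable {H X X' Z Z' : Type*} [Ring H] [Bialgebra ℂ H]
  [AddCommGroup X] [Module ℂ X] [AddCommGroup X'] [Module ℂ X']
  [AddCommGroup Z] [Module ℂ Z] [AddCommGroup Z'] [Module ℂ Z']

/-- `x ↦ T(x₍₋₁₎) Y(x₍₀₎)`. -/
def lconv (B : Bicomodule H X) (act : H ⊗[ℂ] Z →ₗ[ℂ] Z) (T : H →ₗ[ℂ] H) (Y : X →ₗ[ℂ] Z) :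
    X →ₗ[ℂ] Z :=
  act ∘ₗ TensorProduct.map T Y ∘ₗ B.lco

/-- `x ↦ Y(x₍₀₎) T(x₍₁₎)`. -/
def rconv (B : Bicomodule H X) (act : Z ⊗[ℂ] H →ₗ[ℂ] Z) (T : H →ₗ[ℂ] H) (Y : X →ₗ[ℂ] Z) :
    X →ₗ[ℂ] Z :=
  act ∘ₗ TensorProduct.map Y T ∘ₗ B.rco

/-- By coassociativity the convolution algebra of endomorphisms of H acts on the linear maps X → Z.
The antipode is the convolution inverse of the identity, so it inverts x ↦ x₍₋₁₎ Y(x₍₀₎); this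
replaces Sweedler cancellations throughout. -/
lemma lconv_lconv (B : Bicomodule H X) {act : H ⊗[ℂ] Z →ₗ[ℂ] Z}
    (hm : ∀ a b z, act ((a * b) ⊗ₜ z) = act (a ⊗ₜ act (b ⊗ₜ z))) (S T : H →ₗ[ℂ] H)
    (Y : X →ₗ[ℂ] Z) : lconv B act S (lconv B act T Y) =
      lconv B act (LinearMap.mul' ℂ H ∘ₗ TensorProduct.map S T ∘ₗ comul) Y := by
  have e : act ∘ₗ TensorProduct.map S (act ∘ₗ TensorProduct.map T Y) ∘ₗ
      (TensorProduct.assoc ℂ H H X).toLinearMap =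
      act ∘ₗ TensorProduct.map (LinearMap.mul' ℂ H ∘ₗ TensorProduct.map S T) Y := by
    ext; simp [hm]
  ext x
  have h := LinearMap.congr_fun e (comul.rTensor X (B.lco x))
  simp only [LinearMap.comp_apply, LinearEquiv.coe_coe, B.lco_coassoc] at h
  simp only [LinearMap.lTensor, LinearMap.rTensor, TensorProduct.map_map, LinearMap.comp_id] at h
  exact h

lemma rconv_rconv (B : Bicomodule H X) {act : Z ⊗[ℂ] H →ₗ[ℂ] Z}
    (hm : ∀ z a b, act (z ⊗ₜ (a * b)) = act (act (z ⊗ₜ a) ⊗ₜ b)) (S T : H →ₗ[ℂ] H)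
    (Y : X →ₗ[ℂ] Z) : rconv B act S (rconv B act T Y) =
      rconv B act (LinearMap.mul' ℂ H ∘ₗ TensorProduct.map T S ∘ₗ comul) Y := by
  have e : act ∘ₗ TensorProduct.map (act ∘ₗ TensorProduct.map Y T) S =
      act ∘ₗ TensorProduct.map Y (LinearMap.mul' ℂ H ∘ₗ TensorProduct.map T S) ∘ₗ
      (TensorProduct.assoc ℂ X H H).toLinearMap := by
    ext; simp [hm]
  ext x
  have h := LinearMap.congr_fun e (B.rco.rTensor H (B.rco x))
  simp only [LinearMap.comp_apply, LinearEquiv.coe_coe, B.rco_coassoc] at h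
  simp only [LinearMap.lTensor, LinearMap.rTensor, TensorProduct.map_map, LinearMap.comp_id] at h
  exact h

lemma lconv_counit (B : Bicomodule H X) {act : H ⊗[ℂ] Z →ₗ[ℂ] Z} (h1 : ∀ z, act (1 ⊗ₜ z) = z)
    (Y : X →ₗ[ℂ] Z) : lconv B act (Algebra.linearMap ℂ H ∘ₗ counit) Y = Y := by
  have e : act ∘ₗ TensorProduct.map (Algebra.linearMap ℂ H ∘ₗ counit) Y =
      Y ∘ₗ (TensorProduct.lid ℂ X).toLinearMap ∘ₗ (counit (R := ℂ) (A := H)).rTensor X := by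
    ext a x
    simp [Algebra.algebraMap_eq_smul_one, ← TensorProduct.smul_tmul', h1]
  ext x
  exact (LinearMap.congr_fun e (B.lco x)).trans (congrArg Y (B.lco_counit x))

lemma rconv_counit (B : Bicomodule H X) {act : Z ⊗[ℂ] H →ₗ[ℂ] Z} (h1 : ∀ z, act (z ⊗ₜ 1) = z)
    (Y : X →ₗ[ℂ] Z) : rconv B act (Algebra.linearMap ℂ H ∘ₗ counit) Y = Y := by
  have e : act ∘ₗ TensorProduct.map Y (Algebra.linearMap ℂ H ∘ₗ counit) =
      Y ∘ₗ (TensorProduct.rid ℂ X).toLinearMap ∘ₗ (counit (R := ℂ) (A := H)).lTensor X := by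
    ext a x
    simp [Algebra.algebraMap_eq_smul_one, h1]
  ext x
  exact (LinearMap.congr_fun e (B.rco x)).trans (congrArg Y (B.rco_counit x))

lemma comp_lconv (B : Bicomodule H X) {act : H ⊗[ℂ] Z →ₗ[ℂ] Z} {act' : H ⊗[ℂ] Z' →ₗ[ℂ] Z'}
    {F : Z →ₗ[ℂ] Z'} (hF : ∀ a z, F (act (a ⊗ₜ z)) = act' (a ⊗ₜ F z)) (T : H →ₗ[ℂ] H)
    (Y : X →ₗ[ℂ] Z) : F ∘ₗ lconv B act T Y = lconv B act' T (F ∘ₗ Y) := by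
  have e : F ∘ₗ act ∘ₗ TensorProduct.map T Y = act' ∘ₗ TensorProduct.map T (F ∘ₗ Y) := by
    ext; simp [hF]
  exact LinearMap.ext fun x ↦ LinearMap.congr_fun e (B.lco x)

lemma comp_rconv (B : Bicomodule H X) {act : Z ⊗[ℂ] H →ₗ[ℂ] Z} {act' : Z' ⊗[ℂ] H →ₗ[ℂ] Z'}
    {F : Z →ₗ[ℂ] Z'} (hF : ∀ z a, F (act (z ⊗ₜ a)) = act' (F z ⊗ₜ a)) (T : H →ₗ[ℂ] H)
    (Y : X →ₗ[ℂ] Z) : F ∘ₗ rconv B act T Y = rconv B act' T (F ∘ₗ Y) := by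
  have e : F ∘ₗ act ∘ₗ TensorProduct.map Y T = act' ∘ₗ TensorProduct.map (F ∘ₗ Y) T := by
    ext; simp [hF]
  exact LinearMap.ext fun x ↦ LinearMap.congr_fun e (B.rco x)

/-- Naturality in the source. With G an action and the codiagonal coaction on its domain, it
expresses the composite of a projection with an action as a convolution, the form to which
`lconv_antipode` applies. -/
lemma lconv_comp {B : Bicomodule H X} {B' : Bicomodule H X'} {G : X' →ₗ[ℂ] X}
    (hG : ∀ x, B.lco (G x) = G.lTensor H (B'.lco x)) (act : H ⊗[ℂ] Z →ₗ[ℂ] Z) (T : H →ₗ[ℂ] H)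
    (Y : X →ₗ[ℂ] Z) : lconv B act T Y ∘ₗ G = lconv B' act T (Y ∘ₗ G) := by
  ext x
  simp [lconv, hG, LinearMap.lTensor, TensorProduct.map_map]

lemma rconv_comp {B : Bicomodule H X} {B' : Bicomodule H X'} {G : X' →ₗ[ℂ] X}
    (hG : ∀ x, B.rco (G x) = G.rTensor H (B'.rco x)) (act : Z ⊗[ℂ] H →ₗ[ℂ] Z) (T : H →ₗ[ℂ] H)
    (Y : X →ₗ[ℂ] Z) : rconv B act T Y ∘ₗ G = rconv B' act T (Y ∘ₗ G) := by
  ext x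
  simp [rconv, hG, LinearMap.rTensor, TensorProduct.map_map]

section antipode

variable {S : H →ₗ[ℂ] H} (hS : IsAntipode S)
include hS

lemma IsAntipode.conv_left :
    LinearMap.mul' ℂ H ∘ₗ TensorProduct.map S .id ∘ₗ comul = Algebra.linearMap ℂ H ∘ₗ counit :=
  LinearMap.ext hS.1

lemma IsAntipode.conv_right :
    LinearMap.mul' ℂ H ∘ₗ TensorProduct.map .id S ∘ₗ comul = Algebra.linearMap ℂ H ∘ₗ counit :=
  LinearMap.ext hS.2

lemma IsAntipode.map_one : S 1 = 1 := by
  simpa [Algebra.TensorProduct.one_def] using hS.1 1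

/-- `Y ↦ (x ↦ x₍₋₁₎ Y(x₍₀₎))` is inverse to `Y ↦ (x ↦ S(x₍₋₁₎) Y(x₍₀₎))`. -/
lemma lconv_antipode (B : Bicomodule H X) {act : H ⊗[ℂ] Z →ₗ[ℂ] Z}
    (h1 : ∀ z, act (1 ⊗ₜ z) = z)
    (hm : ∀ a b z, act ((a * b) ⊗ₜ z) = act (a ⊗ₜ act (b ⊗ₜ z))) {Y W : X →ₗ[ℂ] Z} :
    lconv B act .id Y = W ↔ lconv B act S W = Y := by
  constructor
  · rintro rfl
    rw [lconv_lconv B hm, hS.conv_left, lconv_counit B h1]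
  · rintro rfl
    rw [lconv_lconv B hm, hS.conv_right, lconv_counit B h1]

lemma rconv_antipode (B : Bicomodule H X) {act : Z ⊗[ℂ] H →ₗ[ℂ] Z}
    (h1 : ∀ z, act (z ⊗ₜ 1) = z)
    (hm : ∀ z a b, act (z ⊗ₜ (a * b)) = act (act (z ⊗ₜ a) ⊗ₜ b)) {Y W : X →ₗ[ℂ] Z} :
    rconv B act .id Y = W ↔ rconv B act S W = Y := by
  constructor
  · rintro rfl
    rw [rconv_rconv B hm, hS.conv_right, rconv_counit B h1]
  · rintro rfl
    rw [rconv_rconv B hm, hS.conv_left, rconv_counit B h1]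

end antipode

end hopf_modules

/-! ### Projections onto the invariant elements -/

section projections

variable {H X : Type*} [Ring H] [Bialgebra ℂ H] [AddCommGroup X] [Module ℂ X]

/-- The projection `x ↦ S(x₍₋₁₎) x₍₀₎` onto the left-invariant elements. -/
def lproj (S : H →ₗ[ℂ] H) (B : BicovariantBimodule H X) : X →ₗ[ℂ] X :=
  lconv B.toBicomodule B.lact S .id

/-- The projection `x ↦ x₍₀₎ S(x₍₁₎)` onto the right-invariant elements. -/
def rproj (S : H →ₗ[ℂ] H) (B : BicovariantBimodule H X) : X →ₗ[ℂ] X :=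
  rconv B.toBicomodule B.ract S .id

variable {S : H →ₗ[ℂ] H} (hS : IsAntipode S) (B : BicovariantBimodule H X)
include hS

lemma lact_lproj (x : X) : B.lact ((lproj S B).lTensor H (B.lco x)) = x :=
  LinearMap.congr_fun
    ((lconv_antipode hS B.toBicomodule (Y := lproj S B) B.one_lact B.mul_lact).2 rfl) x

lemma ract_rproj (x : X) : B.ract ((rproj S B).rTensor H (B.rco x)) = x :=
  LinearMap.congr_fun
    ((rconv_antipode hS B.toBicomodule (Y := rproj S B) B.ract_one B.ract_mul).2 rfl) x

lemma lproj_of_mem {x : X} (hx : x ∈ leftInv B.toBicomodule) : lproj S B x = x := by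
  have : B.lco x = 1 ⊗ₜ x := hx
  simp [lproj, lconv, this, hS.map_one, B.one_lact]

lemma rproj_of_mem {x : X} (hx : x ∈ rightInv B.toBicomodule) : rproj S B x = x := by
  have : B.rco x = x ⊗ₜ 1 := hx
  simp [rproj, rconv, this, hS.map_one, B.ract_one]

/-- Convolution with the identity is injective, so it suffices to compare both sides after it. There
the claim becomes a₍₁₎ x₍₋₁₎ ε(a₍₂₎) P(x₍₀₎) = a x, which is `lact_lproj`. The other identities for
the projections follow the same pattern. -/
lemma lproj_lact (a : H) (x : X) :
    lproj S B (B.lact (a ⊗ₜ x)) = counit (R := ℂ) a • lproj S B x := by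
  set m := LinearMap.mul' ℂ H
  let Y : H ⊗[ℂ] X →ₗ[ℂ] X := (TensorProduct.lid ℂ X).toLinearMap ∘ₗ
    TensorProduct.map counit (lproj S B)
  have h₁ : lproj S B ∘ₗ B.lact = lconv (Bal.codiag (self H) B.toBicomodule) B.lact S B.lact := by
    rw [lproj, lconv_comp (B' := Bal.codiag (self H) B.toBicomodule), LinearMap.id_comp]
    intro t
    rw [B.lact_isHom.1, Bal.codiag_lco]
    simp only [LinearMap.lTensor, LinearMap.rTensor, TensorProduct.map_map, LinearMap.comp_id,
      LinearMap.id_comp]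
  have h₂ : lconv (Bal.codiag (self H) B.toBicomodule) B.lact .id Y = B.lact := by
    refine TensorProduct.ext' fun b y ↦ ?_
    have e : B.lact ∘ₗ Y.lTensor H ∘ₗ m.rTensor (H ⊗[ℂ] X) ∘ₗ
        (TensorProduct.tensorTensorTensorComm ℂ H H H X).toLinearMap =
        B.lact ∘ₗ TensorProduct.map
          ((TensorProduct.rid ℂ H).toLinearMap ∘ₗ (counit (R := ℂ) (A := H)).lTensor H)
          (B.lact ∘ₗ (lproj S B).lTensor H) := by
      ext
      simp [Y, m, B.mul_lact, ← TensorProduct.smul_tmul']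
    have := LinearMap.congr_fun e (comul b ⊗ₜ B.lco y)
    refine this.trans ?_
    simp [lact_lproj hS]
  have h₃ := (lconv_antipode hS _ B.one_lact B.mul_lact).1 h₂
  rw [h₃] at h₁
  simpa [Y] using LinearMap.congr_fun h₁ (a ⊗ₜ x)

lemma rproj_ract (x : X) (a : H) :
    rproj S B (B.ract (x ⊗ₜ a)) = counit (R := ℂ) a • rproj S B x := by
  set m := LinearMap.mul' ℂ H
  let Y : X ⊗[ℂ] H →ₗ[ℂ] X := (TensorProduct.rid ℂ X).toLinearMap ∘ₗ
    TensorProduct.map (rproj S B) counit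
  have h₁ : rproj S B ∘ₗ B.ract = rconv (Bal.codiag B.toBicomodule (self H)) B.ract S B.ract := by
    rw [rproj, rconv_comp (B' := Bal.codiag B.toBicomodule (self H)), LinearMap.id_comp]
    intro t
    rw [B.ract_isHom.2, Bal.codiag_rco]
    simp only [LinearMap.lTensor, LinearMap.rTensor, TensorProduct.map_map, LinearMap.comp_id,
      LinearMap.id_comp]
  have h₂ : rconv (Bal.codiag B.toBicomodule (self H)) B.ract .id Y = B.ract := by
    refine TensorProduct.ext' fun y b ↦ ?_
    have e : B.ract ∘ₗ Y.rTensor H ∘ₗ m.lTensor (X ⊗[ℂ] H) ∘ₗ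
        (TensorProduct.tensorTensorTensorComm ℂ X H H H).toLinearMap =
        B.ract ∘ₗ TensorProduct.map (B.ract ∘ₗ (rproj S B).rTensor H)
          ((TensorProduct.lid ℂ H).toLinearMap ∘ₗ (counit (R := ℂ) (A := H)).rTensor H) := by
      ext
      simp [Y, m, B.ract_mul, ← TensorProduct.smul_tmul']
    have := LinearMap.congr_fun e (B.rco y ⊗ₜ comul b)
    refine this.trans ?_
    simp [ract_rproj hS]
  have h₃ := (rconv_antipode hS _ B.ract_one B.ract_mul).1 h₂
  rw [h₃] at h₁
  simpa [Y] using LinearMap.congr_fun h₁ (x ⊗ₜ a)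

/-- Let H act on H ⊗ X by a · (b ⊗ x) = a₍₁₎ b ⊗ a₍₂₎ x, so that the left coaction is H-linear. The
coaction of P(x) and 1 ⊗ P(x) then have the same convolution with the identity, namely the coaction
of x, and so they agree. -/
lemma lproj_mem (x : X) : lproj S B x ∈ leftInv B.toBicomodule := by
  set m := LinearMap.mul' ℂ H
  let act : H ⊗[ℂ] (H ⊗[ℂ] X) →ₗ[ℂ] H ⊗[ℂ] X := TensorProduct.map m B.lact ∘ₗ
    (TensorProduct.tensorTensorTensorComm ℂ H H H X).toLinearMap ∘ₗ
      (comul (R := ℂ) (A := H)).rTensor (H ⊗[ℂ] X)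
  have h1 (z) : act (1 ⊗ₜ z) = z := by
    have : act ∘ₗ TensorProduct.mk ℂ H _ 1 = .id := by
      ext; simp [act, m, Algebra.TensorProduct.one_def, B.one_lact]
    exact LinearMap.congr_fun this z
  have hm (a b z) : act ((a * b) ⊗ₜ z) = act (a ⊗ₜ act (b ⊗ₜ z)) := by
    have e : (TensorProduct.map m B.lact ∘ₗ
        (TensorProduct.tensorTensorTensorComm ℂ H H H X).toLinearMap) ∘ₗ
        (LinearMap.mul' ℂ (H ⊗[ℂ] H)).rTensor _ =
      (TensorProduct.map m B.lact ∘ₗ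
        (TensorProduct.tensorTensorTensorComm ℂ H H H X).toLinearMap) ∘ₗ
      (TensorProduct.map m B.lact ∘ₗ
        (TensorProduct.tensorTensorTensorComm ℂ H H H X).toLinearMap).lTensor _ ∘ₗ
        (TensorProduct.assoc ℂ _ _ _).toLinearMap := by
      ext; simp [m, mul_assoc, B.mul_lact]
    have := LinearMap.congr_fun e ((comul a ⊗ₜ comul b) ⊗ₜ z)
    simpa [act] using this
  have h₁ : lconv B.toBicomodule act .id (B.lco ∘ₗ lproj S B) = B.lco := by
    rw [← comp_lconv (act := B.lact) _ fun a z ↦ ?_]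
    · exact LinearMap.ext fun x ↦ congrArg B.lco (lact_lproj hS B x)
    · exact B.lact_isHom.1 (a ⊗ₜ z)
  -- By coassociativity x₍₋₁₎ · (1 ⊗ P(x₍₀₎)) = x₍₋₂₎ ⊗ x₍₋₁₎ P(x₍₀₎), and `lact_lproj` contracts
  -- the last two factors to x₍₀₎.
  have h₂ : lconv B.toBicomodule act .id (TensorProduct.mk ℂ H X 1 ∘ₗ lproj S B) = B.lco := by
    ext x
    have e : act ∘ₗ TensorProduct.map .id (TensorProduct.mk ℂ H X 1 ∘ₗ lproj S B) =
        (B.lact ∘ₗ (lproj S B).lTensor H).lTensor H ∘ₗ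
          (TensorProduct.assoc ℂ H H X).toLinearMap ∘ₗ comul.rTensor X := by
      ext a y
      have e' : TensorProduct.map m B.lact ∘ₗ
          (TensorProduct.tensorTensorTensorComm ℂ H H H X).toLinearMap ∘ₗ
            (TensorProduct.mk ℂ _ _).flip (1 ⊗ₜ lproj S B y) =
          (B.lact ∘ₗ (lproj S B).lTensor H).lTensor H ∘ₗ
          (TensorProduct.assoc ℂ H H X).toLinearMap ∘ₗ (TensorProduct.mk ℂ _ _).flip y := by
        ext; simp [m]
      simpa [act] using LinearMap.congr_fun e' (comul a)
    refine (LinearMap.congr_fun e (B.lco x)).trans ?_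
    rw [LinearMap.comp_apply, LinearMap.comp_apply, LinearEquiv.coe_coe, B.lco_coassoc,
      ← LinearMap.lTensor_comp_apply]
    have : (B.lact ∘ₗ (lproj S B).lTensor H) ∘ₗ B.lco = .id := LinearMap.ext (lact_lproj hS B)
    rw [this, LinearMap.lTensor_id, LinearMap.id_apply]
  have h₃ := (lconv_antipode hS _ h1 hm).1 h₁
  rw [(lconv_antipode hS _ h1 hm).1 h₂] at h₃
  exact (LinearMap.congr_fun h₃ x).symm

lemma rproj_mem (x : X) : rproj S B x ∈ rightInv B.toBicomodule := by
  set m := LinearMap.mul' ℂ H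
  let act : (X ⊗[ℂ] H) ⊗[ℂ] H →ₗ[ℂ] X ⊗[ℂ] H := TensorProduct.map B.ract m ∘ₗ
    (TensorProduct.tensorTensorTensorComm ℂ X H H H).toLinearMap ∘ₗ
      (comul (R := ℂ) (A := H)).lTensor (X ⊗[ℂ] H)
  have h1 (z) : act (z ⊗ₜ 1) = z := by
    have : act ∘ₗ (TensorProduct.mk ℂ _ H).flip 1 = .id := by
      ext; simp [act, m, Algebra.TensorProduct.one_def, B.ract_one]
    exact LinearMap.congr_fun this z
  have hm (z a b) : act (z ⊗ₜ (a * b)) = act (act (z ⊗ₜ a) ⊗ₜ b) := by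
    have e : (TensorProduct.map B.ract m ∘ₗ
        (TensorProduct.tensorTensorTensorComm ℂ X H H H).toLinearMap) ∘ₗ
        (LinearMap.mul' ℂ (H ⊗[ℂ] H)).lTensor _ ∘ₗ (TensorProduct.assoc ℂ _ _ _).toLinearMap =
      (TensorProduct.map B.ract m ∘ₗ
        (TensorProduct.tensorTensorTensorComm ℂ X H H H).toLinearMap) ∘ₗ
      (TensorProduct.map B.ract m ∘ₗ
        (TensorProduct.tensorTensorTensorComm ℂ X H H H).toLinearMap).rTensor _ := by
      ext; simp [m, mul_assoc, B.ract_mul]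
    have := LinearMap.congr_fun e ((z ⊗ₜ comul a) ⊗ₜ comul b)
    simpa [act] using this
  have h₁ : rconv B.toBicomodule act .id (B.rco ∘ₗ rproj S B) = B.rco := by
    rw [← comp_rconv (act := B.ract) _ fun z a ↦ ?_]
    · exact LinearMap.ext fun x ↦ congrArg B.rco (ract_rproj hS B x)
    · exact B.ract_isHom.2 (z ⊗ₜ a)
  have h₂ : rconv B.toBicomodule act .id ((TensorProduct.mk ℂ X H).flip 1 ∘ₗ rproj S B) =
      B.rco := by
    ext x
    have e : act ∘ₗ TensorProduct.map ((TensorProduct.mk ℂ X H).flip 1 ∘ₗ rproj S B) .id ∘ₗ .id =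
        (B.ract ∘ₗ (rproj S B).rTensor H).rTensor H ∘ₗ
          (TensorProduct.assoc ℂ X H H).symm.toLinearMap ∘ₗ comul.lTensor X := by
      ext y a
      have e' : TensorProduct.map B.ract m ∘ₗ
          (TensorProduct.tensorTensorTensorComm ℂ X H H H).toLinearMap ∘ₗ
            TensorProduct.mk ℂ _ _ (rproj S B y ⊗ₜ 1) =
          (B.ract ∘ₗ (rproj S B).rTensor H).rTensor H ∘ₗ
          (TensorProduct.assoc ℂ X H H).symm.toLinearMap ∘ₗ TensorProduct.mk ℂ _ _ y := by
        ext; simp [m]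
      simpa [act] using LinearMap.congr_fun e' (comul a)
    refine (LinearMap.congr_fun e (B.rco x)).trans ?_
    rw [LinearMap.comp_apply, LinearMap.comp_apply, ← B.rco_coassoc, LinearEquiv.coe_coe,
      LinearEquiv.symm_apply_apply, ← LinearMap.rTensor_comp_apply]
    have : (B.ract ∘ₗ (rproj S B).rTensor H) ∘ₗ B.rco = .id := LinearMap.ext (ract_rproj hS B)
    rw [this, LinearMap.rTensor_id, LinearMap.id_apply]
  have h₃ := (rconv_antipode hS _ h1 hm).1 h₁
  rw [(rconv_antipode hS _ h1 hm).1 h₂] at h₃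
  exact (LinearMap.congr_fun h₃ x).symm

/-- `P(x b) = S(b₍₁₎) P(x) b₍₂₎`. -/
lemma lproj_ract (x : X) (b : H) : lproj S B (B.ract (x ⊗ₜ b)) =
    B.lact (TensorProduct.map S (B.ract ∘ₗ TensorProduct.mk ℂ X H (lproj S B x)) (comul b)) := by
  set m := LinearMap.mul' ℂ H
  let Y : X ⊗[ℂ] H →ₗ[ℂ] X := B.lact ∘ₗ TensorProduct.map S B.ract ∘ₗ
    (TensorProduct.leftComm ℂ X H H).toLinearMap ∘ₗ TensorProduct.map (lproj S B) comul
  have hY (y c) : Y (y ⊗ₜ c) = B.lact (TensorProduct.map S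
      (B.ract ∘ₗ TensorProduct.mk ℂ X H (lproj S B y)) (comul c)) := by
    have e : (B.lact ∘ₗ TensorProduct.map S B.ract ∘ₗ
      (TensorProduct.leftComm ℂ X H H).toLinearMap) ∘ₗ TensorProduct.mk ℂ _ _ (lproj S B y) =
      B.lact ∘ₗ TensorProduct.map S (B.ract ∘ₗ TensorProduct.mk ℂ X H (lproj S B y)) := by
      ext; simp
    exact LinearMap.congr_fun e (comul c)
  have h₁ : lproj S B ∘ₗ B.ract = lconv (Bal.codiag B.toBicomodule (self H)) B.lact S B.ract := by
    rw [lproj, lconv_comp (B' := Bal.codiag B.toBicomodule (self H)), LinearMap.id_comp]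
    intro t
    rw [B.ract_isHom.1, Bal.codiag_lco]
    simp only [LinearMap.lTensor, LinearMap.rTensor, TensorProduct.map_map, LinearMap.comp_id,
      LinearMap.id_comp]
  -- The convolution is y₍₋₁₎ c₍₁₎ S(c₍₂₎) P(y₍₀₎) c₍₃₎. The antipode cancels the first two legs of
  -- c, and y₍₋₁₎ P(y₍₀₎) = y.
  have h₂ : lconv (Bal.codiag B.toBicomodule (self H)) B.lact .id Y = B.ract := by
    refine TensorProduct.ext' fun y c ↦ ?_
    have e : B.lact ∘ₗ Y.lTensor H ∘ₗ m.rTensor (X ⊗[ℂ] H) ∘ₗ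
        (TensorProduct.tensorTensorTensorComm ℂ H X H H).toLinearMap ∘ₗ
          (TensorProduct.mk ℂ (H ⊗[ℂ] X) _).flip (comul c) =
        B.ract ∘ₗ (TensorProduct.mk ℂ X H).flip c ∘ₗ B.lact ∘ₗ (lproj S B).lTensor H := by
      ext a z
      have e₁ : B.lact ∘ₗ Y.lTensor H ∘ₗ m.rTensor (X ⊗[ℂ] H) ∘ₗ
        (TensorProduct.tensorTensorTensorComm ℂ H X H H).toLinearMap ∘ₗ
          (TensorProduct.mk ℂ _ (H ⊗[ℂ] H)) (a ⊗ₜ z) =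
          (B.lact ∘ₗ TensorProduct.mk ℂ H X a ∘ₗ B.lact ∘ₗ (B.lact ∘ₗ TensorProduct.map S
            (B.ract ∘ₗ TensorProduct.mk ℂ X H (lproj S B z))).lTensor H) ∘ₗ comul.lTensor H := by
        ext; simp [hY, m, B.mul_lact]
      have e₂ : (B.lact ∘ₗ (B.lact ∘ₗ TensorProduct.map S
            (B.ract ∘ₗ TensorProduct.mk ℂ X H (lproj S B z))).lTensor H) ∘ₗ
            (TensorProduct.assoc ℂ H H H).toLinearMap =
          B.lact ∘ₗ TensorProduct.map (m ∘ₗ S.lTensor H)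
            (B.ract ∘ₗ TensorProduct.mk ℂ X H (lproj S B z)) := by
        ext; simp [m, B.mul_lact]
      have e₃ : (B.lact ∘ₗ TensorProduct.map (Algebra.linearMap ℂ H)
            (B.ract ∘ₗ TensorProduct.mk ℂ X H (lproj S B z))) =
            (B.ract ∘ₗ TensorProduct.mk ℂ X H (lproj S B z)) ∘ₗ
              (TensorProduct.lid ℂ H).toLinearMap := by
        ext; simp [B.one_lact]
      have k₁ := LinearMap.congr_fun e₁ (comul c)
      have k₂ := LinearMap.congr_fun e₂ (comul.rTensor H (comul c))
      have k₃ := LinearMap.congr_fun e₃ (counit.rTensor H (comul c))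
      simp only [LinearMap.comp_apply, LinearEquiv.coe_coe, Coalgebra.coassoc_apply] at k₁ k₂ k₃
      have hc : (m ∘ₗ S.lTensor H) ∘ₗ comul = Algebra.linearMap ℂ H ∘ₗ counit := hS.conv_right
      rw [map_rTensor_apply] at k₃
      rw [k₂, map_rTensor_apply, hc, k₃, Coalgebra.rTensor_counit_comul] at k₁
      refine k₁.trans ?_
      simp [B.lact_ract]
    have := LinearMap.congr_fun e (B.lco y)
    refine this.trans ?_
    simp only [LinearMap.comp_apply, lact_lproj hS]
    rfl
  have h₃ := (lconv_antipode hS _ B.one_lact B.mul_lact).1 h₂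
  rw [h₃] at h₁
  exact (LinearMap.congr_fun h₁ (x ⊗ₜ b)).trans (hY x b)

/-- `Q(b x) = b₍₁₎ Q(x) S(b₍₂₎)`. -/
lemma rproj_lact (b : H) (x : X) : rproj S B (B.lact (b ⊗ₜ x)) =
    B.ract (TensorProduct.map (B.lact ∘ₗ (TensorProduct.mk ℂ H X).flip (rproj S B x)) S
      (comul b)) := by
  set m := LinearMap.mul' ℂ H
  let Y : H ⊗[ℂ] X →ₗ[ℂ] X := B.ract ∘ₗ TensorProduct.map B.lact S ∘ₗ
    (TensorProduct.rightComm ℂ H H X).toLinearMap ∘ₗ TensorProduct.map comul (rproj S B)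
  have hY (c y) : Y (c ⊗ₜ y) = B.ract (TensorProduct.map
      (B.lact ∘ₗ (TensorProduct.mk ℂ H X).flip (rproj S B y)) S (comul c)) := by
    have e : (B.ract ∘ₗ TensorProduct.map B.lact S ∘ₗ
      (TensorProduct.rightComm ℂ H H X).toLinearMap) ∘ₗ
        (TensorProduct.mk ℂ _ _).flip (rproj S B y) =
      B.ract ∘ₗ TensorProduct.map (B.lact ∘ₗ (TensorProduct.mk ℂ H X).flip (rproj S B y)) S := by
      ext; simp
    exact LinearMap.congr_fun e (comul c)
  have h₁ : rproj S B ∘ₗ B.lact = rconv (Bal.codiag (self H) B.toBicomodule) B.ract S B.lact := by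
    rw [rproj, rconv_comp (B' := Bal.codiag (self H) B.toBicomodule), LinearMap.id_comp]
    intro t
    rw [B.lact_isHom.2, Bal.codiag_rco]
    simp only [LinearMap.lTensor, LinearMap.rTensor, TensorProduct.map_map, LinearMap.comp_id,
      LinearMap.id_comp]
  have h₂ : rconv (Bal.codiag (self H) B.toBicomodule) B.ract .id Y = B.lact := by
    refine TensorProduct.ext' fun c y ↦ ?_
    have e : B.ract ∘ₗ Y.rTensor H ∘ₗ m.lTensor (H ⊗[ℂ] X) ∘ₗ
        (TensorProduct.tensorTensorTensorComm ℂ H H X H).toLinearMap ∘ₗ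
          TensorProduct.mk ℂ _ (X ⊗[ℂ] H) (comul c) =
        B.lact ∘ₗ TensorProduct.mk ℂ H X c ∘ₗ B.ract ∘ₗ (rproj S B).rTensor H := by
      ext z a
      have e₁ : B.ract ∘ₗ Y.rTensor H ∘ₗ m.lTensor (H ⊗[ℂ] X) ∘ₗ
        (TensorProduct.tensorTensorTensorComm ℂ H H X H).toLinearMap ∘ₗ
          (TensorProduct.mk ℂ (H ⊗[ℂ] H) _).flip (z ⊗ₜ a) =
          (B.ract ∘ₗ (TensorProduct.mk ℂ X H).flip a ∘ₗ B.ract ∘ₗ (B.ract ∘ₗ TensorProduct.map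
            (B.lact ∘ₗ (TensorProduct.mk ℂ H X).flip (rproj S B z)) S).rTensor H) ∘ₗ
              comul.rTensor H := by
        ext; simp [hY, m, B.ract_mul]
      have e₂ : (B.ract ∘ₗ (B.ract ∘ₗ TensorProduct.map
            (B.lact ∘ₗ (TensorProduct.mk ℂ H X).flip (rproj S B z)) S).rTensor H) =
          B.ract ∘ₗ TensorProduct.map (B.lact ∘ₗ (TensorProduct.mk ℂ H X).flip (rproj S B z))
            (m ∘ₗ S.rTensor H) ∘ₗ (TensorProduct.assoc ℂ H H H).toLinearMap := by
        ext; simp [m, B.ract_mul]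
      have e₃ : (B.ract ∘ₗ TensorProduct.map
            (B.lact ∘ₗ (TensorProduct.mk ℂ H X).flip (rproj S B z)) (Algebra.linearMap ℂ H)) =
            (B.lact ∘ₗ (TensorProduct.mk ℂ H X).flip (rproj S B z)) ∘ₗ
              (TensorProduct.rid ℂ H).toLinearMap := by
        ext; simp [B.ract_one]
      have k₁ := LinearMap.congr_fun e₁ (comul c)
      have k₂ := LinearMap.congr_fun e₂ (comul.rTensor H (comul c))
      have k₃ := LinearMap.congr_fun e₃ (counit.lTensor H (comul c))
      simp only [LinearMap.comp_apply, LinearEquiv.coe_coe, Coalgebra.coassoc_apply] at k₁ k₂ k₃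
      have hc : (m ∘ₗ S.rTensor H) ∘ₗ comul = Algebra.linearMap ℂ H ∘ₗ counit := hS.conv_left
      rw [map_lTensor_apply] at k₃
      rw [k₂, map_lTensor_apply, hc, k₃, Coalgebra.lTensor_counit_comul] at k₁
      refine k₁.trans ?_
      simp [B.lact_ract]
    have := LinearMap.congr_fun e (B.rco y)
    refine this.trans ?_
    simp only [LinearMap.comp_apply, ract_rproj hS]
    rfl
  have h₃ := (rconv_antipode hS _ B.ract_one B.ract_mul).1 h₂
  rw [h₃] at h₁
  exact (LinearMap.congr_fun h₁ (b ⊗ₜ x)).trans (hY b x)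

end projections

/-! ### Detecting a tensor subspace by slices -/

section slices

variable {V X : Type*} [AddCommGroup V] [Module ℂ V] [AddCommGroup X] [Module ℂ X]

/-- The image of t in V ⊗ (X/K) vanishes, because its coordinates in a basis of V are the classes of
the slices by the coordinate functionals. Exactness of V ⊗ - then puts t in V ⊗ K. -/
lemma mem_range_lTensor {K : Submodule ℂ X} {t : V ⊗[ℂ] X}
    (h : ∀ f : V →ₗ[ℂ] ℂ, TensorProduct.lid ℂ X (f.rTensor X t) ∈ K) :
    t ∈ LinearMap.range (K.subtype.lTensor V) := by
  have hex := lTensor_exact V (LinearMap.exact_subtype_mkQ K) K.mkQ_surjective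
  refine (hex t).1 ?_
  classical
  let b := Module.Basis.ofVectorSpace ℂ V
  apply (TensorProduct.equivFinsuppOfBasisLeft (N := X ⧸ K) b).injective
  rw [map_zero]
  ext i
  have e : Finsupp.lapply i ∘ₗ
      (TensorProduct.equivFinsuppOfBasisLeft (N := X ⧸ K) b).toLinearMap ∘ₗ K.mkQ.lTensor V =
      K.mkQ ∘ₗ (TensorProduct.lid ℂ X).toLinearMap ∘ₗ (b.coord i).rTensor X := by
    ext; simp
  refine (LinearMap.congr_fun e t).trans ?_
  exact (Submodule.Quotient.mk_eq_zero K).2 (h _)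

lemma mem_range_rTensor {K : Submodule ℂ X} {t : X ⊗[ℂ] V}
    (h : ∀ f : V →ₗ[ℂ] ℂ, TensorProduct.rid ℂ X (f.lTensor X t) ∈ K) :
    t ∈ LinearMap.range (K.subtype.rTensor V) := by
  have e : (TensorProduct.comm ℂ X V).toLinearMap ∘ₗ K.subtype.rTensor V =
      K.subtype.lTensor V ∘ₗ (TensorProduct.comm ℂ K V).toLinearMap := by ext; simp
  have h' : TensorProduct.comm ℂ X V t ∈ LinearMap.range (K.subtype.lTensor V) := by
    refine mem_range_lTensor fun f ↦ ?_
    have e : (TensorProduct.lid ℂ X).toLinearMap ∘ₗ f.rTensor X ∘ₗ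
        (TensorProduct.comm ℂ X V).toLinearMap =
        (TensorProduct.rid ℂ X).toLinearMap ∘ₗ f.lTensor X := by ext; simp
    have := LinearMap.congr_fun e t
    simp only [LinearMap.comp_apply, LinearEquiv.coe_coe] at this
    rw [this]
    exact h f
  obtain ⟨s, hs⟩ := h'
  refine ⟨(TensorProduct.comm ℂ K V).symm s, (TensorProduct.comm ℂ X V).injective ?_⟩
  rw [← hs]
  simpa using LinearMap.congr_fun e ((TensorProduct.comm ℂ K V).symm s)

end slices

/-! ### Coactions preserve the invariants of the other side -/

section invariants

variable {H X : Type*} [Ring H] [Bialgebra ℂ H] [AddCommGroup X] [Module ℂ X]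
  (B : Bicomodule H X)

lemma lop_mem_rightInv (f : H →ₗ[ℂ] ℂ) {x : X} (hx : x ∈ rightInv B) :
    B.lop f x ∈ rightInv B := by
  have h : B.rco x = x ⊗ₜ 1 := hx
  change B.rco (B.lop f x) = B.lop f x ⊗ₜ 1
  rw [rco_lop, h, TensorProduct.map_tmul, LinearMap.id_apply]

lemma rop_mem_leftInv (f : H →ₗ[ℂ] ℂ) {x : X} (hx : x ∈ leftInv B) :
    B.rop f x ∈ leftInv B := by
  have h : B.lco x = 1 ⊗ₜ x := hx
  change B.lco (B.rop f x) = 1 ⊗ₜ B.rop f x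
  rw [lco_rop, h, TensorProduct.map_tmul, LinearMap.id_apply]

/-- The two coactions commute, so every slice of the left coaction of a right-invariant element is
right-invariant. This lets the swap rule for σ be applied inside a coaction. -/
lemma lco_rightInv {x : X} (hx : x ∈ rightInv B) :
    B.lco x ∈ LinearMap.range ((rightInv B).subtype.lTensor H) :=
  mem_range_lTensor fun f ↦ lop_mem_rightInv B f hx

lemma rco_leftInv {x : X} (hx : x ∈ leftInv B) :
    B.rco x ∈ LinearMap.range ((leftInv B).subtype.rTensor H) :=
  mem_range_rTensor fun f ↦ rop_mem_leftInv B f hx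

end invariants

/-! ### M ⊗_A N as a bicovariant bimodule -/

section tensor_square

variable {H M N : Type*} [Ring H] [Bialgebra ℂ H] [AddCommGroup M] [Module ℂ M]
  [AddCommGroup N] [Module ℂ N] (S : BicovariantBimodule H M) (T : BicovariantBimodule H N)

/-- This places the projection onto M ⊗_A N among the maps covered by `deform`, along with the
product and the actions; ξ is induced by its deformation. -/
lemma Bal.mk_isHom : IsHom (S.toBicomodule.tensor T.toBicomodule) (Bal.bicomodule S T)
    (LinearMap.mul' ℂ H) (Bal.mk S.toBimodule T.toBimodule) := by
  constructor <;> intro t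
  · rw [Bal.bicomodule, Bicomodule.quot_lco, Bal.codiag_lco]
    simp only [LinearMap.lTensor, LinearMap.rTensor, TensorProduct.map_map, LinearMap.comp_id,
      LinearMap.id_comp]
  · rw [Bal.bicomodule, Bicomodule.quot_rco, Bal.codiag_rco]
    simp only [LinearMap.lTensor, LinearMap.rTensor, TensorProduct.map_map, LinearMap.comp_id,
      LinearMap.id_comp]

lemma Bal.lact_tmul_tmul (a : H) (m : M) (n : N) :
    (Bal.bimodule S.toBimodule T.toBimodule).lact
      (a ⊗ₜ Bal.mk S.toBimodule T.toBimodule (m ⊗ₜ n)) =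
      Bal.mk S.toBimodule T.toBimodule (S.lact (a ⊗ₜ m) ⊗ₜ n) :=
  Bal.lact_tmul _ _ _ _

lemma Bal.ract_tmul_tmul (m : M) (n : N) (a : H) :
    (Bal.bimodule S.toBimodule T.toBimodule).ract
      (Bal.mk S.toBimodule T.toBimodule (m ⊗ₜ n) ⊗ₜ a) =
      Bal.mk S.toBimodule T.toBimodule (m ⊗ₜ T.ract (n ⊗ₜ a)) :=
  Bal.ract_tmul _ _ _ _

lemma Bal.mk_balance_tmul (m : M) (a : H) (n : N) :
    Bal.mk S.toBimodule T.toBimodule (S.ract (m ⊗ₜ a) ⊗ₜ n) =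
      Bal.mk S.toBimodule T.toBimodule (m ⊗ₜ T.lact (a ⊗ₜ n)) :=
  Bal.mk_balance _ _ ((m ⊗ₜ a) ⊗ₜ n)

/-- The bicovariant bimodule `M ⊗_A N`. -/
def Bal.bicov : BicovariantBimodule H (Bal S.toBimodule T.toBimodule) where
  toBimodule := Bal.bimodule S.toBimodule T.toBimodule
  __ := Bal.bicomodule S T
  lact_isHom := by
    set m := LinearMap.mul' ℂ H with hm
    set k := Bal.mk S.toBimodule T.toBimodule with hk
    set L := (Bal.bimodule S.toBimodule T.toBimodule).lact with hL
    have hLk (a x y) : L (a ⊗ₜ k (x ⊗ₜ y)) = k (S.lact (a ⊗ₜ x) ⊗ₜ y) :=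
      Bal.lact_tmul_tmul S T a x y
    -- The covariance identity with the Sweedler legs of all three arguments replaced by independent
    -- tensors, so that it can be checked on pure tensors.
    have e₁ : TensorProduct.map m k ∘ₗ
        (TensorProduct.tensorTensorTensorComm ℂ H M H N).toLinearMap ∘ₗ
          (TensorProduct.map m S.lact ∘ₗ
            (TensorProduct.tensorTensorTensorComm ℂ H H H M).toLinearMap).rTensor (H ⊗[ℂ] N) =
        TensorProduct.map m L ∘ₗ
          (TensorProduct.tensorTensorTensorComm ℂ H H H _).toLinearMap ∘ₗ
            (TensorProduct.map m k ∘ₗ (TensorProduct.tensorTensorTensorComm ℂ H M H N).toLinearMap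
              ).lTensor (H ⊗[ℂ] H) ∘ₗ (TensorProduct.assoc ℂ _ _ _).toLinearMap := by
      ext; simp [hm, hLk, mul_assoc]
    have e₂ : TensorProduct.map k m ∘ₗ
        (TensorProduct.tensorTensorTensorComm ℂ M H N H).toLinearMap ∘ₗ
          (TensorProduct.map S.lact m ∘ₗ
            (TensorProduct.tensorTensorTensorComm ℂ H H M H).toLinearMap).rTensor (N ⊗[ℂ] H) =
        TensorProduct.map L m ∘ₗ
          (TensorProduct.tensorTensorTensorComm ℂ H H _ H).toLinearMap ∘ₗ
            (TensorProduct.map k m ∘ₗ (TensorProduct.tensorTensorTensorComm ℂ M H N H).toLinearMap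
              ).lTensor (H ⊗[ℂ] H) ∘ₗ (TensorProduct.assoc ℂ _ _ _).toLinearMap := by
      ext; simp [hm, hLk, mul_assoc]
    have h := Bal.mk_isHom S T
    have k₁ : (Bal.bicomodule S T).lco ∘ₗ L ∘ₗ k.lTensor H ∘ₗ
        (TensorProduct.assoc ℂ H M N).toLinearMap =
        TensorProduct.map m L ∘ₗ ((self H).tensor (Bal.bicomodule S T)).lco ∘ₗ k.lTensor H ∘ₗ
        (TensorProduct.assoc ℂ H M N).toLinearMap := by
      refine TensorProduct.ext_threefold fun a x y ↦ ?_
      have := LinearMap.congr_fun e₁ ((comul a ⊗ₜ S.lco x) ⊗ₜ T.lco y)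
      refine Eq.trans ?_ (this.trans ?_)
      · change (Bal.bicomodule S T).lco (L (a ⊗ₜ k (x ⊗ₜ y))) = _
        rw [hLk, h.1]
        change TensorProduct.map m k (TensorProduct.tensorTensorTensorComm ℂ H M H N
          (S.lco (S.lact (a ⊗ₜ x)) ⊗ₜ T.lco y)) = _
        rw [S.lact_isHom.1]
        rfl
      · change _ = TensorProduct.map m L (TensorProduct.tensorTensorTensorComm ℂ H H H _
          (comul a ⊗ₜ (Bal.bicomodule S T).lco (k (x ⊗ₜ y))))
        rw [h.1]
        rfl
    have k₂ : (Bal.bicomodule S T).rco ∘ₗ L ∘ₗ k.lTensor H ∘ₗ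
        (TensorProduct.assoc ℂ H M N).toLinearMap =
        TensorProduct.map L m ∘ₗ ((self H).tensor (Bal.bicomodule S T)).rco ∘ₗ k.lTensor H ∘ₗ
        (TensorProduct.assoc ℂ H M N).toLinearMap := by
      refine TensorProduct.ext_threefold fun a x y ↦ ?_
      have := LinearMap.congr_fun e₂ ((comul a ⊗ₜ S.rco x) ⊗ₜ T.rco y)
      refine Eq.trans ?_ (this.trans ?_)
      · change (Bal.bicomodule S T).rco (L (a ⊗ₜ k (x ⊗ₜ y))) = _
        rw [hLk, h.2]
        change TensorProduct.map k m (TensorProduct.tensorTensorTensorComm ℂ M H N H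
          (S.rco (S.lact (a ⊗ₜ x)) ⊗ₜ T.rco y)) = _
        rw [S.lact_isHom.2]
        rfl
      · change _ = TensorProduct.map L m (TensorProduct.tensorTensorTensorComm ℂ H H _ H
          (comul a ⊗ₜ (Bal.bicomodule S T).rco (k (x ⊗ₜ y))))
        rw [h.2]
        rfl
    have hs : Function.Surjective (k.lTensor H ∘ₗ (TensorProduct.assoc ℂ H M N).toLinearMap) :=
      (LinearMap.lTensor_surjective H (Bal.mk_surjective _ _)).comp
        (TensorProduct.assoc ℂ H M N).surjective
    exact ⟨hs.forall.2 (LinearMap.congr_fun k₁), hs.forall.2 (LinearMap.congr_fun k₂)⟩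
  ract_isHom := by
    set m := LinearMap.mul' ℂ H with hm
    set k := Bal.mk S.toBimodule T.toBimodule with hk
    set R := (Bal.bimodule S.toBimodule T.toBimodule).ract with hR
    have hRk (x y a) : R (k (x ⊗ₜ y) ⊗ₜ a) = k (x ⊗ₜ T.ract (y ⊗ₜ a)) :=
      Bal.ract_tmul_tmul S T x y a
    have e₁ : TensorProduct.map m k ∘ₗ
        (TensorProduct.tensorTensorTensorComm ℂ H M H N).toLinearMap ∘ₗ
          (TensorProduct.map m T.ract ∘ₗ
            (TensorProduct.tensorTensorTensorComm ℂ H N H H).toLinearMap).lTensor (H ⊗[ℂ] M) ∘ₗ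
              (TensorProduct.assoc ℂ _ _ _).toLinearMap =
        TensorProduct.map m R ∘ₗ
          (TensorProduct.tensorTensorTensorComm ℂ H _ H H).toLinearMap ∘ₗ
            (TensorProduct.map m k ∘ₗ (TensorProduct.tensorTensorTensorComm ℂ H M H N).toLinearMap
              ).rTensor (H ⊗[ℂ] H) := by
      ext; simp [hm, hRk, mul_assoc]
    have e₂ : TensorProduct.map k m ∘ₗ
        (TensorProduct.tensorTensorTensorComm ℂ M H N H).toLinearMap ∘ₗ
          (TensorProduct.map T.ract m ∘ₗ
            (TensorProduct.tensorTensorTensorComm ℂ N H H H).toLinearMap).lTensor (M ⊗[ℂ] H) ∘ₗ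
              (TensorProduct.assoc ℂ _ _ _).toLinearMap =
        TensorProduct.map R m ∘ₗ
          (TensorProduct.tensorTensorTensorComm ℂ _ H H H).toLinearMap ∘ₗ
            (TensorProduct.map k m ∘ₗ (TensorProduct.tensorTensorTensorComm ℂ M H N H).toLinearMap
              ).rTensor (H ⊗[ℂ] H) := by
      ext; simp [hm, hRk, mul_assoc]
    have h := Bal.mk_isHom S T
    have k₁ : (Bal.bicomodule S T).lco ∘ₗ R ∘ₗ k.rTensor H =
        TensorProduct.map m R ∘ₗ ((Bal.bicomodule S T).tensor (self H)).lco ∘ₗ k.rTensor H := by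
      refine TensorProduct.ext_threefold fun x y a ↦ ?_
      have := LinearMap.congr_fun e₁ ((S.lco x ⊗ₜ T.lco y) ⊗ₜ comul a)
      refine Eq.trans ?_ (this.trans ?_)
      · change (Bal.bicomodule S T).lco (R (k (x ⊗ₜ y) ⊗ₜ a)) = _
        rw [hRk, h.1]
        change TensorProduct.map m k (TensorProduct.tensorTensorTensorComm ℂ H M H N
          (S.lco x ⊗ₜ T.lco (T.ract (y ⊗ₜ a)))) = _
        rw [T.ract_isHom.1]
        rfl
      · change _ = TensorProduct.map m R (TensorProduct.tensorTensorTensorComm ℂ H _ H H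
          ((Bal.bicomodule S T).lco (k (x ⊗ₜ y)) ⊗ₜ comul a))
        rw [h.1]
        rfl
    have k₂ : (Bal.bicomodule S T).rco ∘ₗ R ∘ₗ k.rTensor H =
        TensorProduct.map R m ∘ₗ ((Bal.bicomodule S T).tensor (self H)).rco ∘ₗ k.rTensor H := by
      refine TensorProduct.ext_threefold fun x y a ↦ ?_
      have := LinearMap.congr_fun e₂ ((S.rco x ⊗ₜ T.rco y) ⊗ₜ comul a)
      refine Eq.trans ?_ (this.trans ?_)
      · change (Bal.bicomodule S T).rco (R (k (x ⊗ₜ y) ⊗ₜ a)) = _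
        rw [hRk, h.2]
        change TensorProduct.map k m (TensorProduct.tensorTensorTensorComm ℂ M H N H
          (S.rco x ⊗ₜ T.rco (T.ract (y ⊗ₜ a)))) = _
        rw [T.ract_isHom.2]
        rfl
      · change _ = TensorProduct.map R m (TensorProduct.tensorTensorTensorComm ℂ _ H H H
          ((Bal.bicomodule S T).rco (k (x ⊗ₜ y)) ⊗ₜ comul a))
        rw [h.2]
        rfl
    have hs := LinearMap.rTensor_surjective H (Bal.mk_surjective S.toBimodule T.toBimodule)
    exact ⟨hs.forall.2 (LinearMap.congr_fun k₁), hs.forall.2 (LinearMap.congr_fun k₂)⟩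

end tensor_square

/-! ### Existence, uniqueness and colinearity of the braiding -/

section braiding

variable {H E : Type*} [Ring H] [Bialgebra ℂ H] [AddCommGroup E] [Module ℂ E]
  {S : H →ₗ[ℂ] H} (hS : IsAntipode S) (B : BicovariantBimodule H E)

lemma lmul_tmulA (a : H) (x y : E) : lmul B a (tmulA B x y) = tmulA B (B.lact (a ⊗ₜ x)) y :=
  Bal.lact_tmul_tmul B B a x y

lemma rmul_tmulA (x y : E) (a : H) : rmul B (tmulA B x y) a = tmulA B x (B.ract (y ⊗ₜ a)) :=
  Bal.ract_tmul_tmul B B x y a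

lemma tmulA_balance (x : E) (a : H) (y : E) :
    tmulA B (B.ract (x ⊗ₜ a)) y = tmulA B x (B.lact (a ⊗ₜ y)) :=
  Bal.mk_balance_tmul B B x a y

/-- `(a ⊗ x) ⊗ (y ⊗ b) ↦ a x ⊗_A y b`. -/
def actMap : (H ⊗[ℂ] E) ⊗[ℂ] (E ⊗[ℂ] H) →ₗ[ℂ] Two B :=
  Bal.mk B.toBimodule B.toBimodule ∘ₗ TensorProduct.map B.lact B.ract

include hS in
lemma actMap_proj (x y : E) : actMap B ((lproj S B).lTensor H (B.lco x) ⊗ₜ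
    (rproj S B).rTensor H (B.rco y)) = tmulA B x y := by
  rw [actMap, LinearMap.comp_apply, TensorProduct.map_tmul, lact_lproj hS, ract_rproj hS]
  rfl

include hS in
/-- Linear maps on `E ⊗_A E` agree if they agree on all `a (ω ⊗ η) b`, where `ω` is left-invariant
and `η` is right-invariant. -/
lemma two_ext {Z : Type*} [AddCommGroup Z] [Module ℂ Z] {F G : Two B →ₗ[ℂ] Z}
    (h : ∀ a, ∀ ω ∈ leftInv B.toBicomodule, ∀ η ∈ rightInv B.toBicomodule, ∀ b,
      F (lmul B a (rmul B (tmulA B ω η) b)) = G (lmul B a (rmul B (tmulA B ω η) b))) : F = G := by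
  have e : F ∘ₗ actMap B ∘ₗ TensorProduct.map ((lproj S B).lTensor H) ((rproj S B).rTensor H) =
      G ∘ₗ actMap B ∘ₗ TensorProduct.map ((lproj S B).lTensor H) ((rproj S B).rTensor H) := by
    ext a x y b
    have := h a _ (lproj_mem hS B x) _ (rproj_mem hS B y) b
    rw [rmul_tmulA, lmul_tmulA] at this
    exact this
  have e' : F ∘ₗ Bal.mk B.toBimodule B.toBimodule = G ∘ₗ Bal.mk B.toBimodule B.toBimodule := by
    ext x y
    have := LinearMap.congr_fun e (B.lco x ⊗ₜ B.rco y)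
    simp only [LinearMap.comp_apply, TensorProduct.map_tmul, actMap_proj hS] at this
    exact this
  exact LinearMap.ext (Bal.ind (LinearMap.congr_fun e'))

include hS in
lemma isBraiding_unique {σ σ' : Two B →ₗ[ℂ] Two B} (h : IsBraiding B σ) (h' : IsBraiding B σ') :
    σ = σ' :=
  two_ext hS B fun a ω hω η hη b ↦ by
    rw [h.lmul, h'.lmul, h.rmul, h'.rmul, h.swap ω hω η hη, h'.swap ω hω η hη]

include hS in
-- The map x ↦ x₍₋₁₎ ⊗ P(x₍₀₎) into H ⊗ ₀E is left H-linear, with H acting only on the first leg,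
-- since P turns the leg a₍₂₎ into ε(a₍₂₎). Left linearity of the braiding and balancedness of
-- `invRetract` both come from here.
lemma lproj_lco_lact (a : H) (x : E) : (lproj S B).lTensor H (B.lco (B.lact (a ⊗ₜ x))) =
    (LinearMap.mulLeft ℂ a).rTensor E ((lproj S B).lTensor H (B.lco x)) := by
  have h := B.lact_isHom.1 (a ⊗ₜ x)
  have e : (lproj S B).lTensor H ∘ₗ TensorProduct.map (LinearMap.mul' ℂ H) B.lact ∘ₗ
      (TensorProduct.tensorTensorTensorComm ℂ H H H E).toLinearMap =
      TensorProduct.map (LinearMap.mul' ℂ H) (lproj S B) ∘ₗ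
        (TensorProduct.assoc ℂ H H E).symm.toLinearMap ∘ₗ
        ((TensorProduct.rid ℂ H).toLinearMap ∘ₗ (counit (R := ℂ) (A := H)).lTensor H).rTensor
          (H ⊗[ℂ] E) := by
    ext; simp [lproj_lact hS, ← TensorProduct.smul_tmul']
  have e' : TensorProduct.map (LinearMap.mul' ℂ H) (lproj S B) ∘ₗ
        (TensorProduct.assoc ℂ H H E).symm.toLinearMap ∘ₗ TensorProduct.mk ℂ _ _ a =
      (LinearMap.mulLeft ℂ a).rTensor E ∘ₗ (lproj S B).lTensor H := by
    ext; simp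
  rw [h]
  refine (LinearMap.congr_fun e (comul a ⊗ₜ B.lco x)).trans ?_
  refine Eq.trans ?_ (LinearMap.congr_fun e' (B.lco x))
  simp

include hS in
lemma rproj_rco_ract (x : E) (a : H) : (rproj S B).rTensor H (B.rco (B.ract (x ⊗ₜ a))) =
    (LinearMap.mulRight ℂ a).lTensor E ((rproj S B).rTensor H (B.rco x)) := by
  have h := B.ract_isHom.2 (x ⊗ₜ a)
  have e : (rproj S B).rTensor H ∘ₗ TensorProduct.map B.ract (LinearMap.mul' ℂ H) ∘ₗ
      (TensorProduct.tensorTensorTensorComm ℂ E H H H).toLinearMap =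
      TensorProduct.map (rproj S B) (LinearMap.mul' ℂ H) ∘ₗ
        (TensorProduct.assoc ℂ E H H).toLinearMap ∘ₗ
        ((TensorProduct.lid ℂ H).toLinearMap ∘ₗ (counit (R := ℂ) (A := H)).rTensor H).lTensor
          (E ⊗[ℂ] H) := by
    ext; simp [rproj_ract hS, ← TensorProduct.smul_tmul']
  have e' : TensorProduct.map (rproj S B) (LinearMap.mul' ℂ H) ∘ₗ
        (TensorProduct.assoc ℂ E H H).toLinearMap ∘ₗ (TensorProduct.mk ℂ _ _).flip a =
      (LinearMap.mulRight ℂ a).lTensor E ∘ₗ (rproj S B).rTensor H := by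
    ext; simp
  rw [h]
  refine (LinearMap.congr_fun e (B.rco x ⊗ₜ comul a)).trans ?_
  refine Eq.trans ?_ (LinearMap.congr_fun e' (B.rco x))
  simp

/-- `m ⊗ n ↦ m₍₋₁₎ Q(n₍₀₎) ⊗_A P(m₍₀₎) n₍₁₎`, where `P` and `Q` are the projections onto the left-
and the right-invariant elements. -/
def braid₀ (S : H →ₗ[ℂ] H) : E ⊗[ℂ] E →ₗ[ℂ] Two B :=
  actMap B ∘ₗ (TensorProduct.tensorTensorTensorComm ℂ H E E H).toLinearMap ∘ₗ
    TensorProduct.map ((lproj S B).lTensor H ∘ₗ B.lco) ((rproj S B).rTensor H ∘ₗ B.rco)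

include hS in
-- Since P(x b) = S(b₍₁₎) P(x) b₍₂₎ and Q(b y) = b₍₁₎ Q(y) S(b₍₂₎), the two sides are m₍₋₁₎ b₍₁₎
-- Q(n₍₀₎) ⊗ S(b₍₂₎) P(m₍₀₎) b₍₃₎ n₍₁₎ and m₍₋₁₎ b₍₁₎ Q(n₍₀₎) S(b₍₂₎) ⊗ P(m₍₀₎) b₍₃₎ n₍₁₎. They
-- differ only by moving S(b₍₂₎) across ⊗_A.
lemma braid₀_balance (m : E) (b : H) (n : E) :
    braid₀ B S (B.ract (m ⊗ₜ b) ⊗ₜ n) = braid₀ B S (m ⊗ₜ B.lact (b ⊗ₜ n)) := by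
  set μ := LinearMap.mul' ℂ H with hμ
  set C := (TensorProduct.tensorTensorTensorComm ℂ H E E H).toLinearMap
  have key : actMap B ∘ₗ C ∘ₗ TensorProduct.map
        (TensorProduct.map μ (lproj S B ∘ₗ B.ract) ∘ₗ
          (TensorProduct.tensorTensorTensorComm ℂ H E H H).toLinearMap ∘ₗ
            (TensorProduct.mk ℂ _ _).flip (comul b)) ((rproj S B).rTensor H) =
      actMap B ∘ₗ C ∘ₗ TensorProduct.map ((lproj S B).lTensor H)
        (TensorProduct.map (rproj S B ∘ₗ B.lact) μ ∘ₗ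
          (TensorProduct.tensorTensorTensorComm ℂ H H E H).toLinearMap ∘ₗ
            TensorProduct.mk ℂ _ _ (comul b)) := by
    ext a x y c
    set p := lproj S B x with hp
    set q := rproj S B y with hq
    let L₁ : H ⊗[ℂ] (H ⊗[ℂ] H) →ₗ[ℂ] Two B := Bal.mk B.toBimodule B.toBimodule ∘ₗ
      TensorProduct.map (B.lact ∘ₗ TensorProduct.mk ℂ H E a ∘ₗ B.lact ∘ₗ
        (TensorProduct.mk ℂ H E).flip q)
        (B.ract ∘ₗ (TensorProduct.mk ℂ E H).flip c ∘ₗ B.lact ∘ₗ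
          TensorProduct.map S (B.ract ∘ₗ TensorProduct.mk ℂ E H p))
    let L₂ : (H ⊗[ℂ] H) ⊗[ℂ] H →ₗ[ℂ] Two B := Bal.mk B.toBimodule B.toBimodule ∘ₗ
      TensorProduct.map (B.lact ∘ₗ TensorProduct.mk ℂ H E a ∘ₗ B.ract ∘ₗ
        TensorProduct.map (B.lact ∘ₗ (TensorProduct.mk ℂ H E).flip q) S)
        (B.ract ∘ₗ (TensorProduct.mk ℂ E H).flip c ∘ₗ B.ract ∘ₗ TensorProduct.mk ℂ E H p)
    -- The two sides as functions of independent b₁, b₂, b₃: here S(b₂) crosses the balanced tensor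
    -- sign.
    have hL : L₁ ∘ₗ (TensorProduct.assoc ℂ H H H).toLinearMap = L₂ := by
      refine TensorProduct.ext_threefold fun b₁ b₂ b₃ ↦ ?_
      have := tmulA_balance B (B.lact (a ⊗ₜ B.lact (b₁ ⊗ₜ q))) (S b₂)
        (B.ract (B.ract (p ⊗ₜ b₃) ⊗ₜ c))
      rw [← B.lact_ract, B.lact_ract] at this
      exact this.symm
    have e₁ : actMap B ∘ₗ C ∘ₗ (TensorProduct.mk ℂ _ _).flip (q ⊗ₜ c) ∘ₗ
        TensorProduct.map μ (lproj S B ∘ₗ B.ract) ∘ₗ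
          (TensorProduct.tensorTensorTensorComm ℂ H E H H).toLinearMap ∘ₗ
            TensorProduct.mk ℂ _ _ (a ⊗ₜ x) = L₁ ∘ₗ comul.lTensor H := by
      refine TensorProduct.ext' fun b₁ b₂ ↦ ?_
      change tmulA B (B.lact ((a * b₁) ⊗ₜ q)) (B.ract (lproj S B (B.ract (x ⊗ₜ b₂)) ⊗ₜ c)) = _
      rw [B.mul_lact, lproj_ract hS]
      rfl
    have e₂ : actMap B ∘ₗ C ∘ₗ TensorProduct.mk ℂ _ _ (a ⊗ₜ p) ∘ₗ
        TensorProduct.map (rproj S B ∘ₗ B.lact) μ ∘ₗ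
          (TensorProduct.tensorTensorTensorComm ℂ H H E H).toLinearMap ∘ₗ
            (TensorProduct.mk ℂ _ _).flip (y ⊗ₜ c) = L₂ ∘ₗ comul.rTensor H := by
      refine TensorProduct.ext' fun b₁ b₂ ↦ ?_
      change tmulA B (B.lact (a ⊗ₜ rproj S B (B.lact (b₁ ⊗ₜ y)))) (B.ract (p ⊗ₜ (b₂ * c))) = _
      rw [B.ract_mul, rproj_lact hS]
      rfl
    refine (LinearMap.congr_fun e₁ (comul b)).trans ?_
    refine Eq.trans ?_ (LinearMap.congr_fun e₂ (comul b)).symm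
    exact (congrArg L₁ (Coalgebra.coassoc_apply b).symm).trans (LinearMap.congr_fun hL _)
  have hl : (lproj S B).lTensor H (B.lco (B.ract (m ⊗ₜ b))) =
      TensorProduct.map μ (lproj S B ∘ₗ B.ract)
        (TensorProduct.tensorTensorTensorComm ℂ H E H H (B.lco m ⊗ₜ comul b)) := by
    rw [B.ract_isHom.1, LinearMap.lTensor, TensorProduct.map_map, LinearMap.id_comp]
    rfl
  have hr : (rproj S B).rTensor H (B.rco (B.lact (b ⊗ₜ n))) =
      TensorProduct.map (rproj S B ∘ₗ B.lact) μ
        (TensorProduct.tensorTensorTensorComm ℂ H H E H (comul b ⊗ₜ B.rco n)) := by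
    rw [B.lact_isHom.2, LinearMap.rTensor, TensorProduct.map_map, LinearMap.id_comp]
    rfl
  have := LinearMap.congr_fun key (B.lco m ⊗ₜ B.rco n)
  simp only [braid₀, LinearMap.comp_apply, TensorProduct.map_tmul, hl, hr]
  exact this

include hS in
-- Balancedness lets `braid₀` descend to E ⊗_A E. Left linearity holds because a left factor only
-- enters the leg m₍₋₁₎, right linearity because a right factor only enters n₍₁₎. On invariant ω and
-- η the legs are 1 and the projections act as the identity, which leaves η ⊗ ω.
lemma exists_isBraiding : ∃ σ, IsBraiding B σ := by
  let G := braid₀ B S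
  have hG (t : (E ⊗[ℂ] H) ⊗[ℂ] E) : G (B.ract.rTensor E t) =
      G (B.lact.lTensor E (TensorProduct.assoc ℂ E H E t)) := by
    have : G ∘ₗ B.ract.rTensor E =
        G ∘ₗ B.lact.lTensor E ∘ₗ (TensorProduct.assoc ℂ E H E).toLinearMap :=
      TensorProduct.ext_threefold fun m b n ↦ braid₀_balance hS B m b n
    exact LinearMap.congr_fun this t
  let σ : Two B →ₗ[ℂ] Two B := descend (Bal.mk B.toBimodule B.toBimodule)
    (Bal.mk_surjective _ _) G (Bal.eq_zero _ _ hG)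
  have hσ (x y : E) : σ (tmulA B x y) = G (x ⊗ₜ y) := descend_apply ..
  set C := (TensorProduct.tensorTensorTensorComm ℂ H E E H).toLinearMap
  refine ⟨σ, fun a q ↦ ?_, fun q a ↦ ?_, fun ω hω η hη ↦ ?_⟩
  · have e : actMap B ∘ₗ C ∘ₗ ((LinearMap.mulLeft ℂ a).rTensor E).rTensor (E ⊗[ℂ] H) =
        (Bal.bimodule B.toBimodule B.toBimodule).lact ∘ₗ TensorProduct.mk ℂ _ _ a ∘ₗ
          actMap B ∘ₗ C := by
      ext b x y c
      have := lmul_tmulA B a (B.lact (b ⊗ₜ y)) (B.ract (x ⊗ₜ c))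
      rw [← B.mul_lact] at this
      exact this.symm
    have e' : (σ ∘ₗ (Bal.bimodule B.toBimodule B.toBimodule).lact ∘ₗ TensorProduct.mk ℂ _ _ a) ∘ₗ
        Bal.mk B.toBimodule B.toBimodule = ((Bal.bimodule B.toBimodule B.toBimodule).lact ∘ₗ
          TensorProduct.mk ℂ _ _ a ∘ₗ σ) ∘ₗ Bal.mk B.toBimodule B.toBimodule := by
      refine TensorProduct.ext' fun x y ↦ ?_
      change σ (lmul B a (tmulA B x y)) = lmul B a (σ (tmulA B x y))
      rw [lmul_tmulA, hσ, hσ]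
      refine Eq.trans ?_ (LinearMap.congr_fun e ((lproj S B).lTensor H (B.lco x) ⊗ₜ
        (rproj S B).rTensor H (B.rco y)))
      simp only [G, braid₀, LinearMap.comp_apply, TensorProduct.map_tmul, lproj_lco_lact hS]
      rfl
    obtain ⟨t, rfl⟩ := Bal.mk_surjective _ _ q
    exact LinearMap.congr_fun e' t
  · have e : actMap B ∘ₗ C ∘ₗ ((LinearMap.mulRight ℂ a).lTensor E).lTensor (H ⊗[ℂ] E) =
        (Bal.bimodule B.toBimodule B.toBimodule).ract ∘ₗ (TensorProduct.mk ℂ _ _).flip a ∘ₗ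
          actMap B ∘ₗ C := by
      ext b x y c
      have := rmul_tmulA B (B.lact (b ⊗ₜ y)) (B.ract (x ⊗ₜ c)) a
      rw [← B.ract_mul] at this
      exact this.symm
    have e' : (σ ∘ₗ (Bal.bimodule B.toBimodule B.toBimodule).ract ∘ₗ
        (TensorProduct.mk ℂ _ _).flip a) ∘ₗ Bal.mk B.toBimodule B.toBimodule =
        ((Bal.bimodule B.toBimodule B.toBimodule).ract ∘ₗ (TensorProduct.mk ℂ _ _).flip a ∘ₗ σ) ∘ₗ
          Bal.mk B.toBimodule B.toBimodule := by
      refine TensorProduct.ext' fun x y ↦ ?_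
      change σ (rmul B (tmulA B x y) a) = rmul B (σ (tmulA B x y)) a
      rw [rmul_tmulA, hσ, hσ]
      refine Eq.trans ?_ (LinearMap.congr_fun e ((lproj S B).lTensor H (B.lco x) ⊗ₜ
        (rproj S B).rTensor H (B.rco y)))
      simp only [G, braid₀, LinearMap.comp_apply, TensorProduct.map_tmul, rproj_rco_ract hS]
      rfl
    obtain ⟨t, rfl⟩ := Bal.mk_surjective _ _ q
    exact LinearMap.congr_fun e' t
  · have h₁ : B.lco ω = 1 ⊗ₜ ω := hω
    have h₂ : B.rco η = η ⊗ₜ 1 := hη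
    rw [hσ]
    change actMap B (C ((lproj S B).lTensor H (B.lco ω) ⊗ₜ (rproj S B).rTensor H (B.rco η))) = _
    rw [h₁, h₂, LinearMap.lTensor_tmul, LinearMap.rTensor_tmul, lproj_of_mem hS B hω,
      rproj_of_mem hS B hη]
    change tmulA B (B.lact (1 ⊗ₜ η)) (B.ract (ω ⊗ₜ 1)) = _
    rw [B.one_lact, B.ract_one]

lemma lco_tmulA (x y : E) : (Bal.bicomodule B B).lco (tmulA B x y) =
    TensorProduct.map (LinearMap.mul' ℂ H) (Bal.mk B.toBimodule B.toBimodule)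
      (TensorProduct.tensorTensorTensorComm ℂ H E H E (B.lco x ⊗ₜ B.lco y)) :=
  (Bal.mk_isHom B B).1 (x ⊗ₜ y)

lemma rco_tmulA (x y : E) : (Bal.bicomodule B B).rco (tmulA B x y) =
    TensorProduct.map (Bal.mk B.toBimodule B.toBimodule) (LinearMap.mul' ℂ H)
      (TensorProduct.tensorTensorTensorComm ℂ E H E H (B.rco x ⊗ₜ B.rco y)) :=
  (Bal.mk_isHom B B).2 (x ⊗ₜ y)

include hS in
/-- The braiding is a homomorphism of bicomodules. -/
lemma isHom_braiding {σ : Two B →ₗ[ℂ] Two B} (h : IsBraiding B σ) :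
    IsHom (Bal.bicomodule B B) (Bal.bicomodule B B) .id σ := by
  set D := Bal.bicov B B
  have hl : σ ∘ₗ D.lact = D.lact ∘ₗ σ.lTensor H := TensorProduct.ext' fun a q ↦ h.lmul a q
  have hr : σ ∘ₗ D.ract = D.ract ∘ₗ σ.rTensor H := TensorProduct.ext' fun q a ↦ h.rmul q a
  constructor
  -- Compatibility with the coaction is inherited by a q and q a, because σ and the coactions
  -- respect both actions. By `two_ext` only the elements ω ⊗ η remain.
  · have step_l (a : H) (q : Two B) (hq : D.lco (σ q) = TensorProduct.map .id σ (D.lco q)) :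
        D.lco (σ (lmul B a q)) = TensorProduct.map .id σ (D.lco (lmul B a q)) := by
      have := interchange_map (M := H) (N := H) .id .id .id σ (comul a) (D.lco q)
      rw [h.lmul]
      refine (D.lact_isHom.1 (a ⊗ₜ σ q)).trans (Eq.trans ?_
        (congrArg _ (D.lact_isHom.1 (a ⊗ₜ q))).symm)
      change TensorProduct.map _ _ (TensorProduct.tensorTensorTensorComm ℂ H H H _
        (comul a ⊗ₜ D.lco (σ q))) = TensorProduct.map _ _ (TensorProduct.map _ _
          (TensorProduct.tensorTensorTensorComm ℂ H H H _ (comul a ⊗ₜ D.lco q)))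
      rw [hq, TensorProduct.map_map, hl]
      rw [TensorProduct.map_id, LinearMap.id_apply] at this
      rw [this, TensorProduct.map_map]
      rfl
    have step_r (q : Two B) (a : H) (hq : D.lco (σ q) = TensorProduct.map .id σ (D.lco q)) :
        D.lco (σ (rmul B q a)) = TensorProduct.map .id σ (D.lco (rmul B q a)) := by
      have := interchange_map (M' := H) (N' := H) .id σ .id .id (D.lco q) (comul a)
      rw [h.rmul]
      refine (D.ract_isHom.1 (σ q ⊗ₜ a)).trans (Eq.trans ?_
        (congrArg _ (D.ract_isHom.1 (q ⊗ₜ a))).symm)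
      change TensorProduct.map _ _ (TensorProduct.tensorTensorTensorComm ℂ H _ H H
        (D.lco (σ q) ⊗ₜ comul a)) = TensorProduct.map _ _ (TensorProduct.map _ _
          (TensorProduct.tensorTensorTensorComm ℂ H _ H H (D.lco q ⊗ₜ comul a)))
      rw [hq, TensorProduct.map_map, hr]
      rw [TensorProduct.map_id, LinearMap.id_apply] at this
      rw [this, TensorProduct.map_map]
      rfl
    have : D.lco ∘ₗ σ = TensorProduct.map .id σ ∘ₗ D.lco := by
      refine two_ext hS B fun a ω hω η hη b ↦ step_l _ _ (step_r _ _ ?_)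
      have hω' : B.lco ω = 1 ⊗ₜ ω := hω
      -- The coaction of η lies in H ⊗ E₀, so each of its terms can be swapped with ω.
      obtain ⟨s, hs⟩ := lco_rightInv B.toBicomodule hη
      rw [h.swap ω hω η hη]
      refine (lco_tmulA B η ω).trans (Eq.trans ?_ (congrArg _ (lco_tmulA B ω η)).symm)
      rw [hω', ← hs]
      have e : TensorProduct.map (LinearMap.mul' ℂ H) (Bal.mk B.toBimodule B.toBimodule) ∘ₗ
          (TensorProduct.tensorTensorTensorComm ℂ H E H E).toLinearMap ∘ₗ
            (TensorProduct.mk ℂ _ _).flip (1 ⊗ₜ ω) ∘ₗ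
              (rightInv B.toBicomodule).subtype.lTensor H =
          TensorProduct.map .id σ ∘ₗ
            TensorProduct.map (LinearMap.mul' ℂ H) (Bal.mk B.toBimodule B.toBimodule) ∘ₗ
          (TensorProduct.tensorTensorTensorComm ℂ H E H E).toLinearMap ∘ₗ
            TensorProduct.mk ℂ _ _ (1 ⊗ₜ ω) ∘ₗ
              (rightInv B.toBicomodule).subtype.lTensor H := by
        refine TensorProduct.ext' fun a y ↦ ?_
        change (a * 1) ⊗ₜ tmulA B y ω = (1 * a) ⊗ₜ σ (tmulA B ω y)
        rw [mul_one, one_mul, h.swap ω hω y y.2]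
      exact LinearMap.congr_fun e s
    exact LinearMap.congr_fun this
  · have step_l (a : H) (q : Two B) (hq : D.rco (σ q) = TensorProduct.map σ .id (D.rco q)) :
        D.rco (σ (lmul B a q)) = TensorProduct.map σ .id (D.rco (lmul B a q)) := by
      have := interchange_map (M := H) (N := H) .id .id σ .id (comul a) (D.rco q)
      rw [h.lmul]
      refine (D.lact_isHom.2 (a ⊗ₜ σ q)).trans (Eq.trans ?_
        (congrArg _ (D.lact_isHom.2 (a ⊗ₜ q))).symm)
      change TensorProduct.map _ _ (TensorProduct.tensorTensorTensorComm ℂ H H _ H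
        (comul a ⊗ₜ D.rco (σ q))) = TensorProduct.map _ _ (TensorProduct.map _ _
          (TensorProduct.tensorTensorTensorComm ℂ H H _ H (comul a ⊗ₜ D.rco q)))
      rw [hq, TensorProduct.map_map, hl]
      rw [TensorProduct.map_id, LinearMap.id_apply] at this
      rw [this, TensorProduct.map_map]
      rfl
    have step_r (q : Two B) (a : H) (hq : D.rco (σ q) = TensorProduct.map σ .id (D.rco q)) :
        D.rco (σ (rmul B q a)) = TensorProduct.map σ .id (D.rco (rmul B q a)) := by
      have := interchange_map (M' := H) (N' := H) σ .id .id .id (D.rco q) (comul a)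
      rw [h.rmul]
      refine (D.ract_isHom.2 (σ q ⊗ₜ a)).trans (Eq.trans ?_
        (congrArg _ (D.ract_isHom.2 (q ⊗ₜ a))).symm)
      change TensorProduct.map _ _ (TensorProduct.tensorTensorTensorComm ℂ _ H H H
        (D.rco (σ q) ⊗ₜ comul a)) = TensorProduct.map _ _ (TensorProduct.map _ _
          (TensorProduct.tensorTensorTensorComm ℂ _ H H H (D.rco q ⊗ₜ comul a)))
      rw [hq, TensorProduct.map_map, hr]
      rw [TensorProduct.map_id, LinearMap.id_apply] at this
      rw [this, TensorProduct.map_map]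
      rfl
    have : D.rco ∘ₗ σ = TensorProduct.map σ .id ∘ₗ D.rco := by
      refine two_ext hS B fun a ω hω η hη b ↦ step_l _ _ (step_r _ _ ?_)
      have hη' : B.rco η = η ⊗ₜ 1 := hη
      obtain ⟨s, hs⟩ := rco_leftInv B.toBicomodule hω
      rw [h.swap ω hω η hη]
      refine (rco_tmulA B η ω).trans (Eq.trans ?_ (congrArg _ (rco_tmulA B ω η)).symm)
      rw [hη', ← hs]
      have e : TensorProduct.map (Bal.mk B.toBimodule B.toBimodule) (LinearMap.mul' ℂ H) ∘ₗ
          (TensorProduct.tensorTensorTensorComm ℂ E H E H).toLinearMap ∘ₗ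
            TensorProduct.mk ℂ _ _ (η ⊗ₜ 1) ∘ₗ
              (leftInv B.toBicomodule).subtype.rTensor H =
          TensorProduct.map σ .id ∘ₗ
            TensorProduct.map (Bal.mk B.toBimodule B.toBimodule) (LinearMap.mul' ℂ H) ∘ₗ
          (TensorProduct.tensorTensorTensorComm ℂ E H E H).toLinearMap ∘ₗ
            (TensorProduct.mk ℂ _ _).flip (η ⊗ₜ 1) ∘ₗ
              (leftInv B.toBicomodule).subtype.rTensor H := by
        refine TensorProduct.ext' fun y a ↦ ?_
        change tmulA B η y ⊗ₜ (1 * a) = σ (tmulA B y η) ⊗ₜ (a * 1)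
        rw [mul_one, one_mul, h.swap y y.2 η hη]
      exact LinearMap.congr_fun e s
    exact LinearMap.congr_fun this

end braiding

/-! ### Convolution calculus without Sweedler indices -/

section convolution

open WithConv

section ext

variable {C R R' Z : Type*} [AddCommGroup C] [Module ℂ C] [Coalgebra ℂ C] [Ring R] [Algebra ℂ R]
  [Ring R'] [Algebra ℂ R'] [AddCommGroup Z] [Module ℂ Z]

/-- Both convolution products factor through the coproduct of x, so it is enough to compare them
with the two Sweedler legs replaced by independent variables. The versions with three and four
factors iterate this. -/
lemma conv_ext₂ {Φ : R →ₗ[ℂ] Z} {Ψ : R' →ₗ[ℂ] Z} {f₁ f₂ : WithConv (C →ₗ[ℂ] R)}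
    {g₁ g₂ : WithConv (C →ₗ[ℂ] R')}
    (h : ∀ a b, Φ (f₁.ofConv a * f₂.ofConv b) = Ψ (g₁.ofConv a * g₂.ofConv b)) (x : C) :
    Φ ((f₁ * f₂).ofConv x) = Ψ ((g₁ * g₂).ofConv x) := by
  have e : Φ ∘ₗ LinearMap.mul' ℂ R ∘ₗ TensorProduct.map f₁.ofConv f₂.ofConv =
      Ψ ∘ₗ LinearMap.mul' ℂ R' ∘ₗ TensorProduct.map g₁.ofConv g₂.ofConv :=
    TensorProduct.ext' h
  exact LinearMap.congr_fun e (comul x)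

lemma conv_ext₃ {Φ : R →ₗ[ℂ] Z} {Ψ : R' →ₗ[ℂ] Z} {f₁ f₂ f₃ : WithConv (C →ₗ[ℂ] R)}
    {g₁ g₂ g₃ : WithConv (C →ₗ[ℂ] R')}
    (h : ∀ a b c, Φ (f₁.ofConv a * f₂.ofConv b * f₃.ofConv c) =
      Ψ (g₁.ofConv a * g₂.ofConv b * g₃.ofConv c)) (x : C) :
    Φ ((f₁ * f₂ * f₃).ofConv x) = Ψ ((g₁ * g₂ * g₃).ofConv x) :=
  conv_ext₂ (fun a c ↦ conv_ext₂ (Φ := Φ ∘ₗ LinearMap.mulRight ℂ (f₃.ofConv c))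
    (Ψ := Ψ ∘ₗ LinearMap.mulRight ℂ (g₃.ofConv c)) (fun a b ↦ h a b c) a) x

lemma conv_ext₄ {Φ : R →ₗ[ℂ] Z} {Ψ : R' →ₗ[ℂ] Z} {f₁ f₂ f₃ f₄ : WithConv (C →ₗ[ℂ] R)}
    {g₁ g₂ g₃ g₄ : WithConv (C →ₗ[ℂ] R')}
    (h : ∀ a b c d, Φ (f₁.ofConv a * f₂.ofConv b * f₃.ofConv c * f₄.ofConv d) =
      Ψ (g₁.ofConv a * g₂.ofConv b * g₃.ofConv c * g₄.ofConv d)) (x : C) :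
    Φ ((f₁ * f₂ * f₃ * f₄).ofConv x) = Ψ ((g₁ * g₂ * g₃ * g₄).ofConv x) :=
  conv_ext₂ (fun a d ↦ conv_ext₃ (Φ := Φ ∘ₗ LinearMap.mulRight ℂ (f₄.ofConv d))
    (Ψ := Ψ ∘ₗ LinearMap.mulRight ℂ (g₄.ofConv d)) (fun a b c ↦ h a b c d) a) x

/-- A functional with values in the scalars of an algebra. -/
def scal (R : Type*) [Ring R] [Algebra ℂ R] (f : WithConv (C →ₗ[ℂ] ℂ)) : WithConv (C →ₗ[ℂ] R) :=
  toConv (Algebra.linearMap ℂ R ∘ₗ f.ofConv)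

end ext

section antipode

variable {A R R' : Type*} [Ring A] [HopfAlgebra ℂ A] [Ring R] [Algebra ℂ R]
  [Ring R'] [Algebra ℂ R']

/-- An algebra homomorphism as an element of the convolution algebra. -/
def homConv (φ : A →ₐ[ℂ] R) : WithConv (A →ₗ[ℂ] R) := toConv φ.toLinearMap

/-- The convolution inverse of an algebra homomorphism. -/
def antiConv (φ : A →ₐ[ℂ] R) : WithConv (A →ₗ[ℂ] R) :=
  toConv (φ.toLinearMap ∘ₗ HopfAlgebra.antipode ℂ)

lemma antiConv_mul_homConv (φ : A →ₐ[ℂ] R) : antiConv φ * homConv φ = 1 := by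
  have h := LinearMap.algHom_comp_convMul_distrib φ (toConv (HopfAlgebra.antipode ℂ (A := A)))
    (toConv .id)
  rw [LinearMap.antipode_mul_id] at h
  refine WithConv.ofConv_injective (h.symm.trans (LinearMap.ext fun x ↦ ?_))
  simp

lemma homConv_mul_antiConv (φ : A →ₐ[ℂ] R) : homConv φ * antiConv φ = 1 := by
  have h := LinearMap.algHom_comp_convMul_distrib φ (toConv .id)
    (toConv (HopfAlgebra.antipode ℂ (A := A)))
  rw [LinearMap.id_mul_antipode] at h
  refine WithConv.ofConv_injective (h.symm.trans (LinearMap.ext fun x ↦ ?_))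
  simp

lemma comp_conv (φ : R →ₐ[ℂ] R') (f g : WithConv (A →ₗ[ℂ] R)) :
    toConv (φ.toLinearMap ∘ₗ (f * g).ofConv) =
      toConv (φ.toLinearMap ∘ₗ f.ofConv) * toConv (φ.toLinearMap ∘ₗ g.ofConv) :=
  WithConv.ofConv_injective (LinearMap.algHom_comp_convMul_distrib φ f g)

/-- Uniqueness of inverses in the convolution algebra, with the order of the factors reversed. -/
lemma antiConv_eq {φ : A →ₐ[ℂ] R} {f f' g g' : WithConv (A →ₗ[ℂ] R)} (h : homConv φ = f * g)
    (hf : f * f' = 1) (hg : g * g' = 1) : antiConv φ = g' * f' := by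
  refine left_inv_eq_right_inv (antiConv_mul_homConv φ) ?_
  rw [h, mul_assoc, ← mul_assoc g, hg, one_mul, hf]

end antipode

section tensor

variable {A Q R : Type*} [Ring A] [HopfAlgebra ℂ A] [Ring Q] [Bialgebra ℂ Q]
  [Ring R] [Bialgebra ℂ R]

/-- `x ↦ x ⊗ 1`. -/
abbrev incl (R Q : Type*) [Ring R] [Algebra ℂ R] [Ring Q] [Algebra ℂ Q] : R →ₐ[ℂ] R ⊗[ℂ] Q :=
  Algebra.TensorProduct.includeLeft

/-- `x ↦ 1 ⊗ x`. -/
abbrev incr (R Q : Type*) [Ring R] [Algebra ℂ R] [Ring Q] [Algebra ℂ Q] : Q →ₐ[ℂ] R ⊗[ℂ] Q :=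
  Algebra.TensorProduct.includeRight

lemma comul_incl (x : R) : comul (R := ℂ) (incl R Q x) =
    TensorProduct.map (incl R Q).toLinearMap (incl R Q).toLinearMap (comul x) := by
  have e : (TensorProduct.tensorTensorTensorComm ℂ R R Q Q).toLinearMap ∘ₗ
      (TensorProduct.mk ℂ _ _).flip (1 ⊗ₜ 1) =
      TensorProduct.map (incl R Q).toLinearMap (incl R Q).toLinearMap := by ext; simp
  rw [comul_tensor]
  simpa [Algebra.TensorProduct.one_def] using LinearMap.congr_fun e (comul x)

lemma comul_incr (x : Q) : comul (R := ℂ) (incr R Q x) =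
    TensorProduct.map (incr R Q).toLinearMap (incr R Q).toLinearMap (comul x) := by
  have e : (TensorProduct.tensorTensorTensorComm ℂ R R Q Q).toLinearMap ∘ₗ
      TensorProduct.mk ℂ _ _ (1 ⊗ₜ 1) =
      TensorProduct.map (incr R Q).toLinearMap (incr R Q).toLinearMap := by ext; simp
  rw [comul_tensor]
  simpa [Algebra.TensorProduct.one_def] using LinearMap.congr_fun e (comul x)

lemma homConv_comul {φ : A →ₐ[ℂ] R}
    (h : ∀ x, comul (R := ℂ) (φ x) = TensorProduct.map φ.toLinearMap φ.toLinearMap (comul x)) :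
    homConv ((Bialgebra.comulAlgHom ℂ R).comp φ) =
      homConv ((incl R R).comp φ) * homConv ((incr R R).comp φ) := by
  have e : TensorProduct.map φ.toLinearMap φ.toLinearMap = LinearMap.mul' ℂ (R ⊗[ℂ] R) ∘ₗ
      TensorProduct.map ((incl R R).comp φ).toLinearMap ((incr R R).comp φ).toLinearMap := by
    ext; simp
  exact WithConv.ofConv_injective (LinearMap.ext fun x ↦
    (h x).trans (LinearMap.congr_fun e (comul x)))

/-- Anti-comultiplicativity of the antipode: Δ ∘ φ is the product of the embeddings of φ into the
two tensor factors, and passing to convolution inverses reverses their order. -/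
lemma antiConv_comul {φ : A →ₐ[ℂ] R}
    (h : ∀ x, comul (R := ℂ) (φ x) = TensorProduct.map φ.toLinearMap φ.toLinearMap (comul x)) :
    antiConv ((Bialgebra.comulAlgHom ℂ R).comp φ) =
      antiConv ((incr R R).comp φ) * antiConv ((incl R R).comp φ) :=
  antiConv_eq (homConv_comul h) (homConv_mul_antiConv _) (homConv_mul_antiConv _)

end tensor

end convolution

/-! ### The antipode of the deformed Hopf algebra -/

section twist_antipode

open WithConv

variable {A : Type*} [Ring A] [HopfAlgebra ℂ A]

lemma comp_homConv {R R' : Type*} [Ring R] [Algebra ℂ R] [Ring R'] [Algebra ℂ R']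
    (φ : R →ₐ[ℂ] R') (f : A →ₐ[ℂ] R) :
    toConv (φ.toLinearMap ∘ₗ (homConv f).ofConv) = homConv (φ.comp f) := rfl

lemma comp_antiConv {R R' : Type*} [Ring R] [Algebra ℂ R] [Ring R'] [Algebra ℂ R']
    (φ : R →ₐ[ℂ] R') (f : A →ₐ[ℂ] R) :
    toConv (φ.toLinearMap ∘ₗ (antiConv f).ofConv) = antiConv (φ.comp f) := rfl

lemma comp_scal {R R' : Type*} [Ring R] [Algebra ℂ R] [Ring R'] [Algebra ℂ R']
    (φ : R →ₐ[ℂ] R') (f : WithConv (A →ₗ[ℂ] ℂ)) :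
    toConv (φ.toLinearMap ∘ₗ (scal R f).ofConv) = scal R' f :=
  WithConv.ofConv_injective (LinearMap.ext fun _ ↦ φ.commutes _)

section comul

variable {R : Type*} [Ring R] [Bialgebra ℂ R]

lemma comul_conv (f g : WithConv (A →ₗ[ℂ] R)) :
    toConv (comul (R := ℂ) ∘ₗ (f * g).ofConv) =
      toConv (comul (R := ℂ) ∘ₗ f.ofConv) * toConv (comul (R := ℂ) ∘ₗ g.ofConv) :=
  comp_conv (Bialgebra.comulAlgHom ℂ R) f g

lemma comul_homConv {φ : A →ₐ[ℂ] R}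
    (h : ∀ x, comul (R := ℂ) (φ x) = TensorProduct.map φ.toLinearMap φ.toLinearMap (comul x)) :
    toConv (comul (R := ℂ) ∘ₗ (homConv φ).ofConv) =
      homConv ((incl R R).comp φ) * homConv ((incr R R).comp φ) :=
  homConv_comul h

lemma comul_antiConv {φ : A →ₐ[ℂ] R}
    (h : ∀ x, comul (R := ℂ) (φ x) = TensorProduct.map φ.toLinearMap φ.toLinearMap (comul x)) :
    toConv (comul (R := ℂ) ∘ₗ (antiConv φ).ofConv) =
      antiConv ((incr R R).comp φ) * antiConv ((incl R R).comp φ) :=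
  antiConv_comul h

end comul

/-- `a ↦ S(a₍₁₎) ⊗ a₍₂₎`. -/
def antiPair (A : Type*) [Ring A] [HopfAlgebra ℂ A] : WithConv (A →ₗ[ℂ] A ⊗[ℂ] A) :=
  antiConv (incl A A) * homConv (incr A A)

/-- `a ↦ a₍₁₎ ⊗ S(a₍₂₎)`. -/
def pairAnti (A : Type*) [Ring A] [HopfAlgebra ℂ A] : WithConv (A →ₗ[ℂ] A ⊗[ℂ] A) :=
  homConv (incl A A) * antiConv (incr A A)

lemma map_comul {Q R : Type*} [Ring R] [Algebra ℂ R] [Ring Q] [Algebra ℂ Q]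
    (f : WithConv (A →ₗ[ℂ] R)) (g : WithConv (A →ₗ[ℂ] Q)) (x : A) :
    TensorProduct.map f.ofConv g.ofConv (comul x) =
      (toConv ((incl R Q).toLinearMap ∘ₗ f.ofConv) *
        toConv ((incr R Q).toLinearMap ∘ₗ g.ofConv)).ofConv x := by
  have e : TensorProduct.map f.ofConv g.ofConv = LinearMap.mul' ℂ _ ∘ₗ
      TensorProduct.map ((incl R Q).toLinearMap ∘ₗ f.ofConv)
        ((incr R Q).toLinearMap ∘ₗ g.ofConv) := by ext; simp
  exact LinearMap.congr_fun e _

lemma antiPair_eq (x : A) : (antiPair A).ofConv x =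
    TensorProduct.map (HopfAlgebra.antipode ℂ) .id (comul x) :=
  (map_comul (toConv (HopfAlgebra.antipode ℂ)) (toConv .id) x).symm

lemma pairAnti_eq (x : A) : (pairAnti A).ofConv x =
    TensorProduct.map .id (HopfAlgebra.antipode ℂ) (comul x) :=
  (map_comul (toConv .id) (toConv (HopfAlgebra.antipode ℂ)) x).symm

lemma mul_antiPair (x : A) : LinearMap.mul' ℂ A ((antiPair A).ofConv x) =
    algebraMap ℂ A (counit x) := by
  rw [antiPair_eq]
  exact HopfAlgebra.mul_antipode_rTensor_comul_apply x

lemma mul_pairAnti (x : A) : LinearMap.mul' ℂ A ((pairAnti A).ofConv x) =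
    algebraMap ℂ A (counit x) := by
  rw [pairAnti_eq]
  exact HopfAlgebra.mul_antipode_lTensor_comul_apply x

/-- The antipode flips its two legs, so the inner pair S(a₍₂₎) ⊗ a₍₃₎ appears whole in the first
factor, while the outer legs S(a₍₁₎) and a₍₄₎ form the second. Applying a functional to one factor
and, where needed, the product to the other then collapses the expression. `comul_pairAnti` is the
mirror image. -/
lemma comul_antiPair : toConv (comul (R := ℂ) ∘ₗ (antiPair A).ofConv) =
    antiConv ((incr _ _).comp (incl A A)) *
      toConv ((incl _ _).toLinearMap ∘ₗ (antiPair A).ofConv) *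
      homConv ((incr (A ⊗[ℂ] A) (A ⊗[ℂ] A)).comp (incr A A)) := by
  rw [antiPair, comul_conv, comul_antiConv comul_incl, comul_homConv comul_incr, comp_conv, comp_homConv, comp_antiConv]
  simp only [mul_assoc]

lemma comul_pairAnti : toConv (comul (R := ℂ) ∘ₗ (pairAnti A).ofConv) =
    homConv ((incl _ _).comp (incl A A)) *
      toConv ((incr _ _).toLinearMap ∘ₗ (pairAnti A).ofConv) *
      antiConv ((incl (A ⊗[ℂ] A) (A ⊗[ℂ] A)).comp (incr A A)) := by
  rw [pairAnti, comul_conv, comul_antiConv comul_incr, comul_homConv comul_incl, comp_conv, comp_homConv, comp_antiConv]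
  simp only [mul_assoc]

lemma lop_antiPair (f : A ⊗[ℂ] A →ₗ[ℂ] ℂ) (x : A) :
    (self (A ⊗[ℂ] A)).lop f ((antiPair A).ofConv x) =
      (antiConv (incl A A) * scal _ (toConv (f ∘ₗ (antiPair A).ofConv)) *
        homConv (incr A A)).ofConv x := by
  have h := LinearMap.congr_fun (congrArg ofConv (comul_antiPair (A := A))) x
  refine (congrArg ((TensorProduct.lid ℂ (A ⊗[ℂ] A)).toLinearMap ∘ₗ f.rTensor _) h).trans ?_
  refine conv_ext₃ (Ψ := (LinearMap.id : A ⊗[ℂ] A →ₗ[ℂ] A ⊗[ℂ] A)) (fun a b c ↦ ?_) x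
  simp [antiConv, homConv, scal, Algebra.algebraMap_eq_smul_one]

lemma rop_pairAnti (f : A ⊗[ℂ] A →ₗ[ℂ] ℂ) (x : A) :
    (self (A ⊗[ℂ] A)).rop f ((pairAnti A).ofConv x) =
      (homConv (incl A A) * scal _ (toConv (f ∘ₗ (pairAnti A).ofConv)) *
        antiConv (incr A A)).ofConv x := by
  have h := LinearMap.congr_fun (congrArg ofConv (comul_pairAnti (A := A))) x
  refine (congrArg ((TensorProduct.rid ℂ (A ⊗[ℂ] A)).toLinearMap ∘ₗ f.lTensor _) h).trans ?_
  refine conv_ext₃ (Ψ := (LinearMap.id : A ⊗[ℂ] A →ₗ[ℂ] A ⊗[ℂ] A)) (fun a b c ↦ ?_) x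
  simp [antiConv, homConv, scal, Algebra.algebraMap_eq_smul_one]

/-- Here f is applied to the outer legs and the product to the inner pair, which becomes S(a₍₂₎)
a₍₃₎ and reduces to a counit. -/
lemma mul_rop_antiPair (f : A ⊗[ℂ] A →ₗ[ℂ] ℂ) (x : A) :
    LinearMap.mul' ℂ A ((self (A ⊗[ℂ] A)).rop f ((antiPair A).ofConv x)) =
      algebraMap ℂ A (f ((antiPair A).ofConv x)) := by
  have h := LinearMap.congr_fun (congrArg ofConv (comul_antiPair (A := A))) x
  refine (congrArg (LinearMap.mul' ℂ A ∘ₗ (TensorProduct.rid ℂ (A ⊗[ℂ] A)).toLinearMap ∘ₗ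
    f.lTensor _) h).trans ?_
  have h' : antiPair A = antiConv (incl A A) * 1 * homConv (incr A A) := by
    rw [mul_one, antiPair]
  conv_rhs => rw [h']
  refine conv_ext₃ (Ψ := Algebra.linearMap ℂ A ∘ₗ f) (fun a b c ↦ ?_) x
  simpa [antiConv, homConv, Algebra.algebraMap_eq_smul_one, mul_antiPair] using smul_comm _ _ _

lemma mul_lop_pairAnti (f : A ⊗[ℂ] A →ₗ[ℂ] ℂ) (x : A) :
    LinearMap.mul' ℂ A ((self (A ⊗[ℂ] A)).lop f ((pairAnti A).ofConv x)) =
      algebraMap ℂ A (f ((pairAnti A).ofConv x)) := by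
  have h := LinearMap.congr_fun (congrArg ofConv (comul_pairAnti (A := A))) x
  refine (congrArg (LinearMap.mul' ℂ A ∘ₗ (TensorProduct.lid ℂ (A ⊗[ℂ] A)).toLinearMap ∘ₗ
    f.rTensor _) h).trans ?_
  have h' : pairAnti A = homConv (incl A A) * 1 * antiConv (incr A A) := by
    rw [mul_one, pairAnti]
  conv_rhs => rw [h']
  refine conv_ext₃ (Ψ := Algebra.linearMap ℂ A ∘ₗ f) (fun a b c ↦ ?_) x
  simpa [antiConv, homConv, Algebra.algebraMap_eq_smul_one, mul_pairAnti] using smul_comm _ _ _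

variable (𝓒 : DualTwoCocycle A)

/-- The deformed product is the old one after `lop` of γ and `rop` of γ⁻¹, which commute. The first
is undone by the argument, so only the second survives. -/
lemma DualTwoCocycle.mulΩ_lop (t : A ⊗[ℂ] A) :
    𝓒.mulΩ ((self (A ⊗[ℂ] A)).lop 𝓒.γinv t) =
      LinearMap.mul' ℂ A ((self (A ⊗[ℂ] A)).rop 𝓒.γinv t) := by
  have h := (self (A ⊗[ℂ] A)).lop_lop 𝓒.Ω.val 𝓒.Ω⁻¹.val t
  rw [Units.inv_mul, lop_one] at h
  rw [mulΩ, deform, self_tensor, Bicomodule.ad, LinearMap.comp_apply, LinearMap.comp_apply,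
    lop_rop]
  exact congrArg (fun s ↦ LinearMap.mul' ℂ A ((self (A ⊗[ℂ] A)).rop 𝓒.γinv s)) h

lemma DualTwoCocycle.mulΩ_rop (t : A ⊗[ℂ] A) :
    𝓒.mulΩ ((self (A ⊗[ℂ] A)).rop 𝓒.γ t) =
      LinearMap.mul' ℂ A ((self (A ⊗[ℂ] A)).lop 𝓒.γ t) := by
  have h := (self (A ⊗[ℂ] A)).rop_rop 𝓒.Ω⁻¹.val 𝓒.Ω.val t
  rw [Units.inv_mul, rop_one] at h
  rw [mulΩ, deform, self_tensor, Bicomodule.ad, LinearMap.comp_apply, LinearMap.comp_apply]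
  exact congrArg (fun s ↦ LinearMap.mul' ℂ A ((self (A ⊗[ℂ] A)).lop 𝓒.γ s)) h

/-- `U(a) = γ(a₍₁₎ ⊗ S(a₍₂₎))`. -/
def DualTwoCocycle.U : WithConv (A →ₗ[ℂ] ℂ) := toConv (𝓒.γ ∘ₗ (pairAnti A).ofConv)

/-- `V(a) = γ⁻¹(S(a₍₁₎) ⊗ a₍₂₎)`. -/
def DualTwoCocycle.V : WithConv (A →ₗ[ℂ] ℂ) := toConv (𝓒.γinv ∘ₗ (antiPair A).ofConv)

/-- By `lop_antiPair` the argument S(a₍₁₎) V(a₍₂₎) ⊗ a₍₃₎ is `lop` of γ⁻¹ on S(a₍₁₎) ⊗ a₍₂₎. Half of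
the deformed product cancels and `mul_rop_antiPair` evaluates the rest. So S * V is a left inverse
of the identity up to the scalar functional V; `mulΩ_U` is the right-hand counterpart. -/
lemma DualTwoCocycle.mulΩ_V (x : A) :
    𝓒.mulΩ (TensorProduct.map (antiConv (AlgHom.id ℂ A) * scal A 𝓒.V).ofConv .id (comul x)) =
      algebraMap ℂ A (𝓒.V.ofConv x) := by
  have h := map_comul (antiConv (AlgHom.id ℂ A) * scal A 𝓒.V) (toConv .id) x
  rw [comp_conv, comp_antiConv, comp_scal] at h
  rw [ofConv_toConv] at h
  rw [h]
  refine (congrArg 𝓒.mulΩ (lop_antiPair 𝓒.γinv x).symm).trans ?_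
  rw [mulΩ_lop, mul_rop_antiPair]
  rfl

lemma DualTwoCocycle.mulΩ_U (x : A) :
    𝓒.mulΩ (TensorProduct.map .id (scal A 𝓒.U * antiConv (AlgHom.id ℂ A)).ofConv (comul x)) =
      algebraMap ℂ A (𝓒.U.ofConv x) := by
  have h := map_comul (toConv .id) (scal A 𝓒.U * antiConv (AlgHom.id ℂ A)) x
  rw [comp_conv, comp_antiConv, comp_scal, ← mul_assoc] at h
  rw [ofConv_toConv] at h
  rw [h]
  refine (congrArg 𝓒.mulΩ (rop_pairAnti 𝓒.γ x).symm).trans ?_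
  rw [mulΩ_rop, mul_lop_pairAnti]
  rfl

lemma DualTwoCocycle.γ_one_tmul (a : A) : 𝓒.γ (1 ⊗ₜ a) = counit (R := ℂ) a := 𝓒.counit_left a

lemma DualTwoCocycle.γ_tmul_one (a : A) : 𝓒.γ (a ⊗ₜ 1) = counit (R := ℂ) a := 𝓒.counit_right a

lemma DualTwoCocycle.γinv_one_tmul (a : A) : 𝓒.γinv (1 ⊗ₜ a) = counit (R := ℂ) a := by
  have h : Units.map (pull (degen₀ A)) 𝓒.Ω = 1 :=
    Units.ext (WithConv.ofConv_injective (LinearMap.ext 𝓒.counit_left))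
  have h' : Units.map (pull (degen₀ A)) 𝓒.Ω⁻¹ = 1 := by rw [map_inv, h, inv_one]
  exact LinearMap.congr_fun (congrArg (fun u : (WithConv (A →ₗ[ℂ] ℂ))ˣ ↦ u.val.ofConv) h') a

lemma DualTwoCocycle.γinv_tmul_one (a : A) : 𝓒.γinv (a ⊗ₜ 1) = counit (R := ℂ) a := by
  have h : Units.map (pull (degen₁ A)) 𝓒.Ω = 1 :=
    Units.ext (WithConv.ofConv_injective (LinearMap.ext 𝓒.counit_right))
  have h' : Units.map (pull (degen₁ A)) 𝓒.Ω⁻¹ = 1 := by rw [map_inv, h, inv_one]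
  exact LinearMap.congr_fun (congrArg (fun u : (WithConv (A →ₗ[ℂ] ℂ))ˣ ↦ u.val.ofConv) h') a

/-- `a ⊗ b ↦ (1 ⊗ a) ⊗ b`. -/
def inclLast (A : Type*) [Ring A] [Algebra ℂ A] : A ⊗[ℂ] A →ₐ[ℂ] (A ⊗[ℂ] A) ⊗[ℂ] A :=
  Algebra.TensorProduct.map (incr A A) (AlgHom.id ℂ A)

lemma comul_comp_incl {Q R : Type*} [Ring Q] [Bialgebra ℂ Q] [Ring R] [Bialgebra ℂ R]
    {φ : A →ₐ[ℂ] R}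
    (h : ∀ x, comul (R := ℂ) (φ x) = TensorProduct.map φ.toLinearMap φ.toLinearMap (comul x))
    (x : A) : comul (R := ℂ) ((incl R Q).comp φ x) =
      TensorProduct.map ((incl R Q).comp φ).toLinearMap ((incl R Q).comp φ).toLinearMap
        (comul x) := by
  have e := comul_incl (Q := Q) (φ x)
  rw [h, TensorProduct.map_map] at e
  exact e

lemma face₀_inclLast (a : A) (t : A ⊗[ℂ] A) :
    DualTwoCocycle.face₀ A (((a ⊗ₜ 1) ⊗ₜ 1) * inclLast A t) = counit (R := ℂ) a • t := by
  induction t using TensorProduct.induction_on with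
  | zero => simp
  | add u v hu hv => simp only [map_add, mul_add, hu, hv, smul_add]
  | tmul x y => simp [inclLast, DualTwoCocycle.face₀]

lemma face₁_inclLast (a : A) (t : A ⊗[ℂ] A) :
    DualTwoCocycle.face₁ A (((a ⊗ₜ 1) ⊗ₜ 1) * inclLast A t) = a ⊗ₜ LinearMap.mul' ℂ A t := by
  induction t using TensorProduct.induction_on with
  | zero => simp
  | add u v hu hv => simp only [map_add, mul_add, hu, hv, TensorProduct.tmul_add]
  | tmul x y => simp [inclLast, DualTwoCocycle.face₁]

section triple

variable {R : Type*} [Ring R] [Bialgebra ℂ R]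

/-- Meant for the embeddings of A into the three factors of A ⊗ A ⊗ A, where it is the coproduct of
a₍₁₎ ⊗ S(a₍₂₎) ⊗ a₍₃₎. Because the middle term flips, the legs group into the pairs φ₁ * S φ₂ and S
φ₂ * φ₃, so that U and V can be read off. -/
lemma comul_triple {φ₁ φ₂ φ₃ : A →ₐ[ℂ] R}
    (h₁ : ∀ x, comul (R := ℂ) (φ₁ x) =
      TensorProduct.map φ₁.toLinearMap φ₁.toLinearMap (comul x))
    (h₂ : ∀ x, comul (R := ℂ) (φ₂ x) =
      TensorProduct.map φ₂.toLinearMap φ₂.toLinearMap (comul x))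
    (h₃ : ∀ x, comul (R := ℂ) (φ₃ x) =
      TensorProduct.map φ₃.toLinearMap φ₃.toLinearMap (comul x)) :
    toConv (comul (R := ℂ) ∘ₗ (homConv φ₁ * antiConv φ₂ * homConv φ₃).ofConv) =
      homConv ((incl R R).comp φ₁) *
        toConv ((incr R R).toLinearMap ∘ₗ (homConv φ₁ * antiConv φ₂).ofConv) *
        toConv ((incl R R).toLinearMap ∘ₗ (antiConv φ₂ * homConv φ₃).ofConv) *
        homConv ((incr R R).comp φ₃) := by
  rw [comul_conv, comul_conv, comul_homConv h₁, comul_antiConv h₂, comul_homConv h₃, comp_conv,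
    comp_conv]
  simp only [comp_homConv, comp_antiConv, mul_assoc]

lemma conv_triple {φ₁ φ₂ φ₃ : A →ₐ[ℂ] R}
    (h₁ : ∀ x, comul (R := ℂ) (φ₁ x) =
      TensorProduct.map φ₁.toLinearMap φ₁.toLinearMap (comul x))
    (h₂ : ∀ x, comul (R := ℂ) (φ₂ x) =
      TensorProduct.map φ₂.toLinearMap φ₂.toLinearMap (comul x))
    (h₃ : ∀ x, comul (R := ℂ) (φ₃ x) =
      TensorProduct.map φ₃.toLinearMap φ₃.toLinearMap (comul x))
    {f g : WithConv (R →ₗ[ℂ] ℂ)} {k₁ k₂ k₃ k₄ : WithConv (A →ₗ[ℂ] ℂ)}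
    (h : ∀ a b c d, f.ofConv (φ₁ a * (antiConv φ₂ * homConv φ₃).ofConv c) *
      g.ofConv ((homConv φ₁ * antiConv φ₂).ofConv b * φ₃ d) =
      k₁.ofConv a * k₂.ofConv b * k₃.ofConv c * k₄.ofConv d) (x : A) :
    (f * g).ofConv ((homConv φ₁ * antiConv φ₂ * homConv φ₃).ofConv x) =
      (k₁ * k₂ * k₃ * k₄).ofConv x := by
  have e := LinearMap.congr_fun (congrArg ofConv (comul_triple h₁ h₂ h₃)) x
  refine (congrArg (LinearMap.mul' ℂ ℂ ∘ₗ TensorProduct.map f.ofConv g.ofConv) e).trans ?_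
  refine conv_ext₄ (Ψ := (LinearMap.id : ℂ →ₗ[ℂ] ℂ)) (fun a b c d ↦ ?_) x
  simpa [homConv] using h a b c d

end triple

lemma antiConv_mul_homConv_last (x : A) :
    (antiConv ((incl (A ⊗[ℂ] A) A).comp (incr A A)) * homConv (incr (A ⊗[ℂ] A) A)).ofConv x =
      inclLast A ((antiPair A).ofConv x) := by
  have e₁ : (inclLast A).comp (incl A A) = (incl (A ⊗[ℂ] A) A).comp (incr A A) := by
    ext; simp [inclLast]
  have e₂ : (inclLast A).comp (incr A A) = incr (A ⊗[ℂ] A) A := by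
    ext; simp [inclLast, Algebra.TensorProduct.one_def]
  have h := comp_conv (inclLast A) (antiConv (incl A A)) (homConv (incr A A))
  rw [comp_homConv, comp_antiConv, e₁, e₂] at h
  exact (LinearMap.congr_fun (congrArg ofConv h) x).symm

lemma homConv_mul_antiConv_first (x : A) :
    (homConv ((incl (A ⊗[ℂ] A) A).comp (incl A A)) *
      antiConv ((incl (A ⊗[ℂ] A) A).comp (incr A A))).ofConv x =
      (pairAnti A).ofConv x ⊗ₜ 1 := by
  have h := comp_conv (incl (A ⊗[ℂ] A) A) (homConv (incl A A)) (antiConv (incr A A))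
  exact (LinearMap.congr_fun (congrArg ofConv h) x).symm

lemma conv_pairTriple {f g : WithConv ((A ⊗[ℂ] A) ⊗[ℂ] A →ₗ[ℂ] ℂ)}
    {k₁ k₂ k₃ k₄ : WithConv (A →ₗ[ℂ] ℂ)}
    (h : ∀ a b c d, f.ofConv (((a ⊗ₜ 1) ⊗ₜ 1) * inclLast A ((antiPair A).ofConv c)) *
      g.ofConv ((pairAnti A).ofConv b ⊗ₜ d) =
      k₁.ofConv a * k₂.ofConv b * k₃.ofConv c * k₄.ofConv d) (x : A) :
    (f * g).ofConv ((homConv ((incl (A ⊗[ℂ] A) A).comp (incl A A)) *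
      antiConv ((incl _ _).comp (incr A A)) * homConv (incr _ _)).ofConv x) =
      (k₁ * k₂ * k₃ * k₄).ofConv x := by
  refine conv_triple (comul_comp_incl comul_incl) (comul_comp_incl comul_incr) comul_incr
    (fun a b c d ↦ ?_) x
  rw [antiConv_mul_homConv_last, homConv_mul_antiConv_first]
  refine Eq.trans ?_ (h a b c d)
  simp

/-- Write the cocycle identity as face₀⁻¹ face₃ = face₁ face₂⁻¹ and evaluate it on a₍₁₎ ⊗ S(a₍₂₎) ⊗
a₍₃₎. On the left, γ sees a pair x₍₁₎ ⊗ S(x₍₂₎) and γ⁻¹ a pair S(x₍₁₎) ⊗ x₍₂₎, which gives U * V. On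
the right these pairs are multiplied and become counits, so normalisation leaves 1. -/
lemma DualTwoCocycle.U_mul_V : 𝓒.U * 𝓒.V = 1 := by
  have h : (Units.map (pull (face₀ A)) 𝓒.Ω)⁻¹ * Units.map (pull (face₃ A)) 𝓒.Ω =
      Units.map (pull (face₁ A)) 𝓒.Ω * (Units.map (pull (face₂ A)) 𝓒.Ω)⁻¹ := by
    rw [inv_mul_eq_iff_eq_mul, ← mul_assoc, ← cocycle', mul_inv_cancel_right]
  rw [← map_inv, ← map_inv] at h
  have k : pull (face₀ A) 𝓒.Ω⁻¹.val * pull (face₃ A) 𝓒.Ω.val =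
      pull (face₁ A) 𝓒.Ω.val * pull (face₂ A) 𝓒.Ω⁻¹.val := congrArg Units.val h
  refine WithConv.ofConv_injective (LinearMap.ext fun x ↦ ?_)
  have h₁ := conv_pairTriple (f := pull (face₀ A) 𝓒.Ω⁻¹.val) (g := pull (face₃ A) 𝓒.Ω.val)
    (k₁ := 1) (k₂ := 𝓒.U) (k₃ := 𝓒.V) (k₄ := 1) (fun a b c d ↦ by
      have e : face₃ A ((pairAnti A).ofConv b ⊗ₜ d) = counit (R := ℂ) d • (pairAnti A).ofConv b := by
        simp [face₃]
      change 𝓒.γinv (face₀ A _) * 𝓒.γ (face₃ A _) = _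
      rw [e, face₀_inclLast]
      simp [U, V]
      ring) x
  have h₂ := conv_pairTriple (f := pull (face₁ A) 𝓒.Ω.val) (g := pull (face₂ A) 𝓒.Ω⁻¹.val)
    (k₁ := 1) (k₂ := 1) (k₃ := 1) (k₄ := 1) (fun a b c d ↦ by
      have e : face₂ A ((pairAnti A).ofConv b ⊗ₜ d) =
          LinearMap.mul' ℂ A ((pairAnti A).ofConv b) ⊗ₜ d := by
        simp [face₂]
      change 𝓒.γ (face₁ A _) * 𝓒.γinv (face₂ A _) = _
      rw [e, face₁_inclLast, mul_antiPair, mul_pairAnti, Algebra.algebraMap_eq_smul_one,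
        Algebra.algebraMap_eq_smul_one, TensorProduct.tmul_smul, ← TensorProduct.smul_tmul',
        map_smul, map_smul, γ_tmul_one, γinv_one_tmul]
      simp
      ring) x
  rw [k, h₂] at h₁
  simpa using h₁.symm

/-- The deformed Hopf algebra has an antipode. -/
lemma Twist.exists_isAntipode : ∃ T : Twist 𝓒 →ₗ[ℂ] Twist 𝓒, IsAntipode T := by
  let T : WithConv (Twist 𝓒 →ₗ[ℂ] Twist 𝓒) :=
    toConv (antiConv (AlgHom.id ℂ A) * scal A 𝓒.V).ofConv
  let T' : WithConv (Twist 𝓒 →ₗ[ℂ] Twist 𝓒) :=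
    toConv (scal A 𝓒.U * antiConv (AlgHom.id ℂ A)).ofConv
  let I : WithConv (Twist 𝓒 →ₗ[ℂ] Twist 𝓒) := toConv .id
  let u : WithConv (Twist 𝓒 →ₗ[ℂ] Twist 𝓒) :=
    toConv (Algebra.linearMap ℂ (Twist 𝓒) ∘ₗ 𝓒.U.ofConv)
  let v : WithConv (Twist 𝓒 →ₗ[ℂ] Twist 𝓒) :=
    toConv (Algebra.linearMap ℂ (Twist 𝓒) ∘ₗ 𝓒.V.ofConv)
  have huv : u * v = 1 := by
    have e : LinearMap.mul' ℂ (Twist 𝓒) ∘ₗ TensorProduct.map u.ofConv v.ofConv =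
        Algebra.linearMap ℂ (Twist 𝓒) ∘ₗ LinearMap.mul' ℂ ℂ ∘ₗ
          TensorProduct.map 𝓒.U.ofConv 𝓒.V.ofConv :=
      TensorProduct.ext' fun _ _ ↦ (map_mul (algebraMap ℂ (Twist 𝓒)) _ _).symm
    have h := congrArg (fun f ↦ Algebra.linearMap ℂ (Twist 𝓒) ∘ₗ f.ofConv) 𝓒.U_mul_V
    exact WithConv.ofConv_injective (LinearMap.ext fun x ↦
      (LinearMap.congr_fun e (comul (R := ℂ) (A := A) x)).trans (LinearMap.congr_fun h x))
  have e (c : ℂ) : algebraMap ℂ (Twist 𝓒) c = algebraMap ℂ A c := by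
    rw [Algebra.algebraMap_eq_smul_one, Algebra.algebraMap_eq_smul_one]
    rfl
  have h₁ : T * I = v := by
    refine WithConv.ofConv_injective (LinearMap.ext fun x ↦ ?_)
    change LinearMap.mul' ℂ (Twist 𝓒) _ = algebraMap ℂ (Twist 𝓒) _
    rw [Twist.mul'_eq, e]
    exact 𝓒.mulΩ_V x
  have h₂ : I * T' = u := by
    refine WithConv.ofConv_injective (LinearMap.ext fun x ↦ ?_)
    change LinearMap.mul' ℂ (Twist 𝓒) _ = algebraMap ℂ (Twist 𝓒) _
    rw [Twist.mul'_eq, e]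
    exact 𝓒.mulΩ_U x
  -- The relation U * V = 1 makes U * S * V a left and T' * v a right convolution inverse of the
  -- identity of A_Ω. In a monoid such inverses coincide, so V * U = 1 is not needed.
  have l : (u * T) * I = 1 := by rw [mul_assoc, h₁, huv]
  have r : I * (T' * v) = 1 := by rw [← mul_assoc, h₂, huv]
  have r' : I * (u * T) = 1 := by rw [left_inv_eq_right_inv l r, r]
  exact ⟨(u * T).ofConv, LinearMap.congr_fun (congrArg ofConv l),
    LinearMap.congr_fun (congrArg ofConv r')⟩

end twist_antipode

/-! ### Naturality and normalisation of the twist -/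

section ad

variable {A X Y X' Y' Z : Type*} [Ring A] [Bialgebra ℂ A]
  [AddCommGroup X] [Module ℂ X] [AddCommGroup Y] [Module ℂ Y]
  [AddCommGroup X'] [Module ℂ X'] [AddCommGroup Y'] [Module ℂ Y'] [AddCommGroup Z] [Module ℂ Z]
  {BX : Bicomodule A X} {BY : Bicomodule A Y} {BX' : Bicomodule A X'} {BY' : Bicomodule A Y'}

/-- The form of naturality used below: a pair of bicovariant maps commutes with twisting. Every
comparison of a deformed identity with its original passes through it. -/
lemma ad_map {F : X →ₗ[ℂ] X'} {G : Y →ₗ[ℂ] Y'} (hF : IsHom BX BX' .id F) (hG : IsHom BY BY' .id G)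
    (u : (WithConv (A ⊗[ℂ] A →ₗ[ℂ] ℂ))ˣ) (t : X ⊗[ℂ] Y) :
    (BX'.tensor BY').ad u (TensorProduct.map F G t) =
      TensorProduct.map F G ((BX.tensor BY).ad u t) := by
  have h := hF.tensor hG
  rw [TensorProduct.map_id] at h
  exact IsHom.ad (φ := CoalgHom.id ℂ (A ⊗[ℂ] A)) h u t

lemma ad_inv_ad {C : Type*} [AddCommGroup C] [Module ℂ C] [Coalgebra ℂ C] (B : Bicomodule C X)
    (u : (WithConv (C →ₗ[ℂ] ℂ))ˣ) (x : X) : B.ad u⁻¹ (B.ad u x) = x := by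
  rw [ad_ad, mul_inv_cancel, ad_one]

lemma ad_ad_inv {C : Type*} [AddCommGroup C] [Module ℂ C] [Coalgebra ℂ C] (B : Bicomodule C X)
    (u : (WithConv (C →ₗ[ℂ] ℂ))ˣ) (x : X) : B.ad u (B.ad u⁻¹ x) = x := by
  rw [ad_ad, inv_mul_cancel, ad_one]

/-- Unlike `deform_unit_left`, this treats the left coaction alone. A left-invariant argument
removes γ and a right-invariant one removes γ⁻¹, so ξ can be evaluated on elements invariant on one
side only. -/
lemma lop_unit_left {f : A ⊗[ℂ] A →ₗ[ℂ] ℂ} (hf : ∀ a, f (1 ⊗ₜ a) = counit (R := ℂ) a) {x : X}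
    (hx : BX.lco x = 1 ⊗ₜ x) (y : Y) : (BX.tensor BY).lop f (x ⊗ₜ y) = x ⊗ₜ y := by
  have e : (TensorProduct.lid ℂ _).toLinearMap ∘ₗ f.rTensor (X ⊗[ℂ] Y) ∘ₗ
      (TensorProduct.tensorTensorTensorComm ℂ A X A Y).toLinearMap ∘ₗ
      TensorProduct.mk ℂ _ _ (1 ⊗ₜ x) = TensorProduct.mk ℂ X Y x ∘ₗ
      (TensorProduct.lid ℂ Y).toLinearMap ∘ₗ (counit (R := ℂ) (A := A)).rTensor Y := by
    ext; simp [hf]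
  have h := LinearMap.congr_fun e (BY.lco y)
  simp only [LinearMap.comp_apply, LinearEquiv.coe_coe, BY.lco_counit] at h
  change TensorProduct.lid ℂ _ (f.rTensor _ (TensorProduct.tensorTensorTensorComm ℂ A X A Y
    (BX.lco x ⊗ₜ BY.lco y))) = _
  rw [hx]
  exact h

lemma lop_unit_right {f : A ⊗[ℂ] A →ₗ[ℂ] ℂ} (hf : ∀ a, f (a ⊗ₜ 1) = counit (R := ℂ) a) {y : Y}
    (hy : BY.lco y = 1 ⊗ₜ y) (x : X) : (BX.tensor BY).lop f (x ⊗ₜ y) = x ⊗ₜ y := by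
  have e : (TensorProduct.lid ℂ _).toLinearMap ∘ₗ f.rTensor (X ⊗[ℂ] Y) ∘ₗ
      (TensorProduct.tensorTensorTensorComm ℂ A X A Y).toLinearMap ∘ₗ
      (TensorProduct.mk ℂ _ _).flip (1 ⊗ₜ y) = (TensorProduct.mk ℂ X Y).flip y ∘ₗ
      (TensorProduct.lid ℂ X).toLinearMap ∘ₗ (counit (R := ℂ) (A := A)).rTensor X := by
    ext; simp [hf, TensorProduct.smul_tmul']
  have h := LinearMap.congr_fun e (BX.lco x)
  simp only [LinearMap.comp_apply, LinearEquiv.coe_coe, BX.lco_counit] at h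
  change TensorProduct.lid ℂ _ (f.rTensor _ (TensorProduct.tensorTensorTensorComm ℂ A X A Y
    (BX.lco x ⊗ₜ BY.lco y))) = _
  rw [hy]
  exact h

lemma rop_unit_left {f : A ⊗[ℂ] A →ₗ[ℂ] ℂ} (hf : ∀ a, f (1 ⊗ₜ a) = counit (R := ℂ) a) {x : X}
    (hx : BX.rco x = x ⊗ₜ 1) (y : Y) : (BX.tensor BY).rop f (x ⊗ₜ y) = x ⊗ₜ y := by
  have e : (TensorProduct.rid ℂ _).toLinearMap ∘ₗ f.lTensor (X ⊗[ℂ] Y) ∘ₗ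
      (TensorProduct.tensorTensorTensorComm ℂ X A Y A).toLinearMap ∘ₗ
      TensorProduct.mk ℂ _ _ (x ⊗ₜ 1) = TensorProduct.mk ℂ X Y x ∘ₗ
      (TensorProduct.rid ℂ Y).toLinearMap ∘ₗ (counit (R := ℂ) (A := A)).lTensor Y := by
    ext; simp [hf]
  have h := LinearMap.congr_fun e (BY.rco y)
  simp only [LinearMap.comp_apply, LinearEquiv.coe_coe, BY.rco_counit] at h
  change TensorProduct.rid ℂ _ (f.lTensor _ (TensorProduct.tensorTensorTensorComm ℂ X A Y A
    (BX.rco x ⊗ₜ BY.rco y))) = _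
  rw [hx]
  exact h

lemma rop_unit_right {f : A ⊗[ℂ] A →ₗ[ℂ] ℂ} (hf : ∀ a, f (a ⊗ₜ 1) = counit (R := ℂ) a) {y : Y}
    (hy : BY.rco y = y ⊗ₜ 1) (x : X) : (BX.tensor BY).rop f (x ⊗ₜ y) = x ⊗ₜ y := by
  have e : (TensorProduct.rid ℂ _).toLinearMap ∘ₗ f.lTensor (X ⊗[ℂ] Y) ∘ₗ
      (TensorProduct.tensorTensorTensorComm ℂ X A Y A).toLinearMap ∘ₗ
      (TensorProduct.mk ℂ _ _).flip (y ⊗ₜ 1) = (TensorProduct.mk ℂ X Y).flip y ∘ₗ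
      (TensorProduct.rid ℂ X).toLinearMap ∘ₗ (counit (R := ℂ) (A := A)).lTensor X := by
    ext; simp [hf, TensorProduct.smul_tmul']
  have h := LinearMap.congr_fun e (BX.rco x)
  simp only [LinearMap.comp_apply, LinearEquiv.coe_coe, BX.rco_counit] at h
  change TensorProduct.rid ℂ _ (f.lTensor _ (TensorProduct.tensorTensorTensorComm ℂ X A Y A
    (BX.rco x ⊗ₜ BY.rco y))) = _
  rw [hy]
  exact h

end ad

/-! ### Compatibility of ξ with the bimodule and bicomodule structures -/

section xi

variable {A E : Type*} [Ring A] [Bialgebra ℂ A] [AddCommGroup E] [Module ℂ E]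
  (B : BicovariantBimodule A E) (𝓒 : DualTwoCocycle A)

lemma ξ_mk (t : E ⊗[ℂ] E) : Bal.ξ B B 𝓒 (Bal.mk (B.twist 𝓒).toBimodule (B.twist 𝓒).toBimodule t) =
    Bal.mk B.toBimodule B.toBimodule ((B.toBicomodule.tensor B.toBicomodule).ad 𝓒.Ω t) :=
  descend_apply ..

variable {B} in
lemma two_tmul_ext {W Z : Type*} [AddCommGroup W] [Module ℂ W] [AddCommGroup Z] [Module ℂ Z]
    {F G : Two B ⊗[ℂ] W →ₗ[ℂ] Z}
    (h : ∀ x y w, F (tmulA B x y ⊗ₜ w) = G (tmulA B x y ⊗ₜ w)) : F = G := by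
  have e : F ∘ₗ (Bal.mk B.toBimodule B.toBimodule).rTensor W =
      G ∘ₗ (Bal.mk B.toBimodule B.toBimodule).rTensor W := TensorProduct.ext_threefold h
  have hs := LinearMap.rTensor_surjective W (Bal.mk_surjective B.toBimodule B.toBimodule)
  exact LinearMap.ext (hs.forall.2 (LinearMap.congr_fun e))

variable {B} in
lemma tmul_two_ext {W Z : Type*} [AddCommGroup W] [Module ℂ W] [AddCommGroup Z] [Module ℂ Z]
    {F G : W ⊗[ℂ] Two B →ₗ[ℂ] Z}
    (h : ∀ w x y, F (w ⊗ₜ tmulA B x y) = G (w ⊗ₜ tmulA B x y)) : F = G := by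
  have e : F ∘ₗ (TensorProduct.comm ℂ _ _).toLinearMap =
      G ∘ₗ (TensorProduct.comm ℂ _ _).toLinearMap := two_tmul_ext fun x y w ↦ h w x y
  exact LinearMap.ext ((TensorProduct.comm ℂ _ _).surjective.forall.2 (LinearMap.congr_fun e))

lemma twist_lact (a : Twist 𝓒) (x : E) : (B.twist 𝓒).lact (a ⊗ₜ x) =
    𝓒.deform (self A) B.toBicomodule B.lact (Twist.equiv 𝓒 a ⊗ₜ x) := rfl

lemma twist_ract (x : E) (a : Twist 𝓒) : (B.twist 𝓒).ract (x ⊗ₜ a) =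
    𝓒.deform B.toBicomodule (self A) B.ract (x ⊗ₜ Twist.equiv 𝓒 a) := rfl

lemma twist_isHom : IsHom (B.twist 𝓒).toBicomodule B.toBicomodule
    (Twist.equiv 𝓒).toLinearMap .id :=
  ⟨fun x ↦ (LinearMap.congr_fun (TensorProduct.map_id (R := ℂ) (M := A) (N := E)) (B.lco x)).symm,
    fun x ↦ (LinearMap.congr_fun (TensorProduct.map_id (R := ℂ) (M := E) (N := A)) (B.rco x)).symm⟩

lemma Twist.equiv_mul' : (Twist.equiv 𝓒).toLinearMap ∘ₗ LinearMap.mul' ℂ (Twist 𝓒) =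
    𝓒.mulΩ ∘ₗ TensorProduct.map (Twist.equiv 𝓒).toLinearMap (Twist.equiv 𝓒).toLinearMap :=
  TensorProduct.ext' fun _ _ ↦ rfl

/-- The composite of ξ with the deformed projection is `deform` of the original projection, and
`deform_isHom` makes that colinear over the deformed product. This is the product entering the
codiagonal coactions of E_Ω ⊗ E_Ω. -/
lemma ξ_isHom : IsHom (Bal.bicomodule (B.twist 𝓒) (B.twist 𝓒)) (Bal.bicomodule B B)
    (Twist.equiv 𝓒).toLinearMap (Bal.ξ B B 𝓒).toLinearMap := by
  have h := 𝓒.deform_isHom (Bal.mk_isHom B B)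
  have h' := Bal.mk_isHom (B.twist 𝓒) (B.twist 𝓒)
  have h₂ := (twist_isHom B 𝓒).tensor (twist_isHom B 𝓒)
  rw [TensorProduct.map_id] at h₂
  have e : (Bal.ξ B B 𝓒).toLinearMap ∘ₗ Bal.mk (B.twist 𝓒).toBimodule (B.twist 𝓒).toBimodule =
      𝓒.deform B.toBicomodule B.toBicomodule (Bal.mk B.toBimodule B.toBimodule) :=
    LinearMap.ext (ξ_mk B 𝓒)
  have e' := LinearMap.congr_fun e
  simp only [LinearMap.comp_apply, LinearEquiv.coe_coe] at e'
  constructor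
  · refine Bal.ind fun t ↦ ?_
    rw [h'.1, TensorProduct.map_map, e, Twist.equiv_mul', LinearEquiv.coe_coe, e' t, h.1]
    have := h₂.1 t
    rw [LinearMap.id_apply] at this
    rw [this, TensorProduct.map_map, LinearMap.comp_id]
  · refine Bal.ind fun t ↦ ?_
    rw [h'.2, TensorProduct.map_map, e, Twist.equiv_mul', LinearEquiv.coe_coe, e' t, h.2]
    have := h₂.2 t
    rw [LinearMap.id_apply] at this
    rw [this, TensorProduct.map_map, LinearMap.comp_id]

lemma ξ_tmulA (x y : E) : Bal.ξ B B 𝓒 (tmulA (B.twist 𝓒) x y) =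
    𝓒.deform B.toBicomodule B.toBicomodule (Bal.mk B.toBimodule B.toBimodule) (x ⊗ₜ y) :=
  ξ_mk B 𝓒 _

/-- The case (x ⊗ y) a = x ⊗ (y a) of `deform_assoc`: ξ carries the right action on the deformed
tensor square to the deformation of the original right action. `ξ_lmul` is the same on the left. -/
lemma ξ_rmul (q : Two (B.twist 𝓒)) (a : Twist 𝓒) : Bal.ξ B B 𝓒 (rmul (B.twist 𝓒) q a) =
    𝓒.deform (Bal.bicomodule B B) (self A) (Bal.bimodule B.toBimodule B.toBimodule).ract
      (Bal.ξ B B 𝓒 q ⊗ₜ Twist.equiv 𝓒 a) := by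
  have e : (Bal.ξ B B 𝓒).toLinearMap ∘ₗ
      (Bal.bimodule (B.twist 𝓒).toBimodule (B.twist 𝓒).toBimodule).ract =
      𝓒.deform (Bal.bicomodule B B) (self A) (Bal.bimodule B.toBimodule B.toBimodule).ract ∘ₗ
        TensorProduct.map (Bal.ξ B B 𝓒).toLinearMap (Twist.equiv 𝓒).toLinearMap := by
    refine two_tmul_ext fun x y a ↦ ?_
    have h := 𝓒.deform_assoc (BZ := self A) (Bal.mk_isHom B B) B.ract_isHom
      (ν := (Bal.bimodule B.toBimodule B.toBimodule).ract)
      (ν' := Bal.mk B.toBimodule B.toBimodule) (fun x y z ↦ rmul_tmulA B x y z) x y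
      (Twist.equiv 𝓒 a)
    simp only [LinearMap.comp_apply, LinearEquiv.coe_coe, TensorProduct.map_tmul]
    rw [ξ_tmulA, h, ← twist_ract, ← ξ_tmulA]
    exact congrArg _ (rmul_tmulA (B.twist 𝓒) x y a)
  exact LinearMap.congr_fun e (q ⊗ₜ a)

lemma ξ_lmul (a : Twist 𝓒) (q : Two (B.twist 𝓒)) : Bal.ξ B B 𝓒 (lmul (B.twist 𝓒) a q) =
    𝓒.deform (self A) (Bal.bicomodule B B) (Bal.bimodule B.toBimodule B.toBimodule).lact
      (Twist.equiv 𝓒 a ⊗ₜ Bal.ξ B B 𝓒 q) := by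
  have e : (Bal.ξ B B 𝓒).toLinearMap ∘ₗ
      (Bal.bimodule (B.twist 𝓒).toBimodule (B.twist 𝓒).toBimodule).lact =
      𝓒.deform (self A) (Bal.bicomodule B B) (Bal.bimodule B.toBimodule B.toBimodule).lact ∘ₗ
        TensorProduct.map (Twist.equiv 𝓒).toLinearMap (Bal.ξ B B 𝓒).toLinearMap := by
    refine tmul_two_ext fun a x y ↦ ?_
    have h := 𝓒.deform_assoc (BX := self A) B.lact_isHom (Bal.mk_isHom B B)
      (ν := Bal.mk B.toBimodule B.toBimodule)
      (ν' := (Bal.bimodule B.toBimodule B.toBimodule).lact)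
      (fun x y z ↦ (lmul_tmulA B x y z).symm) (Twist.equiv 𝓒 a) x y
    simp only [LinearMap.comp_apply, LinearEquiv.coe_coe, TensorProduct.map_tmul]
    rw [ξ_tmulA, ← h, ← twist_lact, ← ξ_tmulA]
    exact congrArg _ (lmul_tmulA (B.twist 𝓒) a x y)
  exact LinearMap.congr_fun e (a ⊗ₜ q)

end xi

/-! ### The deformed braiding -/

section braiding

variable {A E : Type*} [Ring A] [HopfAlgebra ℂ A] [AddCommGroup E] [Module ℂ E]
  (B : BicovariantBimodule A E) (𝓒 : DualTwoCocycle A)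

/-- Left invariance of x turns the first factor into γ(1 ⊗ y₍₋₁₎) and right invariance of y turns
the last into γ⁻¹(x₍₁₎ ⊗ 1). Both are counits by normalisation. Together with `ξ_right_left` this
transfers the swap rule to σ_Ω. -/
lemma ξ_left_right {x y : E} (hx : x ∈ leftInv B.toBicomodule) (hy : y ∈ rightInv B.toBicomodule) :
    Bal.ξ B B 𝓒 (tmulA (B.twist 𝓒) x y) = tmulA B x y := by
  refine (ξ_mk B 𝓒 _).trans (congrArg _ ?_)
  have h₁ := rop_unit_right (BX := B.toBicomodule) 𝓒.γinv_tmul_one hy x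
  have h₂ := lop_unit_left (BY := B.toBicomodule) 𝓒.γ_one_tmul hx y
  exact (congrArg _ h₁).trans h₂

lemma ξ_right_left {x y : E} (hx : x ∈ rightInv B.toBicomodule) (hy : y ∈ leftInv B.toBicomodule) :
    Bal.ξ B B 𝓒 (tmulA (B.twist 𝓒) x y) = tmulA B x y := by
  refine (ξ_mk B 𝓒 _).trans (congrArg _ ?_)
  have h₁ := rop_unit_left (BY := B.toBicomodule) 𝓒.γinv_one_tmul hx y
  have h₂ := lop_unit_right (BX := B.toBicomodule) 𝓒.γ_tmul_one hy x
  exact (congrArg _ h₁).trans h₂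

lemma isAntipode_antipode (A : Type*) [Ring A] [HopfAlgebra ℂ A] :
    IsAntipode (HopfAlgebra.antipode ℂ (A := A)) :=
  ⟨HopfAlgebra.mul_antipode_rTensor_comul_apply, HopfAlgebra.mul_antipode_lTensor_comul_apply⟩

variable {B} {σ : Two B →ₗ[ℂ] Two B}

/-- Transported along ξ, bilinearity of σ_Ω says that σ respects the deformed actions. It does,
because σ is bilinear and, being colinear, commutes with the twist. -/
lemma IsBraiding.twist (h : IsBraiding B σ) : IsBraiding (B.twist 𝓒) (σΩ B σ 𝓒) := by
  have hσ := isHom_braiding (isAntipode_antipode A) B h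
  constructor
  · intro a q
    apply (Bal.ξ B B 𝓒).injective
    rw [ξ_lmul]
    simp only [σΩ, LinearMap.comp_apply, LinearEquiv.coe_coe, LinearEquiv.apply_symm_apply]
    rw [ξ_lmul]
    have e : σ ∘ₗ (Bal.bimodule B.toBimodule B.toBimodule).lact =
        (Bal.bimodule B.toBimodule B.toBimodule).lact ∘ₗ TensorProduct.map .id σ :=
      TensorProduct.ext' h.lmul
    have h := ad_map (IsHom.id (self A)) hσ 𝓒.Ω (Twist.equiv 𝓒 a ⊗ₜ Bal.ξ B B 𝓒 q)
    refine (LinearMap.congr_fun e _).trans ?_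
    exact congrArg (Bal.bimodule B.toBimodule B.toBimodule).lact h.symm
  · intro q a
    apply (Bal.ξ B B 𝓒).injective
    rw [ξ_rmul]
    simp only [σΩ, LinearMap.comp_apply, LinearEquiv.coe_coe, LinearEquiv.apply_symm_apply]
    rw [ξ_rmul]
    have e : σ ∘ₗ (Bal.bimodule B.toBimodule B.toBimodule).ract =
        (Bal.bimodule B.toBimodule B.toBimodule).ract ∘ₗ TensorProduct.map σ .id :=
      TensorProduct.ext' h.rmul
    have h := ad_map hσ (IsHom.id (self A)) 𝓒.Ω (Bal.ξ B B 𝓒 q ⊗ₜ Twist.equiv 𝓒 a)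
    refine (LinearMap.congr_fun e _).trans ?_
    exact congrArg (Bal.bimodule B.toBimodule B.toBimodule).ract h.symm
  · intro x hx y hy
    apply (Bal.ξ B B 𝓒).injective
    simp only [σΩ, LinearMap.comp_apply, LinearEquiv.coe_coe, LinearEquiv.apply_symm_apply]
    rw [ξ_left_right B 𝓒 hx hy, ξ_right_left B 𝓒 hy hx]
    exact h.swap x hx y hy

end braiding

/-! ### The deformed calculus -/

section calculus

lemma isHom_comp {C D C' X Y Z : Type*} [AddCommGroup C] [Module ℂ C] [Coalgebra ℂ C]
    [AddCommGroup D] [Module ℂ D] [Coalgebra ℂ D] [AddCommGroup C'] [Module ℂ C']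
    [Coalgebra ℂ C'] [AddCommGroup X] [Module ℂ X] [AddCommGroup Y] [Module ℂ Y]
    [AddCommGroup Z] [Module ℂ Z] {BX : Bicomodule C X} {BY : Bicomodule D Y}
    {BZ : Bicomodule C' Z} {φ : C →ₗ[ℂ] D} {ψ : D →ₗ[ℂ] C'} {F : X →ₗ[ℂ] Y} {G : Y →ₗ[ℂ] Z}
    (hG : IsHom BY BZ ψ G) (hF : IsHom BX BY φ F) : IsHom BX BZ (ψ ∘ₗ φ) (G ∘ₗ F) :=
  ⟨fun x ↦ by rw [LinearMap.comp_apply, hG.1, hF.1, TensorProduct.map_map],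
    fun x ↦ by rw [LinearMap.comp_apply, hG.2, hF.2, TensorProduct.map_map]⟩

variable {A E : Type*} [Ring A] [Bialgebra ℂ A] [AddCommGroup E] [Module ℂ E]
  {S : Bimodule A E} {d : A →ₗ[ℂ] E}

lemma IsBicovariantCalculus.isHom_d (h : IsBicovariantCalculus S d) :
    IsHom (self A) h.bicov.toBicomodule .id d := by
  have hd (b : A) : formMap S d (1 ⊗ₜ b) = d b := by simp [formMap, S.one_lact]
  have e₁ : TensorProduct.map (LinearMap.mul' ℂ A) (formMap S d) ∘ₗ
      (TensorProduct.tensorTensorTensorComm ℂ A A A A).toLinearMap ∘ₗ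
        TensorProduct.mk ℂ _ _ (1 ⊗ₜ 1) = TensorProduct.map .id d := by
    ext; simp [hd]
  have e₂ : TensorProduct.map (formMap S d) (LinearMap.mul' ℂ A) ∘ₗ
      (TensorProduct.tensorTensorTensorComm ℂ A A A A).toLinearMap ∘ₗ
        TensorProduct.mk ℂ _ _ (1 ⊗ₜ 1) = TensorProduct.map d .id := by
    ext; simp [hd]
  have h1 : comul (R := ℂ) (1 : A) = 1 ⊗ₜ 1 := Bialgebra.comul_one
  constructor
  · intro b
    have := h.bicomodule_lco 1 b
    rw [hd, h1] at this
    exact this.trans (LinearMap.congr_fun e₁ (comul b))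
  · intro b
    have := h.bicomodule_rco 1 b
    rw [hd, h1] at this
    exact this.trans (LinearMap.congr_fun e₂ (comul b))

lemma isHom_formMap {B : BicovariantBimodule A E} (hd : IsHom (self A) B.toBicomodule .id d) :
    IsHom ((self A).tensor (self A)) B.toBicomodule (LinearMap.mul' ℂ A)
      (formMap B.toBimodule d) := by
  have h := isHom_comp B.lact_isHom ((IsHom.id (self A)).tensor hd)
  rw [TensorProduct.map_id, LinearMap.comp_id] at h
  exact h

/-- If d is colinear, so is a ⊗ b ↦ a db. The two sums in the definition of bicovariance are then
the coactions of ∑ aₖ dbₖ, and they vanish with it. -/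
lemma isBicovariantCalculus_of_isHom {B : BicovariantBimodule A E}
    (hd : IsHom (self A) B.toBicomodule .id d) (hc : IsCalculus B.toBimodule d) :
    IsBicovariantCalculus B.toBimodule d := by
  have hf := isHom_formMap hd
  refine ⟨hc, fun n a b hab ↦ ?_, fun n a b hab ↦ ?_⟩
  · have h0 : formMap B.toBimodule d (∑ k, a k ⊗ₜ b k) = 0 := by simpa [formMap] using hab
    have h1 := hf.1 (∑ k, a k ⊗ₜ b k)
    rw [h0, map_zero] at h1
    simp only [← IsBicovariantCalculus.lTensor_codiag, ← map_sum, Bal.codiag_lco]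
    rw [LinearMap.lTensor, LinearMap.rTensor, TensorProduct.map_map, LinearMap.comp_id,
      LinearMap.id_comp, ← h1]
  · have h0 : formMap B.toBimodule d (∑ k, a k ⊗ₜ b k) = 0 := by simpa [formMap] using hab
    have h1 := hf.2 (∑ k, a k ⊗ₜ b k)
    rw [h0, map_zero] at h1
    simp only [← IsBicovariantCalculus.rTensor_codiag, ← map_sum, Bal.codiag_rco]
    rw [LinearMap.lTensor, LinearMap.rTensor, TensorProduct.map_map, LinearMap.comp_id,
      LinearMap.id_comp, ← h1]

/-- The elements a db exhaust E, so coactions that are compatible with the left action and with d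
are determined. Hence the coactions of the deformed calculus are those of E. -/
lemma IsBicovariantCalculus.bicov_eq {B : BicovariantBimodule A E}
    (hd : IsHom (self A) B.toBicomodule .id d) (h : IsBicovariantCalculus B.toBimodule d) :
    h.bicov = B := by
  have hf := isHom_formMap hd
  have e₁ : h.bicov.lco ∘ₗ formMap B.toBimodule d = B.lco ∘ₗ formMap B.toBimodule d :=
    TensorProduct.ext' fun a b ↦ (h.bicomodule_lco a b).trans (hf.1 (a ⊗ₜ b)).symm
  have e₂ : h.bicov.rco ∘ₗ formMap B.toBimodule d = B.rco ∘ₗ formMap B.toBimodule d :=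
    TensorProduct.ext' fun a b ↦ (h.bicomodule_rco a b).trans (hf.2 (a ⊗ₜ b)).symm
  have hs := h.formMap_surjective
  refine BicovariantBimodule.ext rfl rfl (LinearMap.ext ?_) (LinearMap.ext ?_)
  · exact hs.forall.2 (LinearMap.congr_fun e₁)
  · exact hs.forall.2 (LinearMap.congr_fun e₂)

variable (𝓒 : DualTwoCocycle A) {B : BicovariantBimodule A E}

lemma isHom_dΩ (hd : IsHom (self A) B.toBicomodule .id d) :
    IsHom (self (Twist 𝓒)) (B.twist 𝓒).toBicomodule .id (dΩ d 𝓒) := hd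

/-- Since d commutes with the twist, a * db is the original a db map applied to the twisted tensor a
⊗ b. -/
lemma twist_formMap (hd : IsHom (self A) B.toBicomodule .id d) (x : Twist 𝓒 ⊗[ℂ] Twist 𝓒) :
    formMap (B.twist 𝓒).toBimodule (dΩ d 𝓒) x = formMap B.toBimodule d
      (((self A).tensor (self A)).ad 𝓒.Ω
        (TensorProduct.map (Twist.equiv 𝓒).toLinearMap (Twist.equiv 𝓒).toLinearMap x)) := by
  induction x using TensorProduct.induction_on with
  | zero => simp
  | add u v hu hv => simp only [map_add, hu, hv]
  | tmul a b =>
    have h := ad_map (IsHom.id (self A)) hd 𝓒.Ω (Twist.equiv 𝓒 a ⊗ₜ Twist.equiv 𝓒 b)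
    rw [TensorProduct.map_tmul] at h ⊢
    exact congrArg B.lact h

lemma IsCalculus.twist (hd : IsHom (self A) B.toBicomodule .id d)
    (h : IsCalculus B.toBimodule d) (hs : Function.Surjective (formMap B.toBimodule d)) :
    IsCalculus (B.twist 𝓒).toBimodule (dΩ d 𝓒) := by
  constructor
  · intro a b
    have h₁ := ad_map (IsHom.id (self A)) hd 𝓒.Ω (Twist.equiv 𝓒 a ⊗ₜ Twist.equiv 𝓒 b)
    have h₂ := ad_map hd (IsHom.id (self A)) 𝓒.Ω (Twist.equiv 𝓒 a ⊗ₜ Twist.equiv 𝓒 b)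
    have e : d ∘ₗ LinearMap.mul' ℂ A =
        B.ract ∘ₗ TensorProduct.map d .id + B.lact ∘ₗ TensorProduct.map .id d :=
      TensorProduct.ext' h.leibniz
    refine (LinearMap.congr_fun e (((self A).tensor (self A)).ad 𝓒.Ω
      (Twist.equiv 𝓒 a ⊗ₜ Twist.equiv 𝓒 b))).trans ?_
    simp only [LinearMap.add_apply, LinearMap.comp_apply]
    rw [← h₁, ← h₂]
    rfl
  · intro ρ
    obtain ⟨t, rfl⟩ := hs ρ
    -- Untwisting the preimage t with Ω⁻¹ before decomposing it compensates for the twist in the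
    -- deformed form map.
    obtain ⟨n, a, b, hx⟩ := exists_fin_sum (A := Twist 𝓒)
      (TensorProduct.map (Twist.equiv 𝓒).symm.toLinearMap (Twist.equiv 𝓒).symm.toLinearMap
        (((self A).tensor (self A)).ad 𝓒.Ω⁻¹ t))
    refine ⟨n, a, b, ?_⟩
    have k := twist_formMap 𝓒 hd (∑ k, a k ⊗ₜ b k)
    conv_rhs at k => rw [← hx, TensorProduct.map_map, LinearEquiv.comp_symm,
      TensorProduct.map_id, LinearMap.id_apply, ad_ad_inv]
    rw [← k]
    simp [formMap]

end calculus

/-! ### Reduction of nondegeneracy to right-invariant elements -/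

section pairing

variable {H E : Type*} [Ring H] [Bialgebra ℂ H] [AddCommGroup E] [Module ℂ E]
  {S : H →ₗ[ℂ] H} (hS : IsAntipode S) (B : BicovariantBimodule H E)
  {G : E ⊗[ℂ] E →ₗ[ℂ] H}
  (hG : IsHom (B.toBicomodule.tensor B.toBicomodule) (self H) (LinearMap.mul' ℂ H) G)

include hS hG in
/-- The left kernel of an invariant pairing is a right subcomodule. -/
lemma rop_mem_ker {ρ : E} (hρ : ρ ∈ LinearMap.ker (TensorProduct.curry G)) (f : H →ₗ[ℂ] ℂ) :
    B.rop f ρ ∈ LinearMap.ker (TensorProduct.curry G) := by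
  have hρ' (ν : E) : G (ρ ⊗ₜ ν) = 0 := LinearMap.congr_fun (LinearMap.mem_ker.1 hρ) ν
  let κ : E ⊗[ℂ] (E ⊗[ℂ] H) →ₗ[ℂ] H ⊗[ℂ] H :=
    (G ∘ₗ (TensorProduct.comm ℂ E E).toLinearMap).rTensor H ∘ₗ
      (TensorProduct.assoc ℂ E E H).symm.toLinearMap
  let act : (H ⊗[ℂ] H) ⊗[ℂ] H →ₗ[ℂ] H ⊗[ℂ] H :=
    (LinearMap.mul' ℂ H).lTensor H ∘ₗ (TensorProduct.assoc ℂ H H H).toLinearMap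
  have hκ (ν x : E) (a : H) : κ (ν ⊗ₜ (x ⊗ₜ a)) = G (x ⊗ₜ ν) ⊗ₜ a := by simp [κ]
  have e (t s : E ⊗[ℂ] H) : act (TensorProduct.map (κ ∘ₗ (TensorProduct.mk ℂ E _).flip t) .id s) =
      TensorProduct.map G (LinearMap.mul' ℂ H)
        (TensorProduct.tensorTensorTensorComm ℂ E H E H (t ⊗ₜ s)) := by
    induction t using TensorProduct.induction_on with
    | zero => simp
    | add u v hu hv =>
      simp only [map_add, TensorProduct.add_tmul, ← hu, ← hv, LinearMap.comp_add,
        TensorProduct.map_add_left, LinearMap.add_apply]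
    | tmul x a =>
      have : act ∘ₗ TensorProduct.map (κ ∘ₗ (TensorProduct.mk ℂ E _).flip (x ⊗ₜ a)) .id =
          TensorProduct.map G (LinearMap.mul' ℂ H) ∘ₗ
            (TensorProduct.tensorTensorTensorComm ℂ E H E H).toLinearMap ∘ₗ
            TensorProduct.mk ℂ _ _ (x ⊗ₜ a) := by
        ext; simp [hκ, act]
      exact LinearMap.congr_fun this s
  -- Right colinearity of G gives G(ρ₍₀₎ ⊗ ν₍₀₎) ⊗ ρ₍₁₎ ν₍₁₎ = 0 for all ν. The antipode removes
  -- ν₍₁₎ and leaves G(ρ₍₀₎ ⊗ ν) ⊗ ρ₍₁₎ = 0.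
  have hY : rconv B.toBicomodule act .id (κ ∘ₗ (TensorProduct.mk ℂ E _).flip (B.rco ρ)) = 0 := by
    ext1 ν
    refine (e (B.rco ρ) (B.rco ν)).trans ((hG.2 (ρ ⊗ₜ ν)).symm.trans ?_)
    rw [hρ', map_zero]
    rfl
  have hY0 := (rconv_antipode hS B.toBicomodule
    (fun z ↦ by
      have : act ∘ₗ (TensorProduct.mk ℂ _ H).flip 1 = .id := by ext; simp [act]
      exact LinearMap.congr_fun this z)
    (fun z a b ↦ by
      have : act ∘ₗ (TensorProduct.mk ℂ _ H).flip (a * b) =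
          act ∘ₗ (TensorProduct.mk ℂ _ H).flip b ∘ₗ act ∘ₗ (TensorProduct.mk ℂ _ H).flip a := by
        ext; simp [act, mul_assoc]
      exact LinearMap.congr_fun this z)).1 hY
  have hY1 : κ ∘ₗ (TensorProduct.mk ℂ E _).flip (B.rco ρ) = 0 := by
    rw [← hY0]
    ext x
    simp [rconv]
  refine LinearMap.mem_ker.2 (LinearMap.ext fun ν ↦ ?_)
  have k : G ∘ₗ (TensorProduct.mk ℂ E E).flip ν ∘ₗ (TensorProduct.rid ℂ E).toLinearMap ∘ₗ
      f.lTensor E =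
      (TensorProduct.rid ℂ H).toLinearMap ∘ₗ f.lTensor H ∘ₗ κ ∘ₗ TensorProduct.mk ℂ E _ ν := by
    ext; simp [hκ]
  refine (LinearMap.congr_fun k (B.rco ρ)).trans ?_
  have := LinearMap.congr_fun hY1 ν
  simp only [LinearMap.comp_apply, LinearMap.flip_apply, LinearMap.zero_apply] at this ⊢
  rw [this]
  simp

variable (hb : ∀ x a y, G (B.ract (x ⊗ₜ a) ⊗ₜ y) = G (x ⊗ₜ B.lact (a ⊗ₜ y)))

include hS hG hb in
/-- An invariant pairing is nondegenerate if it is so on the right-invariant elements. -/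
lemma nondeg_of_rightInv (h : ∀ w ∈ rightInv B.toBicomodule,
      (∀ w' ∈ rightInv B.toBicomodule, G (w ⊗ₜ w') = 0) → w = 0)
    {ρ : E} (hρ : ∀ ν, G (ρ ⊗ₜ ν) = 0) : ρ = 0 := by
  set K := LinearMap.ker (TensorProduct.curry G) with hK
  have mem (x : E) (hx : x ∈ K) (y : E) : G (x ⊗ₜ y) = 0 :=
    LinearMap.congr_fun (LinearMap.mem_ker.1 hx) y
  have hr (x : E) (hx : x ∈ K) : B.rco x ∈ LinearMap.range (K.subtype.rTensor H) :=
    mem_range_rTensor fun f ↦ rop_mem_ker hS B hG hx f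
  -- For x in the kernel K, balancedness gives G(x₍₀₎ S(x₍₁₎) ⊗ w') = G(x₍₀₎ ⊗ S(x₍₁₎) w') = 0, as
  -- x₍₀₎ stays in K. So Q kills K, and ρ = Q(ρ₍₀₎) ρ₍₁₎ vanishes as well.
  have hQ (x : E) (hx : x ∈ K) : rproj S B x = 0 := by
    refine h _ (rproj_mem hS B x) fun w' _ ↦ ?_
    obtain ⟨t, ht⟩ := hr x hx
    have e : G ∘ₗ (TensorProduct.mk ℂ E E).flip w' ∘ₗ B.ract ∘ₗ
        TensorProduct.map K.subtype S = 0 := by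
      ext k a
      simp [hb, mem _ k.2]
    change G (B.ract (TensorProduct.map .id S (B.rco x)) ⊗ₜ w') = 0
    rw [← ht, map_rTensor_apply, LinearMap.id_comp]
    exact LinearMap.congr_fun e t
  have hρK : ρ ∈ K := LinearMap.mem_ker.2 (LinearMap.ext hρ)
  obtain ⟨t, ht⟩ := hr ρ hρK
  have e : rproj S B ∘ₗ K.subtype = 0 := LinearMap.ext fun k ↦ hQ k k.2
  rw [← ract_rproj hS B ρ, ← ht, ← LinearMap.rTensor_comp_apply, e, LinearMap.rTensor_zero,
    LinearMap.zero_apply, map_zero]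

variable (hr : ∀ x y a, G (x ⊗ₜ B.ract (y ⊗ₜ a)) = G (x ⊗ₜ y) * a)

include hS hr in
-- Any y equals Q(y₍₀₎) y₍₁₎ with Q(y₍₀₎) right-invariant, and G is right linear in its second
-- argument.
lemma eq_zero_of_rightInv {x : E} (hx : ∀ w ∈ rightInv B.toBicomodule, G (x ⊗ₜ w) = 0) (y : E) :
    G (x ⊗ₜ y) = 0 := by
  have e : G ∘ₗ TensorProduct.mk ℂ E E x ∘ₗ B.ract ∘ₗ (rproj S B).rTensor H = 0 := by
    ext z a
    simp [hr, hx _ (rproj_mem hS B z)]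
  have := LinearMap.congr_fun e (B.rco y)
  simpa [ract_rproj hS] using this

end pairing

/-! ### The deformed pairing on right-invariant elements -/

section deformed

variable {A E : Type*} [Ring A] [HopfAlgebra ℂ A] [AddCommGroup E] [Module ℂ E]
  (B : BicovariantBimodule A E)
  {G : E ⊗[ℂ] E →ₗ[ℂ] A}
  (hG : IsHom (B.toBicomodule.tensor B.toBicomodule) (self A) (LinearMap.mul' ℂ A) G)
  (𝓒 : DualTwoCocycle A)

include hG in
-- Right colinearity makes the value G(w ⊗ w') right coinvariant in A; applying the counit shows
-- that it is a scalar multiple of 1, hence left coinvariant too.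
lemma comul_pairing_rightInv {w w' : E} (hw : w ∈ rightInv B.toBicomodule)
    (hw' : w' ∈ rightInv B.toBicomodule) :
    comul (R := ℂ) (G (w ⊗ₜ w')) = 1 ⊗ₜ G (w ⊗ₜ w') := by
  have h₁ : B.rco w = w ⊗ₜ 1 := hw
  have h₂ : B.rco w' = w' ⊗ₜ 1 := hw'
  have h : comul (R := ℂ) (G (w ⊗ₜ w')) = G (w ⊗ₜ w') ⊗ₜ 1 := by
    refine (hG.2 (w ⊗ₜ w')).trans ?_
    change TensorProduct.map G _ (TensorProduct.tensorTensorTensorComm ℂ E A E A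
      (B.rco w ⊗ₜ B.rco w')) = _
    rw [h₁, h₂]
    simp
  have hc := Coalgebra.rTensor_counit_comul (R := ℂ) (G (w ⊗ₜ w'))
  rw [h, LinearMap.rTensor_tmul] at hc
  have hc' := congrArg (TensorProduct.lid ℂ A) hc
  rw [TensorProduct.lid_tmul, TensorProduct.lid_tmul, one_smul] at hc'
  rw [h, ← hc', TensorProduct.smul_tmul]

include hG in
-- Left colinearity and the previous lemma give w₍₋₁₎ w'₍₋₁₎ ⊗ G(w₍₀₎ ⊗ w'₍₀₎) = 1 ⊗ G(w ⊗ w').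
-- Cancelling w₍₋₁₎ with the antipode yields w'₍₋₁₎ ⊗ G(w ⊗ w'₍₀₎) = S(w₍₋₁₎) ⊗ G(w₍₀₎ ⊗ w').
-- Inserted into γ, this produces γ(w₍₋₂₎ ⊗ S(w₍₋₁₎)), which is U on the coaction of w.
lemma pairing_lop_rightInv {w w' : E} (hw : w ∈ rightInv B.toBicomodule)
    (hw' : w' ∈ rightInv B.toBicomodule) :
    G ((B.toBicomodule.tensor B.toBicomodule).lop 𝓒.γ (w ⊗ₜ w')) =
      G (B.lop 𝓒.U.ofConv w ⊗ₜ w') := by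
  set S := HopfAlgebra.antipode ℂ (A := A)
  let κ : E ⊗[ℂ] (A ⊗[ℂ] E) →ₗ[ℂ] A ⊗[ℂ] A :=
    G.lTensor A ∘ₗ (TensorProduct.leftComm ℂ E A E).toLinearMap
  let act : A ⊗[ℂ] (A ⊗[ℂ] A) →ₗ[ℂ] A ⊗[ℂ] A :=
    (LinearMap.mul' ℂ A).rTensor A ∘ₗ (TensorProduct.assoc ℂ A A A).symm.toLinearMap
  let Λ : A ⊗[ℂ] (A ⊗[ℂ] A) →ₗ[ℂ] A := (TensorProduct.lid ℂ A).toLinearMap ∘ₗ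
    𝓒.γ.rTensor A ∘ₗ (TensorProduct.assoc ℂ A A A).symm.toLinearMap
  have hκ (x y : E) (a : A) : κ (x ⊗ₜ (a ⊗ₜ y)) = a ⊗ₜ G (x ⊗ₜ y) := by simp [κ]
  let G' : E →ₗ[ℂ] A := G ∘ₗ (TensorProduct.mk ℂ E E).flip w'
  let Y : E →ₗ[ℂ] A ⊗[ℂ] A := κ ∘ₗ (TensorProduct.mk ℂ E _).flip (B.lco w')
  let Y' : E →ₗ[ℂ] A ⊗[ℂ] A := TensorProduct.map S G' ∘ₗ B.lco
  have e₁ (t s : A ⊗[ℂ] E) : act (TensorProduct.map .id (κ ∘ₗ (TensorProduct.mk ℂ E _).flip s) t) =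
      TensorProduct.map (LinearMap.mul' ℂ A) G
        (TensorProduct.tensorTensorTensorComm ℂ A E A E (t ⊗ₜ s)) := by
    induction s using TensorProduct.induction_on with
    | zero => simp
    | add u v hu hv =>
      simp only [map_add, TensorProduct.tmul_add, ← hu, ← hv, LinearMap.comp_add,
        TensorProduct.map_add_right, LinearMap.add_apply]
    | tmul a x =>
      have : act ∘ₗ TensorProduct.map .id (κ ∘ₗ (TensorProduct.mk ℂ E _).flip (a ⊗ₜ x)) =
          TensorProduct.map (LinearMap.mul' ℂ A) G ∘ₗ
            (TensorProduct.tensorTensorTensorComm ℂ A E A E).toLinearMap ∘ₗ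
            (TensorProduct.mk ℂ _ _).flip (a ⊗ₜ x) := by
        ext; simp [hκ, act]
      exact LinearMap.congr_fun this t
  have e₂ (t s : A ⊗[ℂ] E) : G (TensorProduct.lid ℂ _ (𝓒.γ.rTensor _
        (TensorProduct.tensorTensorTensorComm ℂ A E A E (t ⊗ₜ s)))) =
      Λ (TensorProduct.map .id (κ ∘ₗ (TensorProduct.mk ℂ E _).flip s) t) := by
    induction s using TensorProduct.induction_on with
    | zero => simp
    | add u v hu hv =>
      simp only [map_add, TensorProduct.tmul_add, hu, hv, LinearMap.comp_add,
        TensorProduct.map_add_right, LinearMap.add_apply]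
    | tmul a x =>
      have : G ∘ₗ (TensorProduct.lid ℂ _).toLinearMap ∘ₗ 𝓒.γ.rTensor _ ∘ₗ
            (TensorProduct.tensorTensorTensorComm ℂ A E A E).toLinearMap ∘ₗ
            (TensorProduct.mk ℂ _ _).flip (a ⊗ₜ x) =
          Λ ∘ₗ TensorProduct.map .id (κ ∘ₗ (TensorProduct.mk ℂ E _).flip (a ⊗ₜ x)) := by
        ext; simp [hκ, Λ]
      exact LinearMap.congr_fun this t
  have hY : lconv B.toBicomodule act .id Y = comul (R := ℂ) ∘ₗ G' :=
    LinearMap.ext fun x ↦ (e₁ (B.lco x) (B.lco w')).trans (hG.1 (x ⊗ₜ w')).symm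
  have hY0 := (lconv_antipode (isAntipode_antipode A) B.toBicomodule
    (fun z ↦ by
      have : act ∘ₗ TensorProduct.mk ℂ A _ 1 = .id := by ext; simp [act]
      exact LinearMap.congr_fun this z)
    (fun a b z ↦ by
      have : act ∘ₗ TensorProduct.mk ℂ A _ (a * b) =
          act ∘ₗ TensorProduct.mk ℂ A _ a ∘ₗ act ∘ₗ TensorProduct.mk ℂ A _ b := by
        ext; simp [act, mul_assoc]
      exact LinearMap.congr_fun this z)).1 hY
  -- The cancelled form holds only on right-invariant elements. This suffices because the left
  -- coaction of w has its second leg there.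
  have hYY : Y ∘ₗ (rightInv B.toBicomodule).subtype = Y' ∘ₗ (rightInv B.toBicomodule).subtype := by
    ext1 x
    obtain ⟨t, ht⟩ := lco_rightInv B.toBicomodule x.2
    have e : act ∘ₗ TensorProduct.map S
        ((comul (R := ℂ) ∘ₗ G') ∘ₗ (rightInv B.toBicomodule).subtype) =
        TensorProduct.map S (G' ∘ₗ (rightInv B.toBicomodule).subtype) := by
      ext a v
      have := comul_pairing_rightInv B hG v.2 hw'
      simp [G', this, act]
    change Y x = TensorProduct.map S G' (B.lco x)
    rw [← hY0]
    change act (TensorProduct.map S _ (B.lco x)) = _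
    rw [← ht, map_lTensor_apply, map_lTensor_apply]
    exact LinearMap.congr_fun e t
  have e₃ : Λ ∘ₗ (TensorProduct.map S G').lTensor A ∘ₗ (TensorProduct.assoc ℂ A A E).toLinearMap =
      G' ∘ₗ (TensorProduct.lid ℂ E).toLinearMap ∘ₗ
        (𝓒.γ ∘ₗ TensorProduct.map .id S).rTensor E := by
    ext; simp [Λ]
  obtain ⟨t, ht⟩ := lco_rightInv B.toBicomodule hw
  have h₁ : TensorProduct.map .id Y (B.lco w) = TensorProduct.map .id Y' (B.lco w) := by
    rw [← ht, map_lTensor_apply, map_lTensor_apply, hYY]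
  have h₂ : TensorProduct.map .id Y' (B.lco w) = (TensorProduct.map S G').lTensor A
      (TensorProduct.assoc ℂ A A E ((comul (R := ℂ)).rTensor E (B.lco w))) := by
    rw [B.lco_coassoc, ← LinearMap.lTensor_comp_apply]
    rfl
  have hU : 𝓒.U.ofConv = (𝓒.γ ∘ₗ TensorProduct.map .id S) ∘ₗ comul :=
    LinearMap.ext fun x ↦ congrArg 𝓒.γ (pairAnti_eq x)
  refine (e₂ (B.lco w) (B.lco w')).trans ?_
  change Λ (TensorProduct.map .id Y (B.lco w)) = _
  rw [h₁, h₂]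
  refine (LinearMap.congr_fun e₃ _).trans ?_
  have hl : B.lop 𝓒.U.ofConv w = TensorProduct.lid ℂ E ((𝓒.γ ∘ₗ TensorProduct.map .id S).rTensor E
      ((comul (R := ℂ)).rTensor E (B.lco w))) := by
    rw [hU, ← LinearMap.rTensor_comp_apply]
    rfl
  rw [hl]
  rfl

lemma lop_V_lop_U {X : Type*} [AddCommGroup X] [Module ℂ X] (D : Bicomodule A X) (x : X) :
    D.lop 𝓒.V.ofConv (D.lop 𝓒.U.ofConv x) = x := by
  rw [lop_lop, 𝓒.U_mul_V, lop_one]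

end deformed

/-! ### Bi-invariance as colinearity -/

section metric

variable {H E : Type*} [Ring H] [Bialgebra ℂ H] [AddCommGroup E] [Module ℂ E]

/-- H is cofree as a comodule over itself, so a colinear map into it is recovered from its composite
with the counit. Conversely, coassociativity makes every map of the form x ↦ x₍₋₁₎ f(x₍₀₎) left
colinear, and similarly on the right. -/
lemma isHom_self_iff {X : Type*} [AddCommGroup X] [Module ℂ X] {D : Bicomodule H X}
    {g : X →ₗ[ℂ] H} : IsHom D (self H) .id g ↔
      (∀ x, TensorProduct.rid ℂ H ((counit (R := ℂ) ∘ₗ g).lTensor H (D.lco x)) = g x) ∧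
      ∀ x, TensorProduct.lid ℂ H ((counit (R := ℂ) ∘ₗ g).rTensor H (D.rco x)) = g x := by
  constructor
  · intro h
    constructor
    · intro x
      rw [LinearMap.lTensor_comp_apply]
      refine (congrArg (fun t ↦ TensorProduct.rid ℂ H (counit.lTensor H t)) (h.1 x)).symm.trans ?_
      exact (self H).rco_counit (g x)
    · intro x
      rw [LinearMap.rTensor_comp_apply]
      refine (congrArg (fun t ↦ TensorProduct.lid ℂ H (counit.rTensor H t)) (h.2 x)).symm.trans ?_
      exact (self H).lco_counit (g x)
  · rintro ⟨hl, hr⟩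
    constructor
    · intro x
      have e : g = (TensorProduct.rid ℂ H).toLinearMap ∘ₗ (counit (R := ℂ) ∘ₗ g).lTensor H ∘ₗ
          D.lco := LinearMap.ext fun x ↦ (hl x).symm
      have k := contract_right (D.lco_coassoc x) (counit (R := ℂ) ∘ₗ g)
      rw [hl] at k
      conv_rhs => rw [e]
      exact k
    · intro x
      have e : g = (TensorProduct.lid ℂ H).toLinearMap ∘ₗ (counit (R := ℂ) ∘ₗ g).rTensor H ∘ₗ
          D.rco := LinearMap.ext fun x ↦ (hr x).symm
      have k := contract_left (D.rco_coassoc x) (counit (R := ℂ) ∘ₗ g)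
      rw [hr] at k
      conv_rhs => rw [e]
      exact k

variable {B : BicovariantBimodule H E} {σ : Two B →ₗ[ℂ] Two B} {g : Two B →ₗ[ℂ] H}

lemma two_hom_ext {Z : Type*} [AddCommGroup Z] [Module ℂ Z] {F G : Two B →ₗ[ℂ] Z}
    (h : ∀ x y, F (tmulA B x y) = G (tmulA B x y)) : F = G := by
  have e : F ∘ₗ Bal.mk B.toBimodule B.toBimodule = G ∘ₗ Bal.mk B.toBimodule B.toBimodule :=
    TensorProduct.ext' h
  exact LinearMap.ext (Bal.ind (LinearMap.congr_fun e))

lemma isBiinvariantMetric_iff : IsBiinvariantMetric B σ g ↔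
    IsMetric B σ g ∧ IsHom (Bal.bicomodule B B) (self H) .id g := by
  rw [isHom_self_iff]
  constructor
  · intro h
    refine ⟨h.toIsMetric, LinearMap.congr_fun (f := (TensorProduct.rid ℂ H).toLinearMap ∘ₗ
      (counit (R := ℂ) ∘ₗ g).lTensor H ∘ₗ (Bal.bicomodule B B).lco) ?_,
      LinearMap.congr_fun (f := (TensorProduct.lid ℂ H).toLinearMap ∘ₗ
      (counit (R := ℂ) ∘ₗ g).rTensor H ∘ₗ (Bal.bicomodule B B).rco) ?_⟩
    · exact two_hom_ext h.left_inv
    · exact two_hom_ext h.right_inv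
  · rintro ⟨h, hl, hr⟩
    exact ⟨h, fun x y ↦ hl _, fun x y ↦ hr _⟩

lemma isHom_pairing (hg : IsHom (Bal.bicomodule B B) (self H) .id g) :
    IsHom (B.toBicomodule.tensor B.toBicomodule) (self H) (LinearMap.mul' ℂ H)
      (g ∘ₗ Bal.mk B.toBimodule B.toBimodule) := by
  have h := isHom_comp hg (Bal.mk_isHom B B)
  rwa [LinearMap.id_comp] at h

lemma nondeg_iff_rightInv {S : H →ₗ[ℂ] H} (hS : IsAntipode S)
    (hg : IsHom (Bal.bicomodule B B) (self H) .id g)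
    (hr : ∀ q a, g (rmul B q a) = g q * a) :
    (∀ ρ, (∀ ν, g (tmulA B ρ ν) = 0) → ρ = 0) ↔
      ∀ w ∈ rightInv B.toBicomodule,
        (∀ w' ∈ rightInv B.toBicomodule, g (tmulA B w w') = 0) → w = 0 := by
  constructor
  · intro h w hw hw'
    refine h w (eq_zero_of_rightInv hS B (G := g ∘ₗ Bal.mk B.toBimodule B.toBimodule) ?_ hw')
    intro x y a
    exact (congrArg g (rmul_tmulA B x y a)).symm.trans (hr _ a)
  · intro h ρ hρ
    exact nondeg_of_rightInv hS B (isHom_pairing hg)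
      (fun x a y ↦ congrArg g (tmulA_balance B x a y)) h hρ

end metric

/-! ### Deformation of bi-invariant metrics -/

section metric_twist

variable {A E : Type*} [Ring A] [HopfAlgebra ℂ A] [AddCommGroup E] [Module ℂ E]
  {B : BicovariantBimodule A E} (𝓒 : DualTwoCocycle A)
  {σ : Two B →ₗ[ℂ] Two B} {g : Two B →ₗ[ℂ] A}

lemma isHom_ξ_comp_iff {g : Two B →ₗ[ℂ] A} :
    IsHom (Bal.bicomodule (B.twist 𝓒) (B.twist 𝓒)) (self (Twist 𝓒)) .id (gΩ B g 𝓒) ↔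
      IsHom (Bal.bicomodule B B) (self A) .id g := by
  have hξ := ξ_isHom B 𝓒
  have e : (Twist.equiv 𝓒).toLinearMap ∘ₗ gΩ B g 𝓒 = g ∘ₗ (Bal.ξ B B 𝓒).toLinearMap :=
    LinearMap.ext fun _ ↦ rfl
  have k : IsHom (self (Twist 𝓒)) (self A) (Twist.equiv 𝓒).toLinearMap
      (Twist.equiv 𝓒).toLinearMap :=
    ⟨fun x ↦ (LinearMap.congr_fun (TensorProduct.map_id (R := ℂ) (M := A) (N := A))
      (comul (R := ℂ) (A := A) x)).symm,
      fun x ↦ (LinearMap.congr_fun (TensorProduct.map_id (R := ℂ) (M := A) (N := A))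
      (comul (R := ℂ) (A := A) x)).symm⟩
  have inj := (TensorProduct.congr (Twist.equiv 𝓒) (Twist.equiv 𝓒)).injective
  constructor
  · intro h
    have h' := isHom_comp k h
    rw [e, LinearMap.comp_id] at h'
    constructor
    · refine (Bal.ξ B B 𝓒).surjective.forall.2 fun q ↦ ?_
      refine (h'.1 q).trans ?_
      have := hξ.1 q
      rw [LinearEquiv.coe_coe] at this
      rw [this, TensorProduct.map_map, LinearMap.id_comp]
    · refine (Bal.ξ B B 𝓒).surjective.forall.2 fun q ↦ ?_
      refine (h'.2 q).trans ?_
      have := hξ.2 q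
      rw [LinearEquiv.coe_coe] at this
      rw [this, TensorProduct.map_map, LinearMap.id_comp]
  · intro h
    have h' := isHom_comp h hξ
    rw [← e, LinearMap.id_comp] at h'
    constructor
    · intro q
      apply inj
      refine (k.1 _).symm.trans ((h'.1 q).trans ?_)
      change _ = TensorProduct.map _ _ _
      rw [TensorProduct.map_map, LinearMap.comp_id]
    · intro q
      apply inj
      refine (k.2 _).symm.trans ((h'.2 q).trans ?_)
      change _ = TensorProduct.map _ _ _
      rw [TensorProduct.map_map, LinearMap.comp_id]

lemma Twist.mul_eq (x y : Twist 𝓒) : x * y = (Twist.equiv 𝓒).symm (LinearMap.mul' ℂ A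
    (((self A).tensor (self A)).ad 𝓒.Ω (Twist.equiv 𝓒 x ⊗ₜ Twist.equiv 𝓒 y))) := rfl

lemma equiv_gΩ (q : Two (B.twist 𝓒)) :
    Twist.equiv 𝓒 (gΩ B g 𝓒 q) = g (Bal.ξ B B 𝓒 q) := rfl

lemma DualTwoCocycle.deform_apply {X Y Z : Type*} [AddCommGroup X] [Module ℂ X] [AddCommGroup Y]
    [Module ℂ Y] [AddCommGroup Z] [Module ℂ Z] (BX : Bicomodule A X) (BY : Bicomodule A Y)
    (μ : X ⊗[ℂ] Y →ₗ[ℂ] Z) (t : X ⊗[ℂ] Y) :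
    𝓒.deform BX BY μ t = μ ((BX.tensor BY).ad 𝓒.Ω t) := rfl

/-- For colinear g, right linearity of g_Ω is right linearity of g precomposed with the twist of (E
⊗_A E) ⊗ A. The twist is invertible, which gives the converse. -/
lemma gΩ_rmul_iff (hg : IsHom (Bal.bicomodule B B) (self A) .id g) :
    (∀ q a, gΩ B g 𝓒 (rmul (B.twist 𝓒) q a) = gΩ B g 𝓒 q * a) ↔
      ∀ q a, g (rmul B q a) = g q * a := by
  set R := (Bal.bimodule B.toBimodule B.toBimodule).ract with hR
  have hl (q : Two (B.twist 𝓒)) (a : Twist 𝓒) : gΩ B g 𝓒 (rmul (B.twist 𝓒) q a) =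
      (Twist.equiv 𝓒).symm (g (R (((Bal.bicomodule B B).tensor (self A)).ad 𝓒.Ω
        (Bal.ξ B B 𝓒 q ⊗ₜ Twist.equiv 𝓒 a)))) := by
    apply (Twist.equiv 𝓒).injective
    rw [equiv_gΩ, ξ_rmul, LinearEquiv.apply_symm_apply, DualTwoCocycle.deform_apply]
  have hr (q : Two (B.twist 𝓒)) (a : Twist 𝓒) : gΩ B g 𝓒 q * a =
      (Twist.equiv 𝓒).symm (LinearMap.mul' ℂ A (TensorProduct.map g .id
        (((Bal.bicomodule B B).tensor (self A)).ad 𝓒.Ω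
          (Bal.ξ B B 𝓒 q ⊗ₜ Twist.equiv 𝓒 a)))) := by
    have := ad_map hg (IsHom.id (self A)) 𝓒.Ω (Bal.ξ B B 𝓒 q ⊗ₜ Twist.equiv 𝓒 a)
    rw [← this, TensorProduct.map_tmul, LinearMap.id_apply, Twist.mul_eq, equiv_gΩ]
  constructor
  · intro h
    have e : (g ∘ₗ R) ∘ₗ ((Bal.bicomodule B B).tensor (self A)).ad 𝓒.Ω =
        (LinearMap.mul' ℂ A ∘ₗ TensorProduct.map g .id) ∘ₗ
          ((Bal.bicomodule B B).tensor (self A)).ad 𝓒.Ω := by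
      refine TensorProduct.ext' fun q a ↦ ?_
      obtain ⟨q, rfl⟩ := (Bal.ξ B B 𝓒).surjective q
      obtain ⟨a, rfl⟩ := (Twist.equiv 𝓒).surjective a
      have := h q a
      rw [hl, hr] at this
      exact (Twist.equiv 𝓒).symm.injective this
    intro q a
    have := LinearMap.congr_fun e (((Bal.bicomodule B B).tensor (self A)).ad 𝓒.Ω⁻¹ (q ⊗ₜ a))
    simp only [LinearMap.comp_apply, ad_ad_inv] at this
    exact this
  · intro h q a
    have e : g ∘ₗ R = LinearMap.mul' ℂ A ∘ₗ TensorProduct.map g .id :=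
      TensorProduct.ext' h
    rw [hl, hr]
    exact congrArg (Twist.equiv 𝓒).symm (LinearMap.congr_fun e _)

/-- Right invariance of w' removes γ⁻¹ from ξ, and `pairing_lop_rightInv` converts the remaining γ
into the action of U on w. -/
lemma gΩ_rightInv (hg : IsHom (Bal.bicomodule B B) (self A) .id g) {w w' : E}
    (hw : w ∈ rightInv B.toBicomodule) (hw' : w' ∈ rightInv B.toBicomodule) :
    Twist.equiv 𝓒 (gΩ B g 𝓒 (tmulA (B.twist 𝓒) w w')) =
      g (tmulA B (B.lop 𝓒.U.ofConv w) w') := by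
  refine Eq.trans ?_ (pairing_lop_rightInv B (isHom_pairing hg) 𝓒 hw hw')
  have h₁ := rop_unit_right (BX := B.toBicomodule) 𝓒.γinv_tmul_one hw' w
  refine (congrArg g (ξ_mk B 𝓒 (w ⊗ₜ w'))).trans ?_
  exact congrArg (fun t ↦ g (Bal.mk B.toBimodule B.toBimodule
    ((B.toBicomodule.tensor B.toBicomodule).lop 𝓒.γ t))) h₁

/-- Both conditions are tested on right-invariant elements, where the two forms differ by the action
of U in the first variable. That action is injective since V undoes it. -/
lemma gΩ_nondeg_iff [FiniteDimensional ℂ (rightInv B.toBicomodule)]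
    (hg : IsHom (Bal.bicomodule B B) (self A) .id g)
    (hr : ∀ q a, g (rmul B q a) = g q * a) :
    (∀ ρ, (∀ ν, gΩ B g 𝓒 (tmulA (B.twist 𝓒) ρ ν) = 0) → ρ = 0) ↔
      ∀ ρ, (∀ ν, g (tmulA B ρ ν) = 0) → ρ = 0 := by
  obtain ⟨T, hT⟩ := Twist.exists_isAntipode 𝓒
  rw [nondeg_iff_rightInv (isAntipode_antipode A) hg hr,
    nondeg_iff_rightInv hT ((isHom_ξ_comp_iff 𝓒).2 hg) ((gΩ_rmul_iff 𝓒 hg).2 hr)]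
  let u : rightInv B.toBicomodule →ₗ[ℂ] rightInv B.toBicomodule :=
    (B.lop 𝓒.U.ofConv).restrict fun x hx ↦ lop_mem_rightInv B.toBicomodule _ hx
  have hu : Function.Injective u := by
    intro x y hxy
    have := congrArg (fun z : rightInv B.toBicomodule ↦ B.lop 𝓒.V.ofConv z) hxy
    simp only [u, LinearMap.coe_restrict_apply] at this
    rw [lop_V_lop_U, lop_V_lop_U] at this
    exact Subtype.ext this
  -- Finite dimension enters here: each right-invariant w must be of the form U·v to carry
  -- nondegeneracy back from g_Ω to g.
  have hu' := LinearMap.injective_iff_surjective.1 hu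
  have key (w w' : E) (hw : w ∈ rightInv B.toBicomodule) (hw' : w' ∈ rightInv B.toBicomodule) :
      gΩ B g 𝓒 (tmulA (B.twist 𝓒) w w') = 0 ↔ g (tmulA B (B.lop 𝓒.U.ofConv w) w') = 0 := by
    rw [← gΩ_rightInv 𝓒 hg hw hw']
    exact (LinearEquiv.map_eq_zero_iff _).symm
  constructor
  · intro h w hw hw'
    obtain ⟨v, hv⟩ := hu' ⟨w, hw⟩
    have hv' : B.lop 𝓒.U.ofConv v = w := congrArg Subtype.val hv
    have hv0 : (v : E) = 0 := h v v.2 fun x hx ↦ (key v x v.2 hx).2 (by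
      rw [hv']
      exact hw' x hx)
    rw [← hv', hv0, map_zero]
  · intro h w hw hw'
    have := h (B.lop 𝓒.U.ofConv w) (lop_mem_rightInv B.toBicomodule _ hw)
      fun x hx ↦ (key w x hw hx).1 (hw' x hx)
    rw [← lop_V_lop_U 𝓒 B.toBicomodule w, this, map_zero]

/-- Bi-invariant metrics correspond to each other under the deformation. -/
lemma isBiinvariantMetric_twist_iff [FiniteDimensional ℂ (rightInv B.toBicomodule)] :
    IsBiinvariantMetric (B.twist 𝓒) (σΩ B σ 𝓒) (gΩ B g 𝓒) ↔ IsBiinvariantMetric B σ g := by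
  rw [isBiinvariantMetric_iff, isBiinvariantMetric_iff, isHom_ξ_comp_iff]
  refine and_congr_left fun hg ↦ ?_
  have hs : gΩ B g 𝓒 ∘ₗ σΩ B σ 𝓒 = gΩ B g 𝓒 ↔ g ∘ₗ σ = g := by
    have e : gΩ B g 𝓒 ∘ₗ σΩ B σ 𝓒 = gΩ B (g ∘ₗ σ) 𝓒 := by
      refine LinearMap.ext fun q ↦ ?_
      simp [gΩ, σΩ]
    rw [e]
    constructor
    · intro h
      refine LinearMap.ext ((Bal.ξ B B 𝓒).surjective.forall.2 fun q ↦ ?_)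
      exact (Twist.equiv 𝓒).symm.injective (LinearMap.congr_fun h q)
    · intro h
      rw [h]
  constructor
  · intro h
    have hr := (gΩ_rmul_iff 𝓒 hg).1 h.rmul
    exact ⟨hr, hs.1 h.symm, (gΩ_nondeg_iff 𝓒 hg hr).1 h.nondeg⟩
  · intro h
    exact ⟨(gΩ_rmul_iff 𝓒 hg).2 h.rmul, hs.2 h.symm, (gΩ_nondeg_iff 𝓒 hg h.rmul).2 h.nondeg⟩

lemma exists_gΩ_eq (g' : Two (B.twist 𝓒) →ₗ[ℂ] Twist 𝓒) : ∃ g, gΩ B g 𝓒 = g' :=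
  ⟨(Twist.equiv 𝓒).toLinearMap ∘ₗ g' ∘ₗ (Bal.ξ B B 𝓒).symm.toLinearMap, by
    refine LinearMap.ext fun q ↦ ?_
    simp [gΩ]⟩

end metric_twist

open Bicomodule

/-! ### The left-invariant elements as a bicomodule -/

section invariant_bicomodule

variable {H X : Type*} [Ring H] [Bialgebra ℂ H] [AddCommGroup X] [Module ℂ X]

/-- The right coaction restricted to the left-invariant elements. -/
def rcoInv (B : Bicomodule H X) : leftInv B →ₗ[ℂ] leftInv B ⊗[ℂ] H :=
  (LinearEquiv.ofInjective ((leftInv B).subtype.rTensor H)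
    (Module.Flat.rTensor_preserves_injective_linearMap _
      (leftInv B).injective_subtype)).symm.toLinearMap ∘ₗ
    LinearMap.codRestrict (LinearMap.range ((leftInv B).subtype.rTensor H))
      (B.rco ∘ₗ (leftInv B).subtype) fun v ↦ rco_leftInv B v.2

lemma rTensor_rcoInv (B : Bicomodule H X) (v : leftInv B) :
    (leftInv B).subtype.rTensor H (rcoInv B v) = B.rco v := by
  have := LinearEquiv.apply_symm_apply (LinearEquiv.ofInjective ((leftInv B).subtype.rTensor H)
    (Module.Flat.rTensor_preserves_injective_linearMap _ (leftInv B).injective_subtype))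
    (LinearMap.codRestrict (LinearMap.range ((leftInv B).subtype.rTensor H))
      (B.rco ∘ₗ (leftInv B).subtype) (fun v ↦ rco_leftInv B v.2) v)
  exact congrArg Subtype.val this

/-- The left-invariant elements as a bicomodule with trivial left coaction. -/
def invBicomodule (B : Bicomodule H X) : Bicomodule H (leftInv B) where
  lco := TensorProduct.mk ℂ H _ 1
  rco := rcoInv B
  lco_counit v := by simp
  lco_coassoc v := by simp [Algebra.TensorProduct.one_def]
  rco_counit v := by
    have e : (leftInv B).subtype ∘ₗ (TensorProduct.rid ℂ _).toLinearMap ∘ₗ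
        (counit (R := ℂ) (A := H)).lTensor _ =
        (TensorProduct.rid ℂ _).toLinearMap ∘ₗ (counit (R := ℂ) (A := H)).lTensor _ ∘ₗ
          (leftInv B).subtype.rTensor H := by ext; simp
    apply (leftInv B).injective_subtype
    refine (LinearMap.congr_fun e (rcoInv B v)).trans ?_
    simp only [LinearMap.comp_apply, rTensor_rcoInv]
    exact B.rco_counit v
  rco_coassoc v := by
    apply Module.Flat.rTensor_preserves_injective_linearMap (M := H ⊗[ℂ] H) _
      (leftInv B).injective_subtype
    have e₁ : (leftInv B).subtype.rTensor (H ⊗[ℂ] H) ∘ₗ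
        (TensorProduct.assoc ℂ _ H H).toLinearMap =
        (TensorProduct.assoc ℂ _ H H).toLinearMap ∘ₗ
          ((leftInv B).subtype.rTensor H).rTensor H := by ext; simp
    have e₂ : (leftInv B).subtype.rTensor H ∘ₗ rcoInv B = B.rco ∘ₗ (leftInv B).subtype :=
      LinearMap.ext (rTensor_rcoInv B)
    refine (LinearMap.congr_fun e₁ _).trans ?_
    rw [LinearMap.comp_apply, ← LinearMap.rTensor_comp_apply, e₂, LinearMap.rTensor_comp_apply,
      rTensor_rcoInv]
    refine (B.rco_coassoc v).trans ?_
    rw [← rTensor_rcoInv]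
    exact LinearMap.congr_fun ((LinearMap.lTensor_comp_rTensor _ _ _).trans
      (LinearMap.rTensor_comp_lTensor _ _ _).symm) (rcoInv B v)
  lco_rco v := by
    have e : (TensorProduct.assoc ℂ H _ H).toLinearMap ∘ₗ
        (TensorProduct.mk ℂ H (leftInv B) 1).rTensor H = TensorProduct.mk ℂ H _ 1 := by
      ext; simp
    exact LinearMap.congr_fun e (rcoInv B v)

lemma isHom_subtype (B : Bicomodule H X) :
    IsHom (invBicomodule B) B .id (leftInv B).subtype :=
  ⟨fun v ↦ v.2, fun v ↦ (rTensor_rcoInv B v).symm⟩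

/-- Over a field, tensoring with H preserves injectivity, so colinearity of F may be tested after
composing with G. This is how maps into ₀E ⊗ ₀E inherit colinearity from maps into E ⊗_A E. -/
lemma isHom_of_injective {Y Z : Type*} [AddCommGroup Y] [Module ℂ Y] [AddCommGroup Z] [Module ℂ Z]
    {BX : Bicomodule H X} {BY : Bicomodule H Y} {BZ : Bicomodule H Z} {F : X →ₗ[ℂ] Y}
    {G : Y →ₗ[ℂ] Z} (hi : Function.Injective G) (hG : IsHom BY BZ .id G)
    (h : IsHom BX BZ .id (G ∘ₗ F)) : IsHom BX BY .id F := by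
  refine ⟨fun x ↦ Module.Flat.lTensor_preserves_injective_linearMap (M := H) G hi ?_,
    fun x ↦ Module.Flat.rTensor_preserves_injective_linearMap (M := H) G hi ?_⟩
  · refine (hG.1 (F x)).symm.trans ((h.1 x).trans ?_)
    rw [LinearMap.lTensor, TensorProduct.map_map, LinearMap.id_comp]
  · refine (hG.2 (F x)).symm.trans ((h.2 x).trans ?_)
    rw [LinearMap.rTensor, TensorProduct.map_map, LinearMap.id_comp]

lemma isHom_codiag_iff {Y Z : Type*} [AddCommGroup Y] [Module ℂ Y] [AddCommGroup Z] [Module ℂ Z]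
    {BX : Bicomodule H X} {BY : Bicomodule H Y} {BZ : Bicomodule H Z} {F : X ⊗[ℂ] Y →ₗ[ℂ] Z} :
    IsHom (Bal.codiag BX BY) BZ .id F ↔ IsHom (BX.tensor BY) BZ (LinearMap.mul' ℂ H) F := by
  simp only [IsHom, Bal.codiag_lco, Bal.codiag_rco, map_rTensor_apply, map_lTensor_apply,
    LinearMap.id_comp]

/-- The trivial bicomodule. -/
def trivBicomodule (H : Type*) [Ring H] [Bialgebra ℂ H] : Bicomodule H ℂ where
  lco := TensorProduct.mk ℂ H _ 1
  rco := (TensorProduct.mk ℂ _ H).flip 1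
  lco_counit v := by simp
  lco_coassoc v := by simp [Algebra.TensorProduct.one_def]
  rco_counit v := by simp
  rco_coassoc v := by simp [Algebra.TensorProduct.one_def]
  lco_rco v := by simp

end invariant_bicomodule

/-! ### Metric compatibility as the vanishing of a contraction -/

section invariant_forms

variable {H E : Type*} [Ring H] [Bialgebra ℂ H] [AddCommGroup E] [Module ℂ E]
  (B : BicovariantBimodule H E)

lemma isHom_invIncl : IsHom (Bal.codiag (invBicomodule B.toBicomodule)
    (invBicomodule B.toBicomodule)) (Bal.bicomodule B B) .id (invIncl B) := by
  rw [isHom_codiag_iff]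
  have h := isHom_comp (Bal.mk_isHom B B)
    ((isHom_subtype B.toBicomodule).tensor (isHom_subtype B.toBicomodule))
  rwa [TensorProduct.map_id, LinearMap.comp_id] at h

/-- `m ⊗ n ↦ P(m n₍₋₁₎) ⊗ P(n₍₀₎)`, where `P` is the projection to the left-invariants. -/
def invRetract (S : H →ₗ[ℂ] H) : E ⊗[ℂ] E →ₗ[ℂ] E ⊗[ℂ] E :=
  (lproj S B ∘ₗ B.ract).rTensor E ∘ₗ (TensorProduct.assoc ℂ E H E).symm.toLinearMap ∘ₗ
    ((lproj S B).lTensor H ∘ₗ B.lco).lTensor E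

lemma invRetract_balance {S : H →ₗ[ℂ] H} (hS : IsAntipode S) (t : (E ⊗[ℂ] H) ⊗[ℂ] E) :
    invRetract B S (B.ract.rTensor E t) =
      invRetract B S (B.lact.lTensor E (TensorProduct.assoc ℂ E H E t)) := by
  have e : invRetract B S ∘ₗ B.ract.rTensor E = invRetract B S ∘ₗ B.lact.lTensor E ∘ₗ
      (TensorProduct.assoc ℂ E H E).toLinearMap := by
    refine TensorProduct.ext_threefold fun m b n ↦ ?_
    have e' : (lproj S B ∘ₗ B.ract).rTensor E ∘ₗ
        (TensorProduct.assoc ℂ E H E).symm.toLinearMap ∘ₗ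
          TensorProduct.mk ℂ E _ (B.ract (m ⊗ₜ b)) =
        (lproj S B ∘ₗ B.ract).rTensor E ∘ₗ (TensorProduct.assoc ℂ E H E).symm.toLinearMap ∘ₗ
          TensorProduct.mk ℂ E _ m ∘ₗ (LinearMap.mulLeft ℂ b).rTensor E :=
      TensorProduct.ext' fun c y ↦ by simp [B.ract_mul]
    have := LinearMap.congr_fun e' ((lproj S B).lTensor H (B.lco n))
    simp only [LinearMap.comp_apply, ← lproj_lco_lact hS] at this
    exact this
  exact LinearMap.congr_fun e t

lemma invRetract_inv {S : H →ₗ[ℂ] H} (hS : IsAntipode S) (t : Inv B ⊗[ℂ] Inv B) :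
    invRetract B S (TensorProduct.map (leftInv B.toBicomodule).subtype
      (leftInv B.toBicomodule).subtype t) =
      TensorProduct.map (leftInv B.toBicomodule).subtype (leftInv B.toBicomodule).subtype t := by
  have e : invRetract B S ∘ₗ TensorProduct.map (leftInv B.toBicomodule).subtype
      (leftInv B.toBicomodule).subtype =
      TensorProduct.map (leftInv B.toBicomodule).subtype (leftInv B.toBicomodule).subtype := by
    refine TensorProduct.ext' fun v w ↦ ?_
    have hw : B.lco (w : E) = 1 ⊗ₜ (w : E) := w.2
    simp [invRetract, hw, B.ract_one, lproj_of_mem hS B v.2, lproj_of_mem hS B w.2]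
  exact LinearMap.congr_fun e t

/-- The map m ⊗ n ↦ P(m n₍₋₁₎) ⊗ P(n₍₀₎) is balanced and restricts to the inclusion on ₀E ⊗ ₀E. So a
tensor of invariants that dies in E ⊗_A E is already zero. -/
lemma invIncl_injective {S : H →ₗ[ℂ] H} (hS : IsAntipode S) :
    Function.Injective (invIncl B) := by
  rw [injective_iff_map_eq_zero]
  intro t ht
  have h := Bal.eq_zero B.toBimodule B.toBimodule (invRetract_balance B hS) _ ht
  rw [invRetract_inv B hS] at h
  refine (injective_iff_map_eq_zero _).1 ?_ t h
  exact TensorProduct.map_injective_of_flat_flat _ _ (leftInv B.toBicomodule).injective_subtype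
    (leftInv B.toBicomodule).injective_subtype

lemma isHom_of_invIncl {S : H →ₗ[ℂ] H} (hS : IsAntipode S) {X : Type*} [AddCommGroup X]
    [Module ℂ X] {D : Bicomodule H X} {M : X →ₗ[ℂ] Inv B ⊗[ℂ] Inv B}
    (h : IsHom D (Bal.bicomodule B B) .id (invIncl B ∘ₗ M)) :
    IsHom D (Bal.codiag (invBicomodule B.toBicomodule) (invBicomodule B.toBicomodule)) .id M :=
  isHom_of_injective (invIncl_injective B hS) (isHom_invIncl B) h

variable {B} {g : Two B →ₗ[ℂ] H}

variable (B g) in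
/-- The form induced on the left-invariant elements. -/
def invForm : Inv B ⊗[ℂ] Inv B →ₗ[ℂ] ℂ := counit ∘ₗ g ∘ₗ invIncl B

lemma codiag_inv_lco (t : Inv B ⊗[ℂ] Inv B) :
    (Bal.codiag (invBicomodule B.toBicomodule) (invBicomodule B.toBicomodule)).lco t = 1 ⊗ₜ t := by
  have e : (Bal.codiag (invBicomodule B.toBicomodule) (invBicomodule B.toBicomodule)).lco =
      TensorProduct.mk ℂ H _ 1 := by
    refine TensorProduct.ext' fun v w ↦ ?_
    rw [Bal.codiag_lco]
    simp [Bicomodule.tensor, invBicomodule]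
  exact LinearMap.congr_fun e t

/-- The value of g on a tensor of left-invariants is left coinvariant in H, and such elements are
scalars. -/
lemma pairing_invIncl (hg : IsHom (Bal.bicomodule B B) (self H) .id g)
    (t : Inv B ⊗[ℂ] Inv B) : g (invIncl B t) = invForm B g t • (1 : H) := by
  have h : comul (R := ℂ) (g (invIncl B t)) = 1 ⊗ₜ g (invIncl B t) := by
    refine (hg.1 _).trans ?_
    rw [(isHom_invIncl B).1, codiag_inv_lco]
    simp
  have := congrArg (TensorProduct.rid ℂ H ∘ (counit (R := ℂ) (A := H)).lTensor H) h
  simpa [invForm] using this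

lemma isHom_invForm (hg : IsHom (Bal.bicomodule B B) (self H) .id g) :
    IsHom (Bal.codiag (invBicomodule B.toBicomodule) (invBicomodule B.toBicomodule))
      (trivBicomodule H) .id (invForm B g) := by
  refine ⟨fun t ↦ by rw [codiag_inv_lco]; rfl, fun t ↦ ?_⟩
  have h := ((isHom_comp hg (isHom_invIncl B)).2 t)
  rw [LinearMap.comp_apply, pairing_invIncl hg, map_smul] at h
  have := congrArg ((counit (R := ℂ) (A := H)).rTensor H) h
  rw [LinearMap.rTensor, TensorProduct.map_map, map_smul] at this
  have h1 : (self H).rco 1 = 1 ⊗ₜ 1 := DualTwoCocycle.self_one.2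
  rw [h1, TensorProduct.map_tmul, Bialgebra.counit_one, TensorProduct.smul_tmul'] at this
  simpa [trivBicomodule, invForm] using this

lemma contract_apply (hg : IsHom (Bal.bicomodule B B) (self H) .id g)
    (t : (Inv B ⊗[ℂ] Inv B) ⊗[ℂ] Inv B) :
    contract B g t = (leftInv B.toBicomodule).subtype (TensorProduct.rid ℂ _
      ((invForm B g).lTensor _ (TensorProduct.assoc ℂ _ _ _ t))) := by
  have e : contract B g = (leftInv B.toBicomodule).subtype ∘ₗ
      (TensorProduct.rid ℂ _).toLinearMap ∘ₗ (invForm B g).lTensor _ ∘ₗ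
        (TensorProduct.assoc ℂ _ _ _).toLinearMap := by
    refine TensorProduct.ext_threefold fun u v w ↦ ?_
    simp [contract, pairing_invIncl hg, B.ract_one]
  exact LinearMap.congr_fun e t

/-- As g(ω₁ ⊗ ω₂) is a scalar and g is right linear, the terms g(ω₁ ⊗ ω₂) da and d(g(ω₁ ⊗ ω₂ a)) are
equal. What remains is Π⁰(ω₁ ⊗ ω₂) a = 0, for which a = 1 suffices. -/
lemma isMetricCompatible_iff (hg : IsHom (Bal.bicomodule B B) (self H) .id g)
    (hr : ∀ q a, g (rmul B q a) = g q * a) {d : H →ₗ[ℂ] E} {σ : Two B →ₗ[ℂ] Two B}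
    {nab : E →ₗ[ℂ] Two B} : IsMetricCompatible B d σ g nab ↔
      ∃ s P N, IsRestriction B σ s ∧ IsSymProj B s P ∧ (∀ ω : Inv B, invIncl B (N ω) = nab ω) ∧
        ∀ t, contract B g ((s ∘ₗ N).rTensor _ (P t)) = 0 := by
  have key (s P) (N : Inv B →ₗ[ℂ] Inv B ⊗[ℂ] Inv B) :
      (∀ (ω₁ ω₂ : Inv B) (a : H),
      B.ract (preMetricity B g s P N (ω₁ ⊗ₜ ω₂) ⊗ₜ a) + B.lact (g (tmulA B ω₁ ω₂) ⊗ₜ d a) =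
        d (g (rmul B (tmulA B ω₁ ω₂) a))) ↔
      ∀ t, contract B g ((s ∘ₗ N).rTensor _ (P t)) = 0 := by
    have h1 (ω₁ ω₂ : Inv B) (a : H) : B.lact (g (tmulA B ω₁ ω₂) ⊗ₜ d a) =
        d (g (rmul B (tmulA B ω₁ ω₂) a)) := by
      have : g (tmulA B ω₁ ω₂) = invForm B g (ω₁ ⊗ₜ ω₂) • (1 : H) :=
        pairing_invIncl hg (ω₁ ⊗ₜ ω₂)
      rw [hr, this, ← TensorProduct.smul_tmul', map_smul, B.one_lact, smul_mul_assoc, one_mul,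
        map_smul]
    have h2 (t : Inv B ⊗[ℂ] Inv B) : preMetricity B g s P N t =
        (2 : ℂ) • contract B g ((s ∘ₗ N).rTensor _ (P t)) := by
      rw [LinearMap.rTensor_comp_apply]
      rfl
    simp only [h1, add_eq_right]
    constructor
    · intro h t
      have e : contract B g ∘ₗ (s ∘ₗ N).rTensor _ ∘ₗ P = 0 := by
        refine TensorProduct.ext' fun v w ↦ ?_
        have := h v w 1
        rw [B.ract_one, h2] at this
        exact (smul_eq_zero.1 this).resolve_left two_ne_zero
      exact LinearMap.congr_fun e t
    · intro h v w a
      rw [h2, h, smul_zero, TensorProduct.zero_tmul, map_zero]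
  simp only [IsMetricCompatible, key]

end invariant_forms

open Bicomodule

/-! ### Eigenspaces, kernels and ranges under conjugation -/

section conjugation

variable {V W : Type*} [AddCommGroup V] [Module ℂ V] [AddCommGroup W] [Module ℂ W]
  (y : V ≃ₗ[ℂ] W)

lemma eigenspace_conj (s : Module.End ℂ V) (c : ℂ) :
    Module.End.eigenspace (y.conj s) c =
      (Module.End.eigenspace s c).map (y : V →ₗ[ℂ] W) := by
  ext w
  obtain ⟨v, rfl⟩ := y.surjective w
  rw [Submodule.mem_map_equiv, y.symm_apply_apply, Module.End.mem_eigenspace_iff,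
    Module.End.mem_eigenspace_iff, LinearEquiv.conj_apply_apply, y.symm_apply_apply, ← map_smul,
    y.injective.eq_iff]

lemma ker_conj (P : Module.End ℂ V) :
    LinearMap.ker (y.conj P) = (LinearMap.ker P).map (y : V →ₗ[ℂ] W) := by
  ext w
  obtain ⟨v, rfl⟩ := y.surjective w
  rw [Submodule.mem_map_equiv, y.symm_apply_apply, LinearMap.mem_ker, LinearMap.mem_ker,
    LinearEquiv.conj_apply_apply, y.symm_apply_apply, y.map_eq_zero_iff]

lemma range_conj (P : Module.End ℂ V) :
    LinearMap.range (y.conj P) = (LinearMap.range P).map (y : V →ₗ[ℂ] W) := by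
  ext w
  obtain ⟨v, rfl⟩ := y.surjective w
  rw [Submodule.mem_map_equiv, y.symm_apply_apply, LinearMap.mem_range, LinearMap.mem_range]
  simp only [LinearEquiv.conj_apply_apply, y.injective.eq_iff]
  exact (y.symm.surjective.exists (p := fun v' ↦ P v' = v)).symm

end conjugation

/-- `Bicomodule.ad` as an automorphism. -/
def Bicomodule.adEquiv {C X : Type*} [AddCommGroup C] [Module ℂ C] [Coalgebra ℂ C]
    [AddCommGroup X] [Module ℂ X] (B : Bicomodule C X) (u : (WithConv (C →ₗ[ℂ] ℂ))ˣ) :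
    X ≃ₗ[ℂ] X :=
  LinearEquiv.ofLinearMap (B.ad u) (B.ad u⁻¹) (LinearMap.ext (ad_ad_inv B u))
    (LinearMap.ext (ad_inv_ad B u))

/-! ### Deformation on the left-invariant elements -/

section twist_invariants

variable {A E : Type*} [Ring A] [Bialgebra ℂ A] [AddCommGroup E] [Module ℂ E]
  (B : BicovariantBimodule A E) (𝓒 : DualTwoCocycle A)

lemma leftInv_twist : leftInv (B.twist 𝓒).toBicomodule = leftInv B.toBicomodule := rfl

/-- The left-invariant elements are unchanged by the deformation. -/
def invEquiv : Inv (B.twist 𝓒) ≃ₗ[ℂ] Inv B := LinearEquiv.ofEq _ _ (leftInv_twist B 𝓒)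

/-- The restriction of `ξ` to the left-invariant elements. -/
def ξInv : (Inv (B.twist 𝓒) ⊗[ℂ] Inv (B.twist 𝓒)) ≃ₗ[ℂ] (Inv B ⊗[ℂ] Inv B) :=
  TensorProduct.congr (invEquiv B 𝓒) (invEquiv B 𝓒) ≪≫ₗ
    ((invBicomodule B.toBicomodule).tensor (invBicomodule B.toBicomodule)).adEquiv 𝓒.Ω

lemma ξInv_apply (t : Inv (B.twist 𝓒) ⊗[ℂ] Inv (B.twist 𝓒)) :
    ξInv B 𝓒 t = ((invBicomodule B.toBicomodule).tensor (invBicomodule B.toBicomodule)).ad 𝓒.Ω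
      (TensorProduct.map (invEquiv B 𝓒).toLinearMap (invEquiv B 𝓒).toLinearMap t) := rfl

lemma ξInv_symm_apply (t : Inv B ⊗[ℂ] Inv B) :
    (ξInv B 𝓒).symm t =
      TensorProduct.map (invEquiv B 𝓒).symm.toLinearMap (invEquiv B 𝓒).symm.toLinearMap
        (((invBicomodule B.toBicomodule).tensor (invBicomodule B.toBicomodule)).ad 𝓒.Ω⁻¹ t) := rfl

/-- The inclusion of the left-invariants is colinear, so it commutes with the twist, and ξ restricts
to the twist of ₀E ⊗ ₀E. Consequently ₀(σ_Ω) is conjugate to ₀σ, and the eigenspaces and the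
symmetric projection are transported. -/
lemma ξ_invIncl (t : Inv (B.twist 𝓒) ⊗[ℂ] Inv (B.twist 𝓒)) :
    Bal.ξ B B 𝓒 (invIncl (B.twist 𝓒) t) = invIncl B (ξInv B 𝓒 t) := by
  have h := ad_map (isHom_subtype B.toBicomodule) (isHom_subtype B.toBicomodule) 𝓒.Ω
    (TensorProduct.map (invEquiv B 𝓒).toLinearMap (invEquiv B 𝓒).toLinearMap t)
  rw [TensorProduct.map_map] at h
  have e₁ : (leftInv B.toBicomodule).subtype ∘ₗ (invEquiv B 𝓒).toLinearMap =
    (leftInv (B.twist 𝓒).toBicomodule).subtype := rfl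
  rw [e₁] at h
  rw [ξInv_apply]
  exact (ξ_mk B 𝓒 _).trans (congrArg (Bal.mk B.toBimodule B.toBimodule) h)

variable {B}

lemma ξ_σΩ {σ : Two B →ₗ[ℂ] Two B} (q : Two (B.twist 𝓒)) :
    Bal.ξ B B 𝓒 (σΩ B σ 𝓒 q) = σ (Bal.ξ B B 𝓒 q) := by
  simp only [σΩ, LinearMap.comp_apply, LinearEquiv.coe_coe, LinearEquiv.apply_symm_apply]

lemma isRestriction_twist_iff {σ : Two B →ₗ[ℂ] Two B}
    {s : Module.End ℂ (Inv (B.twist 𝓒) ⊗[ℂ] Inv (B.twist 𝓒))} :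
    IsRestriction (B.twist 𝓒) (σΩ B σ 𝓒) s ↔ IsRestriction B σ ((ξInv B 𝓒).conj s) := by
  simp only [IsRestriction, LinearMap.ext_iff, LinearMap.comp_apply]
  rw [(ξInv B 𝓒).surjective.forall]
  refine forall_congr' fun t ↦ ?_
  rw [← (Bal.ξ B B 𝓒).injective.eq_iff, ξ_σΩ, ξ_invIncl, ξ_invIncl, LinearEquiv.conj_apply_apply,
    LinearEquiv.symm_apply_apply]

lemma isSymProj_twist_iff {s P : Module.End ℂ (Inv (B.twist 𝓒) ⊗[ℂ] Inv (B.twist 𝓒))} :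
    IsSymProj (B.twist 𝓒) s P ↔ IsSymProj B ((ξInv B 𝓒).conj s) ((ξInv B 𝓒).conj P) := by
  have hi := Submodule.map_injective_of_injective (ξInv B 𝓒).injective
  refine and_congr ?_ (and_congr ?_ ?_)
  · rw [← (ξInv B 𝓒).conj.injective.eq_iff]
    refine Eq.congr ?_ rfl
    exact LinearEquiv.conj_comp (ξInv B 𝓒) P P
  · rw [range_conj, eigenspace_conj, hi.eq_iff]
  · simp only [ker_conj, eigenspace_conj, ← Submodule.map_iSup]
    exact hi.eq_iff.symm

lemma IsDiagonalisable.twist {σ : Two B →ₗ[ℂ] Two B} (h : IsDiagonalisable B σ) :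
    IsDiagonalisable (B.twist 𝓒) (σΩ B σ 𝓒) := by
  obtain ⟨s, hs, he⟩ := h
  obtain ⟨s, rfl⟩ := (ξInv B 𝓒).conj.surjective s
  refine ⟨s, (isRestriction_twist_iff 𝓒).2 hs, ?_⟩
  simp only [eigenspace_conj, ← Submodule.map_iSup] at he
  apply Submodule.map_injective_of_injective (ξInv B 𝓒).injective
  refine he.trans ?_
  rw [Submodule.map_top]
  exact (LinearEquiv.range (ξInv B 𝓒)).symm

end twist_invariants

/-! ### Invariance of the contraction under the deformation -/

section compatibility

variable {A V : Type*} [Ring A] [Bialgebra ℂ A] [AddCommGroup V] [Module ℂ V]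
  {D : Bicomodule A V} (𝓒 : DualTwoCocycle A)

/-- Normalisation of γ on the unit, extended to Ω⁻¹ by invertibility. It makes twists disappear once
two factors have been contracted to a scalar. -/
lemma ad_triv_right {u : (WithConv (A ⊗[ℂ] A →ₗ[ℂ] ℂ))ˣ} (h : u = 𝓒.Ω ∨ u = 𝓒.Ω⁻¹)
    (t : V ⊗[ℂ] ℂ) : (D.tensor (trivBicomodule A)).ad u t = t := by
  have e : (D.tensor (trivBicomodule A)).ad 𝓒.Ω = .id :=
    TensorProduct.ext' fun v c ↦ 𝓒.deform_unit_right (BX := D) (BY := trivBicomodule A) (y := c)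
      rfl rfl .id v
  rcases h with rfl | rfl
  · exact LinearMap.congr_fun e t
  · have := ad_ad_inv (D.tensor (trivBicomodule A)) 𝓒.Ω t
    rwa [e] at this

open DualTwoCocycle in
/-- A contraction of the last two factors is unaffected by the deformation. -/
lemma contraction_ad {M : V →ₗ[ℂ] V ⊗[ℂ] V} (hM : IsHom D (Bal.codiag D D) .id M)
    {φ : V ⊗[ℂ] V →ₗ[ℂ] ℂ} (hφ : IsHom (Bal.codiag D D) (trivBicomodule A) .id φ)
    (t : V ⊗[ℂ] V) :
    (φ ∘ₗ (D.tensor D).ad 𝓒.Ω).lTensor V (TensorProduct.assoc ℂ V V V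
      (((D.tensor D).ad 𝓒.Ω⁻¹ ∘ₗ M).rTensor V ((D.tensor D).ad 𝓒.Ω⁻¹ t))) =
      φ.lTensor V (TensorProduct.assoc ℂ V V V (M.rTensor V t)) := by
  have hid : IsHom (D.tensor D) (Bal.codiag D D) (LinearMap.mul' ℂ A) .id :=
    isHom_codiag_iff.1 (IsHom.id _)
  -- M is colinear for the codiagonal coactions, so a twist of two factors becomes after M ⊗ id the
  -- twist of three factors in which the first two legs are multiplied.
  have h₁ : M.rTensor V ((D.tensor D).ad 𝓒.Ω⁻¹ t) =
      ((D.tensor D).tensor D).ad (Units.map (pull (face₂ A)) 𝓒.Ω⁻¹) (M.rTensor V t) := by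
    have := ad_map hM (IsHom.id D) 𝓒.Ω⁻¹ t
    refine this.symm.trans ?_
    have := ad_face₂ (BZ := D) hid 𝓒.Ω⁻¹ (M.rTensor V t)
    rwa [LinearMap.rTensor_id, LinearMap.id_apply, LinearMap.id_apply] at this
  rw [LinearMap.lTensor_comp_apply, LinearMap.rTensor_comp_apply, h₁, ← ad_face₃, ← ad_face₀,
    ad_ad, ad_ad]
  -- The three accumulated twists multiply to face₂⁻¹ face₃⁻¹ face₀, which the cocycle identity
  -- reduces to face₁⁻¹. Since φ is colinear into the trivial bicomodule, that twist passes through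
  -- the contraction to V ⊗ ℂ, where it is the identity.
  have hu : Units.map (pull (face₂ A)) 𝓒.Ω⁻¹ * Units.map (pull (face₃ A)) 𝓒.Ω⁻¹ *
      Units.map (pull (face₀ A)) 𝓒.Ω = Units.map (pull (face₁ A)) 𝓒.Ω⁻¹ := by
    rw [map_inv, map_inv, map_inv, ← mul_inv_rev, cocycle', mul_inv_rev, inv_mul_cancel_right]
  rw [← mul_assoc, hu, ← ad_face₁ (isHom_codiag_iff.1 hφ), ad_triv_right 𝓒 (Or.inr rfl)]

end compatibility

open Bicomodule

/-! ### Deformation of the connection and torsion conditions -/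

section levi_civita

variable {A E : Type*} [Ring A] [HopfAlgebra ℂ A] [AddCommGroup E] [Module ℂ E]
  {B : BicovariantBimodule A E} (𝓒 : DualTwoCocycle A)
  {d : A →ₗ[ℂ] E} {σ : Two B →ₗ[ℂ] Two B} {g : Two B →ₗ[ℂ] A} {nab : E →ₗ[ℂ] Two B}

lemma ξ_nablaΩ (x : E) : Bal.ξ B B 𝓒 (nablaΩ B nab 𝓒 x) = nab x := by
  simp only [nablaΩ, LinearMap.comp_apply, LinearEquiv.coe_coe, LinearEquiv.apply_symm_apply]

/-- The Leibniz rule is an equality of two maps on E ⊗ A, and colinearity of ∇ and d makes the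
deformed rule the same equality precomposed with the invertible twist. -/
lemma isConnection_twist_iff (hd : IsHom (self A) B.toBicomodule .id d)
    (hn : IsHom B.toBicomodule (Bal.bicomodule B B) .id nab) :
    IsConnection (B.twist 𝓒) (dΩ d 𝓒) (nablaΩ B nab 𝓒) ↔ IsConnection B d nab := by
  set L : E ⊗[ℂ] A →ₗ[ℂ] Two B := (Bal.bimodule B.toBimodule B.toBimodule).ract ∘ₗ
    TensorProduct.map nab .id + Bal.mk B.toBimodule B.toBimodule ∘ₗ TensorProduct.map .id d with hL
  have h₁ : IsConnection B d nab ↔ nab ∘ₗ B.ract = L :=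
    ⟨fun h ↦ TensorProduct.ext' h, fun h x a ↦ LinearMap.congr_fun h (x ⊗ₜ a)⟩
  have h₂ (x : E) (a : Twist 𝓒) : Bal.ξ B B 𝓒 (nablaΩ B nab 𝓒 ((B.twist 𝓒).ract (x ⊗ₜ a))) =
      nab (B.ract ((B.toBicomodule.tensor (self A)).ad 𝓒.Ω (x ⊗ₜ Twist.equiv 𝓒 a))) := by
    rw [ξ_nablaΩ, twist_ract, DualTwoCocycle.deform_apply]
  have h₃ (x : E) (a : Twist 𝓒) : Bal.ξ B B 𝓒 (rmul (B.twist 𝓒) (nablaΩ B nab 𝓒 x) a +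
      tmulA (B.twist 𝓒) x (dΩ d 𝓒 a)) =
      L ((B.toBicomodule.tensor (self A)).ad 𝓒.Ω (x ⊗ₜ Twist.equiv 𝓒 a)) := by
    have k₁ := ad_map hn (IsHom.id (self A)) 𝓒.Ω (x ⊗ₜ Twist.equiv 𝓒 a)
    have k₂ := ad_map (IsHom.id B.toBicomodule) hd 𝓒.Ω (x ⊗ₜ Twist.equiv 𝓒 a)
    rw [map_add, ξ_rmul, ξ_tmulA, ξ_nablaΩ, DualTwoCocycle.deform_apply,
      DualTwoCocycle.deform_apply, hL, LinearMap.add_apply, LinearMap.comp_apply,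
      LinearMap.comp_apply, ← k₁, ← k₂, TensorProduct.map_tmul, TensorProduct.map_tmul]
    rfl
  have h₄ : IsConnection (B.twist 𝓒) (dΩ d 𝓒) (nablaΩ B nab 𝓒) ↔
      (nab ∘ₗ B.ract) ∘ₗ (B.toBicomodule.tensor (self A)).ad 𝓒.Ω =
        L ∘ₗ (B.toBicomodule.tensor (self A)).ad 𝓒.Ω := by
    constructor
    · intro h
      refine TensorProduct.ext' fun x a ↦ ?_
      obtain ⟨a, rfl⟩ := (Twist.equiv 𝓒).surjective a
      exact (h₂ x a).symm.trans ((congrArg (Bal.ξ B B 𝓒) (h x a)).trans (h₃ x a))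
    · intro h x a
      apply (Bal.ξ B B 𝓒).injective
      rw [h₂, h₃]
      exact LinearMap.congr_fun h _
  rw [h₁, h₄]
  exact ((B.toBicomodule.tensor (self A)).adEquiv 𝓒.Ω).eq_comp_toLinearMap_iff _ _

/-- Vanishing torsion forces the exterior derivative to be -∧∇. The only question is whether that
map satisfies D(a db) = da ∧ db, so the quotient by Ker(σ - 1) can be replaced by applying σ - 1. -/
lemma isTorsionless_iff {H : Type*} [Ring H] [Bialgebra ℂ H] {B : BicovariantBimodule H E}
    {d : H →ₗ[ℂ] E} {σ : Two B →ₗ[ℂ] Two B} {nab : E →ₗ[ℂ] Two B} :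
    IsTorsionless B d σ nab ↔ (σ - .id) ∘ₗ (nab ∘ₗ formMap B.toBimodule d +
      Bal.mk B.toBimodule B.toBimodule ∘ₗ TensorProduct.map d d) = 0 := by
  have h₁ (q : Two B) : wedge B σ q = 0 ↔ (σ - .id) q = 0 :=
    (Submodule.Quotient.mk_eq_zero _).trans LinearMap.mem_ker
  constructor
  · rintro ⟨D, hD, h⟩
    refine TensorProduct.ext' fun a b ↦ (h₁ _).1 ?_
    have := LinearMap.congr_fun h (B.lact (a ⊗ₜ d b))
    rw [LinearMap.add_apply, hD] at this
    rw [LinearMap.add_apply, map_add]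
    exact this
  · intro h
    refine ⟨-(wedge B σ ∘ₗ nab), fun a b ↦ ?_, add_neg_cancel _⟩
    have := (h₁ _).2 (LinearMap.congr_fun h (a ⊗ₜ b))
    rw [LinearMap.add_apply, map_add] at this
    exact neg_eq_of_add_eq_zero_right this

/-- In the criterion above, the map a ⊗ b ↦ ∇(a db) + da ⊗ db deforms, up to ξ, by precomposition
with the twist of A ⊗ A, as d is colinear. Colinearity of ∇ plays no role here. -/
lemma isTorsionless_twist_iff (hd : IsHom (self A) B.toBicomodule .id d) :
    IsTorsionless (B.twist 𝓒) (dΩ d 𝓒) (σΩ B σ 𝓒) (nablaΩ B nab 𝓒) ↔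
      IsTorsionless B d σ nab := by
  set L : A ⊗[ℂ] A →ₗ[ℂ] Two B := nab ∘ₗ formMap B.toBimodule d +
    Bal.mk B.toBimodule B.toBimodule ∘ₗ TensorProduct.map d d with hL
  set a := ((self A).tensor (self A)).adEquiv 𝓒.Ω
  set e := TensorProduct.congr (Twist.equiv 𝓒) (Twist.equiv 𝓒)
  have h₁ (t : Twist 𝓒 ⊗[ℂ] Twist 𝓒) : Bal.ξ B B 𝓒 ((nablaΩ B nab 𝓒 ∘ₗ
      formMap (B.twist 𝓒).toBimodule (dΩ d 𝓒) +
        Bal.mk (B.twist 𝓒).toBimodule (B.twist 𝓒).toBimodule ∘ₗ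
          TensorProduct.map (dΩ d 𝓒) (dΩ d 𝓒)) t) = L (a (e t)) := by
    have k := ad_map hd hd 𝓒.Ω (e t)
    have k' : TensorProduct.map d d (e t) = TensorProduct.map (dΩ d 𝓒) (dΩ d 𝓒) t := by
      change TensorProduct.map d d (TensorProduct.map _ _ t) = _
      rw [TensorProduct.map_map]
      rfl
    rw [LinearMap.add_apply, map_add, LinearMap.comp_apply, LinearMap.comp_apply, ξ_nablaΩ,
      twist_formMap 𝓒 hd, ξ_mk, ← k', k, hL, LinearMap.add_apply, LinearMap.comp_apply,
      LinearMap.comp_apply]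
    rfl
  rw [isTorsionless_iff, isTorsionless_iff]
  simp only [LinearMap.ext_iff, LinearMap.comp_apply (f := σΩ B σ 𝓒 - .id),
    LinearMap.comp_apply (f := σ - .id), LinearMap.zero_apply]
  rw [(e.trans a).surjective.forall]
  refine forall_congr' fun t ↦ ?_
  rw [LinearEquiv.trans_apply, ← h₁, ← (Bal.ξ B B 𝓒).map_eq_zero_iff, LinearMap.sub_apply,
    map_sub, ξ_σΩ]
  rfl

end levi_civita

open Bicomodule

lemma isHom_comp_equiv_iff {C D X Y Z : Type*} [AddCommGroup C] [Module ℂ C] [Coalgebra ℂ C]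
    [AddCommGroup D] [Module ℂ D] [Coalgebra ℂ D] [AddCommGroup X] [Module ℂ X]
    [AddCommGroup Y] [Module ℂ Y] [AddCommGroup Z] [Module ℂ Z]
    {BX : Bicomodule C X} {BX' : Bicomodule D X} {BY : Bicomodule C Y} {BZ : Bicomodule D Z}
    {φ : C ≃ₗ[ℂ] D} {G : Y ≃ₗ[ℂ] Z} (h : IsHom BX BX' φ.toLinearMap .id)
    (hG : IsHom BY BZ φ.toLinearMap G.toLinearMap) {F : X →ₗ[ℂ] Y} :
    IsHom BX BY .id F ↔ IsHom BX' BZ .id (G.toLinearMap ∘ₗ F) := by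
  refine and_congr (forall_congr' fun x ↦ ?_) (forall_congr' fun x ↦ ?_)
  · have h₁ := h.1 x
    rw [LinearMap.id_apply] at h₁
    rw [LinearMap.comp_apply, hG.1, h₁, TensorProduct.map_map, LinearMap.id_comp,
      LinearMap.comp_id, ← (TensorProduct.congr φ G).injective.eq_iff]
    refine Eq.congr rfl ?_
    change TensorProduct.map _ _ (TensorProduct.map _ _ _) = _
    rw [TensorProduct.map_map, LinearMap.comp_id]
  · have h₁ := h.2 x
    rw [LinearMap.id_apply] at h₁
    rw [LinearMap.comp_apply, hG.2, h₁, TensorProduct.map_map, LinearMap.id_comp,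
      LinearMap.comp_id, ← (TensorProduct.congr G φ).injective.eq_iff]
    refine Eq.congr rfl ?_
    change TensorProduct.map _ _ (TensorProduct.map _ _ _) = _
    rw [TensorProduct.map_map, LinearMap.comp_id]

/-! ### Deformation of metric compatibility -/

section levi_civita

variable {A E : Type*} [Ring A] [HopfAlgebra ℂ A] [AddCommGroup E] [Module ℂ E]
  {B : BicovariantBimodule A E} (𝓒 : DualTwoCocycle A)
  {d : A →ₗ[ℂ] E} {σ : Two B →ₗ[ℂ] Two B} {g : Two B →ₗ[ℂ] A} {nab : E →ₗ[ℂ] Two B}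

lemma isHom_nablaΩ_iff : IsHom (B.twist 𝓒).toBicomodule
    (Bal.bicomodule (B.twist 𝓒) (B.twist 𝓒)) .id (nablaΩ B nab 𝓒) ↔
      IsHom B.toBicomodule (Bal.bicomodule B B) .id nab := by
  rw [isHom_comp_equiv_iff (twist_isHom B 𝓒) (ξ_isHom B 𝓒)]
  have e : (Bal.ξ B B 𝓒).toLinearMap ∘ₗ nablaΩ B nab 𝓒 = nab :=
    LinearMap.ext fun x ↦ by rw [LinearMap.comp_apply, LinearEquiv.coe_coe, ξ_nablaΩ]
  rw [e]

lemma invForm_gΩ : invForm (B.twist 𝓒) (gΩ B g 𝓒) =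
    invForm B g ∘ₗ (ξInv B 𝓒).toLinearMap := by
  refine LinearMap.ext fun t ↦ ?_
  have h : g (Bal.ξ B B 𝓒 (invIncl (B.twist 𝓒) t)) = g (invIncl B (ξInv B 𝓒 t)) := by
    rw [ξ_invIncl]
  exact congrArg (counit (R := ℂ) (A := A)) h

/-- Both contractions are scalar contractions by `contract_apply`. After identifying the two spaces
of left-invariants, the deformed one is the left-hand side of `contraction_ad`, with M the colinear
map ₀σ∇. -/
lemma contract_gΩ (hg : IsHom (Bal.bicomodule B B) (self A) .id g)
    (hg' : IsHom (Bal.bicomodule (B.twist 𝓒) (B.twist 𝓒)) (self (Twist 𝓒)) .id (gΩ B g 𝓒))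
    {M : Inv B →ₗ[ℂ] Inv B ⊗[ℂ] Inv B}
    (hM : IsHom (invBicomodule B.toBicomodule) (Bal.codiag (invBicomodule B.toBicomodule)
      (invBicomodule B.toBicomodule)) .id M) (t : Inv B ⊗[ℂ] Inv B) :
    contract (B.twist 𝓒) (gΩ B g 𝓒) (((ξInv B 𝓒).symm.toLinearMap ∘ₗ M ∘ₗ
      (invEquiv B 𝓒).toLinearMap).rTensor _ ((ξInv B 𝓒).symm t)) =
      contract B g (M.rTensor _ t) := by
  rw [contract_apply hg', contract_apply hg, ← contraction_ad 𝓒 hM (isHom_invForm hg), invForm_gΩ]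
  set D := invBicomodule B.toBicomodule
  set x := (D.tensor D).ad 𝓒.Ω
  set x' := (D.tensor D).ad 𝓒.Ω⁻¹
  set φ := invForm B g
  have e₁ : (leftInv (B.twist 𝓒).toBicomodule).subtype =
      (leftInv B.toBicomodule).subtype ∘ₗ (invEquiv B 𝓒).toLinearMap := rfl
  have e₂ : (ξInv B 𝓒).toLinearMap = x ∘ₗ TensorProduct.map (invEquiv B 𝓒).toLinearMap
    (invEquiv B 𝓒).toLinearMap := LinearMap.ext (ξInv_apply B 𝓒)
  have e₃ : (ξInv B 𝓒).symm.toLinearMap = TensorProduct.map (invEquiv B 𝓒).symm.toLinearMap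
    (invEquiv B 𝓒).symm.toLinearMap ∘ₗ x' := LinearMap.ext (ξInv_symm_apply B 𝓒)
  have h₃ := LinearMap.congr_fun e₃ t
  rw [LinearEquiv.coe_coe] at h₃
  rw [h₃, e₁, e₂, e₃, LinearMap.comp_apply, LinearMap.comp_apply]
  -- From here only the invertibility of the identification of the two spaces of left-invariants
  -- matters.
  generalize invEquiv B 𝓒 = e
  have k : ((leftInv B.toBicomodule).subtype ∘ₗ e.toLinearMap) ∘ₗ
      (TensorProduct.rid ℂ _).toLinearMap ∘ₗ
        (φ ∘ₗ x ∘ₗ TensorProduct.map e.toLinearMap e.toLinearMap).lTensor _ ∘ₗ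
          (TensorProduct.assoc ℂ _ _ _).toLinearMap ∘ₗ
      ((TensorProduct.map e.symm.toLinearMap e.symm.toLinearMap ∘ₗ x') ∘ₗ M ∘ₗ
        e.toLinearMap).rTensor _ ∘ₗ
        TensorProduct.map e.symm.toLinearMap e.symm.toLinearMap =
      (leftInv B.toBicomodule).subtype ∘ₗ (TensorProduct.rid ℂ _).toLinearMap ∘ₗ
        (φ ∘ₗ x).lTensor _ ∘ₗ (TensorProduct.assoc ℂ _ _ _).toLinearMap ∘ₗ
          (x' ∘ₗ M).rTensor _ := by
    refine TensorProduct.ext' fun v w ↦ ?_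
    have k' : ((leftInv B.toBicomodule).subtype ∘ₗ e.toLinearMap) ∘ₗ
      (TensorProduct.rid ℂ _).toLinearMap ∘ₗ
        (φ ∘ₗ x ∘ₗ TensorProduct.map e.toLinearMap e.toLinearMap).lTensor _ ∘ₗ
          (TensorProduct.assoc ℂ _ _ _).toLinearMap ∘ₗ
        TensorProduct.map (TensorProduct.map e.symm.toLinearMap e.symm.toLinearMap)
          e.symm.toLinearMap =
      (leftInv B.toBicomodule).subtype ∘ₗ (TensorProduct.rid ℂ _).toLinearMap ∘ₗ
        (φ ∘ₗ x).lTensor _ ∘ₗ (TensorProduct.assoc ℂ _ _ _).toLinearMap :=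
      TensorProduct.ext_threefold fun a b c ↦ by simp
    have := LinearMap.congr_fun k' (x' (M v) ⊗ₜ w)
    simp only [LinearMap.comp_apply, TensorProduct.map_tmul, LinearMap.rTensor_tmul,
      LinearEquiv.coe_coe, LinearEquiv.apply_symm_apply] at this ⊢
    exact this
  exact LinearMap.congr_fun k (x' t)

/-- Inside E ⊗_A E the map s ∘ N is σ ∘ ∇ on left-invariants, a composite of colinear maps.
Injectivity of `invIncl` brings this back to ₀E ⊗ ₀E. -/
lemma isHom_restriction {H : Type*} [Ring H] [Bialgebra ℂ H] {S : H →ₗ[ℂ] H} (hS : IsAntipode S)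
    {B : BicovariantBimodule H E} {σ : Two B →ₗ[ℂ] Two B} (hσ : IsBraiding B σ)
    {nab : E →ₗ[ℂ] Two B} (hn : IsHom B.toBicomodule (Bal.bicomodule B B) .id nab)
    {s : Module.End ℂ (Inv B ⊗[ℂ] Inv B)} (hs : IsRestriction B σ s)
    {N : Inv B →ₗ[ℂ] Inv B ⊗[ℂ] Inv B} (hN : ∀ ω : Inv B, invIncl B (N ω) = nab ω) :
    IsHom (invBicomodule B.toBicomodule) (Bal.codiag (invBicomodule B.toBicomodule)
      (invBicomodule B.toBicomodule)) .id (s ∘ₗ N) := by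
  refine isHom_of_invIncl B hS ?_
  have e : invIncl B ∘ₗ s ∘ₗ N = σ ∘ₗ nab ∘ₗ (leftInv B.toBicomodule).subtype :=
    LinearMap.ext fun v ↦ (LinearMap.congr_fun hs (N v)).trans (congrArg σ (hN v))
  have h := isHom_comp (isHom_braiding hS B hσ) (isHom_comp hn (isHom_subtype B.toBicomodule))
  rw [LinearMap.id_comp, LinearMap.id_comp] at h
  rwa [e]

/-- The witnesses correspond bijectively: ₀σ and the symmetric projection are conjugated by the
restriction of ξ, and the restriction of ∇ is composed with it. Under this correspondence the
contraction is unchanged by `contract_gΩ`. -/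
lemma isMetricCompatible_twist_iff (hσ : IsBraiding B σ) (hg : IsBiinvariantMetric B σ g)
    (hg' : IsBiinvariantMetric (B.twist 𝓒) (σΩ B σ 𝓒) (gΩ B g 𝓒))
    (hn : IsHom B.toBicomodule (Bal.bicomodule B B) .id nab) :
    IsMetricCompatible (B.twist 𝓒) (dΩ d 𝓒) (σΩ B σ 𝓒) (gΩ B g 𝓒) (nablaΩ B nab 𝓒) ↔
      IsMetricCompatible B d σ g nab := by
  have hS := isAntipode_antipode A
  have hh := (isBiinvariantMetric_iff.1 hg).2
  have hh' := (isBiinvariantMetric_iff.1 hg').2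
  rw [isMetricCompatible_iff hh hg.rmul, isMetricCompatible_iff hh' hg'.rmul]
  set y := ξInv B 𝓒
  let c : (Inv (B.twist 𝓒) →ₗ[ℂ] Inv (B.twist 𝓒) ⊗[ℂ] Inv (B.twist 𝓒)) ≃
      (Inv B →ₗ[ℂ] Inv B ⊗[ℂ] Inv B) := (LinearEquiv.arrowCongr (invEquiv B 𝓒) y).toEquiv
  have hc (N v) : c N v = y (N ((invEquiv B 𝓒).symm v)) := rfl
  -- Reindexing the existential witnesses along bijections reduces the equivalence to one fixed
  -- triple s, P, N.
  rw [← y.conj.toEquiv.exists_congr_right]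
  refine exists_congr fun s ↦ ?_
  rw [← y.conj.toEquiv.exists_congr_right]
  refine exists_congr fun P ↦ ?_
  rw [← c.exists_congr_right]
  refine exists_congr fun N ↦ ?_
  refine (and_congr (isRestriction_twist_iff 𝓒) (and_congr (isSymProj_twist_iff 𝓒)
    (and_congr_left' ?_))).trans (and_congr_right fun hs ↦ and_congr_right fun hP ↦
      and_congr_right fun hN ↦ ?_)
  · rw [(invEquiv B 𝓒).symm.surjective.forall]
    refine forall_congr' fun v ↦ ?_
    rw [← (Bal.ξ B B 𝓒).injective.eq_iff, ξ_invIncl, ξ_nablaΩ, hc]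
    rfl
  · have hM := isHom_restriction hS hσ hn hs hN
    rw [y.symm.surjective.forall]
    refine forall_congr' fun t ↦ ?_
    have h := contract_gΩ 𝓒 hh hh' hM (y.conj P t)
    have e₁ : y.symm.toLinearMap ∘ₗ (y.conj s ∘ₗ c N) ∘ₗ (invEquiv B 𝓒).toLinearMap = s ∘ₗ N := by
      refine LinearMap.ext fun v ↦ ?_
      simp only [LinearMap.comp_apply, LinearEquiv.coe_coe, hc, LinearEquiv.conj_apply_apply,
        LinearEquiv.symm_apply_apply]
    have e₂ : y.symm (y.conj P t) = P (y.symm t) := by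
      rw [LinearEquiv.conj_apply_apply, LinearEquiv.symm_apply_apply]
    rw [e₂] at h
    refine Eq.congr ?_ rfl
    refine Eq.trans ?_ h
    rw [e₁]

lemma isBicovariantLeviCivita_twist_iff (hd : IsHom (self A) B.toBicomodule .id d)
    (hσ : IsBraiding B σ) (hg : IsBiinvariantMetric B σ g)
    (hg' : IsBiinvariantMetric (B.twist 𝓒) (σΩ B σ 𝓒) (gΩ B g 𝓒)) :
    IsBicovariantLeviCivita (B.twist 𝓒) (dΩ d 𝓒) (σΩ B σ 𝓒) (gΩ B g 𝓒) (nablaΩ B nab 𝓒) ↔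
      IsBicovariantLeviCivita B d σ g nab := by
  constructor
  · intro h
    have hn := (isHom_nablaΩ_iff 𝓒).1 ⟨h.left_covariant, h.right_covariant⟩
    exact ⟨⟨(isConnection_twist_iff 𝓒 hd hn).1 h.connection, hn.1,
      (isTorsionless_twist_iff 𝓒 hd).1 h.torsionless,
      (isMetricCompatible_twist_iff 𝓒 hσ hg hg' hn).1 h.compatible⟩, hn.2⟩
  · intro h
    have hn : IsHom B.toBicomodule (Bal.bicomodule B B) .id nab :=
      ⟨h.left_covariant, h.right_covariant⟩
    have hn' := (isHom_nablaΩ_iff 𝓒).2 hn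
    exact ⟨⟨(isConnection_twist_iff 𝓒 hd hn).2 h.connection, hn'.1,
      (isTorsionless_twist_iff 𝓒 hd).2 h.torsionless,
      (isMetricCompatible_twist_iff 𝓒 hσ hg hg' hn).2 h.compatible⟩, hn'.2⟩

lemma exists_nablaΩ_eq (nab' : E →ₗ[ℂ] Two (B.twist 𝓒)) : ∃ nab, nablaΩ B nab 𝓒 = nab' :=
  ⟨(Bal.ξ B B 𝓒).toLinearMap ∘ₗ nab', LinearMap.ext fun x ↦ by
    simp only [nablaΩ, LinearMap.comp_apply, LinearEquiv.coe_coe, LinearEquiv.symm_apply_apply]⟩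

end levi_civita

end BicovariantCalculus

end

end

theorem mainTheorem2 {A E : Type*} [Ring A] [HopfAlgebra ℂ A] [AddCommGroup E] [Module ℂ E]
    (S : Bimodule A E) (d : A →ₗ[ℂ] E) (h : IsBicovariantCalculus S d)
    [FiniteDimensional ℂ (leftInv h.bicov.toBicomodule)]
    [FiniteDimensional ℂ (rightInv h.bicov.toBicomodule)]
    (𝓒 : DualTwoCocycle A) :
    (∃ T : Twist 𝓒 →ₗ[ℂ] Twist 𝓒, IsAntipode T) ∧
    (∃ h' : IsBicovariantCalculus (h.bicov.twist 𝓒).toBimodule (dΩ d 𝓒),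
      h'.bicov = h.bicov.twist 𝓒) ∧
    (∃! σ, IsBraiding h.bicov σ) ∧
    (∃! σ', IsBraiding (h.bicov.twist 𝓒) σ') ∧
    ∀ σ, IsBraiding h.bicov σ →
      IsBraiding (h.bicov.twist 𝓒) (σΩ h.bicov σ 𝓒) ∧
      (IsDiagonalisable h.bicov σ →
        IsDiagonalisable (h.bicov.twist 𝓒) (σΩ h.bicov σ 𝓒)) ∧
      (∀ g', IsBiinvariantMetric (h.bicov.twist 𝓒) (σΩ h.bicov σ 𝓒) g' →
        ∃ g, IsBiinvariantMetric h.bicov σ g ∧ gΩ h.bicov g 𝓒 = g') ∧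
      ∀ g, IsBiinvariantMetric h.bicov σ g →
        IsBiinvariantMetric (h.bicov.twist 𝓒) (σΩ h.bicov σ 𝓒) (gΩ h.bicov g 𝓒) ∧
        (IsDiagonalisable h.bicov σ →
          ∀ nab, IsBicovariantLeviCivita h.bicov d σ g nab →
            IsBicovariantLeviCivita (h.bicov.twist 𝓒) (dΩ d 𝓒) (σΩ h.bicov σ 𝓒)
              (gΩ h.bicov g 𝓒) (nablaΩ h.bicov nab 𝓒) ∧
            ((∀ nab', IsBicovariantLeviCivita h.bicov d σ g nab' → nab' = nab) →
              ∀ nab', IsBicovariantLeviCivita (h.bicov.twist 𝓒) (dΩ d 𝓒) (σΩ h.bicov σ 𝓒)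
                (gΩ h.bicov g 𝓒) nab' → nab' = nablaΩ h.bicov nab 𝓒)) := by
  have hd := h.isHom_d
  have hS := isAntipode_antipode A
  obtain ⟨T, hT⟩ := Twist.exists_isAntipode 𝓒
  have hc : IsCalculus h.bicov.toBimodule d := h.toIsCalculus
  have hc' := isBicovariantCalculus_of_isHom (isHom_dΩ 𝓒 hd)
    (IsCalculus.twist 𝓒 hd hc h.formMap_surjective)
  refine ⟨⟨T, hT⟩, ⟨hc', IsBicovariantCalculus.bicov_eq (isHom_dΩ 𝓒 hd) hc'⟩, ?_, ?_, fun σ hσ ↦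
    ⟨hσ.twist 𝓒, fun h ↦ h.twist 𝓒, fun g' hg' ↦ ?_, fun g hg ↦ ?_⟩⟩
  · obtain ⟨σ, hσ⟩ := exists_isBraiding hS h.bicov
    exact ⟨σ, hσ, fun σ' hσ' ↦ isBraiding_unique hS h.bicov hσ' hσ⟩
  -- Existence and uniqueness of a braiding need only some antipode, so they apply directly to the
  -- deformed bimodule with T.
  · obtain ⟨σ, hσ⟩ := exists_isBraiding hT (h.bicov.twist 𝓒)
    exact ⟨σ, hσ, fun σ' hσ' ↦ isBraiding_unique hT (h.bicov.twist 𝓒) hσ' hσ⟩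
  · obtain ⟨g, rfl⟩ := exists_gΩ_eq 𝓒 g'
    exact ⟨g, (isBiinvariantMetric_twist_iff 𝓒).1 hg', rfl⟩
  · have hg' := (isBiinvariantMetric_twist_iff 𝓒).2 hg
    refine ⟨hg', fun _ nab hn ↦ ⟨(isBicovariantLeviCivita_twist_iff 𝓒 hd hσ hg hg').2 hn,
      fun hu nab' hn' ↦ ?_⟩⟩
    -- Every linear map into the deformed tensor square comes from an undeformed one, and the
    -- equivalence makes that one a bicovariant Levi-Civita connection, to which uniqueness applies.
    obtain ⟨nab', rfl⟩ := exists_nablaΩ_eq 𝓒 nab'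
    rw [hu nab' ((isBicovariantLeviCivita_twist_iff 𝓒 hd hσ hg hg').1 hn')]
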